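/- Let $k$ be a field of characteristic $0$. For a $k$-scheme $Z$ and $z\in Z(k)$ let $\widehat{Z}_z=\operatorname{Spf}\widehat{\mathcal O_{Z,z}}$ be the formal neighborhood, where $\widehat{\mathcal O_{Z,z}}=\varprojlim_n\mathcal O_{Z,z}/\mathfrak m_z^n$ carries the inverse limit topology. For a set $I$ let $k[[z_i\mid i\in I]]$ be the completion of $k[z_i\mid i\in I]$ at the ideal $(z_i\mid i\in I)$, also with the inverse limit topology; products of formal schemes are taken over $k$, i.e. they correspond to completed tensor products. An affine formal $k$-scheme $\operatorname{Spf}R$ *admits a smooth factor* if there are an admissible topological $k$-algebra $S$ and an isomorphism $R\cong S\,\widehat\otimes_k\,k[[z]]$ of topological $k$-algebras. A *finite formal model* of $\widehat Z_z$ is a formal scheme $\widehat{W}_w$, with $W$ a $k$-scheme of finite type and $w\in W(k)$, such that $\widehat Z_z\cong\widehat W_w\times\operatorname{Spf}k[[z_i\mid i\in I]]$ for some set $I$; it is *minimal* if $\widehat W_w$ does not admit a smooth factor. Let $Z_\infty$ denote the arc space of $Z$; its $k$-points are the arcs $\alpha\colon\operatorname{Spec}k[[t]]\to Z$ over $k$,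 and $\alpha$ is centered at $\alpha(0)\in Z(k)$. The constant arc at $z\in Z(k)$ is the composition $\operatorname{Spec}k[[t]]\to\operatorname{Spec}k\xrightarrow{z}Z$. Let $X$ be a $k$-scheme of finite type, $x\in X(k)$, let $\widehat Y_y$ be a minimal formal model of $\widehat X_x$ ($Y$ a $k$-scheme of finite type, $y\in Y(k)$), and fix an isomorphism $\widehat X_x\cong\widehat Y_y\times\operatorname{Spf}k[[z_i\mid i\in I]]$ for some set $I$. Let $\alpha\in X_\infty(k)$ be an arc centered at $x$. It induces a homomorphism $\widehat{\mathcal O_{X,x}}\to k[[t]]$; composing it with the homomorphism $\widehat{\mathcal O_{Y,y}}\to\widehat{\mathcal O_{X,x}}$ of the projection $\widehat X_x\to\widehat Y_y$ gives an arc on $Y$, the image of $\alpha$ in $Y_\infty$. Assume that this image is the constant arc $\beta_y$ at $y$. Then: 1. there are a set $J$ and an isomorphism $\widehat{(X_\infty)}_\alpha\cong\widehat{(Y_\infty)}_{\beta_y}\times\operatorname{Spf}k[[z_j\mid j\in J]]$ of formal $k$-schemes; 2. $\widehat{(Y_\infty)}_{\beta_y}$ does not admit a smooth factor; 3. if $X\to\operatorname{Spec}k$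 is not smooth at $x$, then $\widehat{(X_\infty)}_\alpha$ has no finite formal model. -/

import Mathlib

open CategoryTheory AlgebraicGeometry IsLocalRing TensorProduct

universe u v w

namespace ArcSpaces

noncomputable section

/-! ### Hasse--Schmidt algebras -/

/-- The relations between the symbols `a⁽ⁿ⁾` (`a ∈ A`, `n ∈ ℕ`) in the Hasse--Schmidt algebra of
`A` over `k`. -/
inductive HasseSchmidt.Rel {k A : Type*} [CommRing k] [CommRing A] (φ : k →+* A) :
    MvPolynomial (A × ℕ) ℤ → Prop
  | add (a b : A) (n : ℕ) : Rel φ (.X (a + b, n) - (.X (a, n) + .X (b, n)))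
  | mul (a b : A) (n : ℕ) : Rel φ (.X (a * b, n) -
      ∑ ij ∈ Finset.HasAntidiagonal.antidiagonal n, .X (a, ij.1) * .X (b, ij.2))
  | one : Rel φ (.X (1, 0) - 1)
  | const (c : k) (n : ℕ) : Rel φ (.X (φ c, n + 1))

/-- The Hasse--Schmidt algebra of the `k`-algebra `φ : k → A`: the universal ring `B` with a ring
homomorphism `A → B[[t]]`, `a ↦ ∑ a⁽ⁿ⁾ tⁿ`, that sends the elements of `k` to constant series.
It is an `A`-algebra (in particular a `k`-algebra) through `a ↦ a⁽⁰⁾`. -/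
def HasseSchmidt {k A : Type*} [CommRing k] [CommRing A] (φ : k →+* A) : Type _ :=
  MvPolynomial (A × ℕ) ℤ ⧸ Ideal.span ({P | HasseSchmidt.Rel φ P})

namespace HasseSchmidt

variable {k A B C : Type*} [CommRing k] [CommRing A] [CommRing B] [CommRing C]
  (φ : k →+* A)

instance : CommRing (HasseSchmidt φ) := inferInstanceAs (CommRing (_ ⧸ _))

/-- The element `a⁽ⁿ⁾`. -/
def d (n : ℕ) (a : A) : HasseSchmidt φ :=
  Ideal.Quotient.mk (Ideal.span ({P | Rel φ P})) (.X (a, n))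

lemma mk_eq_zero {P : MvPolynomial (A × ℕ) ℤ} (h : Rel φ P) :
    Ideal.Quotient.mk (Ideal.span ({P | Rel φ P})) P = 0 :=
  Ideal.Quotient.eq_zero_iff_mem.2 (Ideal.subset_span h)

lemma d_add (n : ℕ) (a b : A) : d φ n (a + b) = d φ n a + d φ n b := by
  have := mk_eq_zero φ (Rel.add a b n)
  rw [map_sub, sub_eq_zero, map_add] at this
  exact this

lemma d_mul (n : ℕ) (a b : A) :
    d φ n (a * b) = ∑ ij ∈ Finset.HasAntidiagonal.antidiagonal n, d φ ij.1 a * d φ ij.2 b := by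
  have := mk_eq_zero φ (Rel.mul a b n)
  rw [map_sub, sub_eq_zero, map_sum] at this
  simp only [map_mul] at this
  exact this

lemma d_zero_one : d φ 0 (1 : A) = 1 := by
  have := mk_eq_zero φ Rel.one
  rw [map_sub, sub_eq_zero, map_one] at this
  exact this

lemma d_succ_const (n : ℕ) (c : k) : d φ (n + 1) (φ c) = 0 := mk_eq_zero φ (Rel.const c n)

/-- The universal arc `A → A_∞[[t]]`, `a ↦ ∑ a⁽ⁿ⁾ tⁿ`. -/
def univArc : A →+* PowerSeries (HasseSchmidt φ) where
  toFun a := PowerSeries.mk fun n ↦ d φ n a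
  map_zero' := by
    ext n
    have := d_add φ n 0 0
    simpa using this
  map_one' := by
    ext n
    cases n with
    | zero => simpa using d_zero_one φ
    | succ n =>
      have := d_succ_const φ n 1
      rw [map_one] at this
      simpa [PowerSeries.coeff_one] using this
  map_add' a b := by
    ext n
    simpa using d_add φ n a b
  map_mul' a b := by
    ext n
    simpa [PowerSeries.coeff_mul] using d_mul φ n a b

@[simp] lemma coeff_univArc (n : ℕ) (a : A) :
    PowerSeries.coeff n (univArc φ a) = d φ n a := by simp [univArc]

/-- The structure map `A → A_∞`, `a ↦ a⁽⁰⁾`. -/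
def ofBase : A →+* HasseSchmidt φ := PowerSeries.constantCoeff.comp (univArc φ)

lemma ofBase_apply (a : A) : ofBase φ a = d φ 0 a := by
  rw [← coeff_univArc φ 0 a, PowerSeries.coeff_zero_eq_constantCoeff_apply]; rfl

variable {φ}

@[ext] lemma ringHom_ext {f g : HasseSchmidt φ →+* B} (h : ∀ n a, f (d φ n a) = g (d φ n a)) :
    f = g := by
  refine Ideal.Quotient.ringHom_ext (MvPolynomial.ringHom_ext' (RingHom.ext_int _ _) ?_)
  rintro ⟨a, n⟩
  exact h n a

/-- The universal property of the Hasse--Schmidt algebra. -/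
def lift (g : A →+* PowerSeries B) (hg : ∀ n c, PowerSeries.coeff (n + 1) (g (φ c)) = 0) :
    HasseSchmidt φ →+* B :=
  Ideal.Quotient.lift _
    (MvPolynomial.eval₂Hom (Int.castRingHom B) fun x ↦ PowerSeries.coeff x.2 (g x.1)) <| by
    intro P hP
    rw [← RingHom.mem_ker]
    revert P hP
    refine fun P hP ↦ (Ideal.span_le (I := RingHom.ker _)).2 ?_ hP
    rintro _ (⟨a, b, n⟩ | ⟨a, b, n⟩ | _ | ⟨c, n⟩)
    · simp
    · simp [PowerSeries.coeff_mul]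
    · simp
    · simp [hg]

@[simp] lemma lift_d (g : A →+* PowerSeries B)
    (hg : ∀ n c, PowerSeries.coeff (n + 1) (g (φ c)) = 0) (n : ℕ) (a : A) :
    lift g hg (d φ n a) = PowerSeries.coeff n (g a) := by
  change Ideal.Quotient.lift _ _ _ (Ideal.Quotient.mk _ _) = _
  simp

variable (φ) in
/-- Functoriality of the Hasse--Schmidt algebra. -/
def map {φ' : k →+* B} (ψ : A →+* B) (h : ψ.comp φ = φ') : HasseSchmidt φ →+* HasseSchmidt φ' :=
  lift ((univArc φ').comp ψ) fun n c ↦ by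
    have : ψ (φ c) = φ' c := by rw [← h]; rfl
    simp [this, d_succ_const]

@[simp] lemma map_d {φ' : k →+* B} (ψ : A →+* B) (h : ψ.comp φ = φ') (n : ℕ) (a : A) :
    map φ ψ h (d φ n a) = d φ' n (ψ a) := by
  simp [map]

variable (φ) in
/-- The retraction `A_∞ → A` of `A → A_∞` given by constant arcs. -/
def toBase : HasseSchmidt φ →+* A :=
  lift PowerSeries.C fun n c ↦ by simp

lemma toBase_d (n : ℕ) (a : A) : toBase φ (d φ n a) = if n = 0 then a else 0 := by
  simp [toBase, PowerSeries.coeff_C]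

/-- Hasse--Schmidt algebras commute with localization. -/
lemma isLocalizationAway_map {φ' : k →+* B} (ψ : A →+* B) (h : ψ.comp φ = φ') (f : A)
    (hf : letI := ψ.toAlgebra; IsLocalization.Away f B) :
    letI := (map φ ψ h).toAlgebra
    IsLocalization.Away (ofBase φ f) (HasseSchmidt φ') := by
  let : Algebra A B := ψ.toAlgebra
  let : Algebra (HasseSchmidt φ) (HasseSchmidt φ') := (map φ ψ h).toAlgebra
  let L := Localization.Away (ofBase φ f)
  let ι : HasseSchmidt φ →+* L := algebraMap _ _
  let g : A →+* PowerSeries L := (PowerSeries.map ι).comp (univArc φ)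
  have hg : IsUnit (g f) := by
    rw [PowerSeries.isUnit_iff_constantCoeff]
    have : PowerSeries.constantCoeff (g f) = ι (ofBase φ f) := by
      have := PowerSeries.coeff_map ι 0 (univArc φ f)
      simp only [PowerSeries.coeff_zero_eq_constantCoeff_apply] at this
      exact this
    rw [this]
    exact IsLocalization.Away.algebraMap_isUnit _
  let g' : B →+* PowerSeries L := IsLocalization.Away.lift f hg
  have hg' : ∀ a, g' (ψ a) = g a := fun a ↦ IsLocalization.Away.lift_eq f hg a
  have hψ : ∀ c, ψ (φ c) = φ' c := fun c ↦ by rw [← h]; rfl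
  let inv : HasseSchmidt φ' →+* L := lift g' fun n c ↦ by
    rw [← hψ, hg']
    simp [g, d_succ_const]
  have hu : IsUnit (map φ ψ h (ofBase φ f)) := by
    have : map φ ψ h (ofBase φ f) = ofBase φ' (ψ f) := by simp [ofBase_apply]
    rw [this]
    exact (IsLocalization.Away.algebraMap_isUnit (S := B) f).map (ofBase φ')
  let fwd : L →+* HasseSchmidt φ' := IsLocalization.Away.lift (ofBase φ f) hu
  have hfwd : ∀ a, fwd (ι a) = map φ ψ h a := fun a ↦ IsLocalization.Away.lift_eq _ hu a
  have hinvmap : ∀ a, inv (map φ ψ h a) = ι a := by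
    intro a
    have : inv.comp (map φ ψ h) = ι := by
      ext n a
      simp [inv, hg', g]
    exact congr($this a)
  have h1 : inv.comp fwd = RingHom.id L := by
    refine IsLocalization.ringHom_ext (.powers (ofBase φ f)) (RingHom.ext fun a ↦ ?_)
    change inv (fwd (ι a)) = ι a
    rw [hfwd, hinvmap]
  have h2 : fwd.comp inv = RingHom.id _ := by
    have key : (PowerSeries.map fwd).comp g' = univArc φ' := by
      refine IsLocalization.ringHom_ext (.powers f) (RingHom.ext fun a ↦ ?_)
      change PowerSeries.map fwd (g' (ψ a)) = univArc φ' (ψ a)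
      rw [hg']
      ext n
      simp [g, hfwd]
    ext n b
    have := congr(PowerSeries.coeff n ($key b))
    simpa [inv] using this
  let e : L ≃ₐ[HasseSchmidt φ] HasseSchmidt φ' :=
    { RingEquiv.ofRingHom fwd inv h2 h1 with commutes' := hfwd }
  exact IsLocalization.isLocalization_of_algEquiv _ e

end HasseSchmidt

/-! ### The arc space of a scheme -/

section ArcSpace

variable {k : Type u} [Field k] {X : Scheme.{u}} (p : X ⟶ Spec (.of k))

/-- The `k`-algebra structure on the sections over an open subset of a `k`-scheme. -/
def sectionsHom (U : X.Opens) : k →+* Γ(X, U) :=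
  ((Scheme.ΓSpecIso (.of k)).inv ≫ p.appTop ≫ X.presheaf.map (homOfLE le_top).op).hom

lemma map_comp_sectionsHom {U V : X.Opens} (i : U ⟶ V) :
    (X.presheaf.map i.op).hom.comp (sectionsHom p V) = sectionsHom p U := by
  unfold sectionsHom
  rw [← CommRingCat.hom_comp, Category.assoc, Category.assoc, ← Functor.map_comp]
  rfl

open Scheme Scheme.AffineZariskiSite

/-- The restriction maps between the Hasse--Schmidt algebras of rings of sections. -/
def hsRes {U V : X.Opens} (i : U ⟶ V) :
    HasseSchmidt (sectionsHom p V) →+* HasseSchmidt (sectionsHom p U) :=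
  HasseSchmidt.map _ (X.presheaf.map i.op).hom (map_comp_sectionsHom p i)

lemma hsRes_d {U V : X.Opens} (i : U ⟶ V) (n : ℕ) (a : Γ(X, V)) :
    hsRes p i (HasseSchmidt.d _ n a) = HasseSchmidt.d _ n (X.presheaf.map i.op a) :=
  HasseSchmidt.map_d _ _ _ _

lemma hsRes_id (U : X.Opens) : hsRes p (𝟙 U) = RingHom.id _ := by
  refine HasseSchmidt.ringHom_ext fun n a ↦ ?_
  rw [hsRes_d, op_id, X.presheaf.map_id]
  rfl

lemma hsRes_comp {U V W : X.Opens} (i : U ⟶ V) (j : V ⟶ W) :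
    hsRes p (i ≫ j) = (hsRes p i).comp (hsRes p j) := by
  refine HasseSchmidt.ringHom_ext fun n a ↦ ?_
  rw [RingHom.comp_apply, hsRes_d, hsRes_d, hsRes_d, op_comp, X.presheaf.map_comp]
  rfl

/-- The presheaf `U ↦ Γ(X, U)_∞` of Hasse--Schmidt algebras on the affine open subsets of `X`. -/
def hsPresheaf : X.AffineZariskiSiteᵒᵖ ⥤ CommRingCat.{u} where
  obj U := .of (HasseSchmidt (sectionsHom p U.unop.toOpens))
  map i := CommRingCat.ofHom (hsRes p ((toOpensFunctor X).map i.unop))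
  map_id _ := CommRingCat.hom_ext (hsRes_id p _)
  map_comp _ _ := CommRingCat.hom_ext (hsRes_comp p _ _)

/-- The inclusion `f ↦ f⁽⁰⁾` of the structure sheaf. -/
def toHSPresheaf : (toOpensFunctor X).op ⋙ X.presheaf ⟶ hsPresheaf p where
  app U := CommRingCat.ofHom (HasseSchmidt.ofBase (sectionsHom p U.unop.toOpens))
  naturality U V i := by
    ext a
    change HasseSchmidt.ofBase _ (X.presheaf.map ((toOpensFunctor X).map i.unop).op a) =
      hsRes p _ (HasseSchmidt.ofBase _ a)
    rw [HasseSchmidt.ofBase_apply, HasseSchmidt.ofBase_apply]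
    exact (hsRes_d p _ 0 a).symm

lemma coequifibered_toHSPresheaf : (toHSPresheaf p).Coequifibered := by
  refine coequifibered_iff_forall_isLocalizationAway.2 fun U f ↦ ?_
  exact HasseSchmidt.isLocalizationAway_map _ (map_comp_sectionsHom p (homOfLE (X.basicOpen_le f)))
    f (U.2.isLocalization_basicOpen f)

/-- The gluing datum consisting of the schemes `Spec Γ(X, U)_∞`, for `U ⊆ X` open affine. -/
def arcGluingData := relativeGluingData (coequifibered_toHSPresheaf p)

instance : ((arcGluingData p).functor ⋙ Scheme.forget).IsLocallyDirected :=
  Cover.RelativeGluingData.instIsLocallyDirectedI₀CompFunctorForgetOfIsThin ..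

/-- The arc space `X_∞` of a `k`-scheme `X`, glued from the spectra of the Hasse--Schmidt algebras
of the affine open subsets of `X`. -/
def arcSpace : Scheme.{u} := (arcGluingData p).glued

/-- The projection `X_∞ ⟶ X`, `α ↦ α(0)`. -/
def arcSpaceProj : arcSpace p ⟶ X := (arcGluingData p).toBase

/-- The `k`-scheme structure on the arc space. -/
def arcSpaceStr : arcSpace p ⟶ Spec (.of k) := arcSpaceProj p ≫ p

/-- The open immersion `Spec Γ(X, U)_∞ ⟶ X_∞` onto the preimage of the affine open `U`. -/
def arcChart (U : X.AffineZariskiSite) :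
    Spec (.of (HasseSchmidt (sectionsHom p U.toOpens))) ⟶ arcSpace p :=
  (arcGluingData p).cover.f U

instance (U : X.AffineZariskiSite) : IsOpenImmersion (arcChart p U) :=
  (arcGluingData p).cover.map_prop U

lemma arcChart_proj (U : X.AffineZariskiSite) :
    arcChart p U ≫ arcSpaceProj p =
      Spec.map (CommRingCat.ofHom (HasseSchmidt.ofBase (sectionsHom p U.toOpens))) ≫
        U.2.fromSpec :=
  Limits.colimit.ι_desc _ _

lemma opensRange_arcChart (U : X.AffineZariskiSite) :
    arcSpaceProj p ⁻¹ᵁ U.toOpens = (arcChart p U).opensRange := by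
  simpa using! (arcGluingData p).toBase_preimage_eq_opensRange_ι U

lemma arcChart_w {U V : X.AffineZariskiSite} (i : U ⟶ V) :
    Spec.map (CommRingCat.ofHom (hsRes p (homOfLE (toOpens_mono i.le)))) ≫ arcChart p V =
      arcChart p U :=
  Limits.colimit.w (arcGluingData p).functor i

lemma toBase_comp_ofBase {k A : Type*} [CommRing k] [CommRing A] (φ : k →+* A) :
    (HasseSchmidt.toBase φ).comp (HasseSchmidt.ofBase φ) = RingHom.id A := by
  ext a
  simp [HasseSchmidt.ofBase_apply, HasseSchmidt.toBase_d]

lemma toBase_comp_hsRes {U V : X.Opens} (i : U ⟶ V) :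
    (HasseSchmidt.toBase (sectionsHom p U)).comp (hsRes p i) =
      (X.presheaf.map i.op).hom.comp (HasseSchmidt.toBase (sectionsHom p V)) := by
  refine HasseSchmidt.ringHom_ext fun n a ↦ ?_
  rw [RingHom.comp_apply, RingHom.comp_apply, hsRes_d, HasseSchmidt.toBase_d, HasseSchmidt.toBase_d]
  split_ifs
  · rfl
  · exact (map_zero _).symm

/-- The constant arcs in an affine open `U`. -/
def constArcsChart (U : X.AffineZariskiSite) : Spec Γ(X, U.toOpens) ⟶ arcSpace p :=
  Spec.map (CommRingCat.ofHom (HasseSchmidt.toBase (sectionsHom p U.toOpens))) ≫ arcChart p U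

lemma map_constArcsChart {U V : X.AffineZariskiSite} (i : U ⟶ V) :
    Spec.map (X.presheaf.map (homOfLE (toOpens_mono i.le)).op) ≫ constArcsChart p V =
      constArcsChart p U := by
  have h : CommRingCat.ofHom (HasseSchmidt.toBase (sectionsHom p V.toOpens)) ≫
      X.presheaf.map (homOfLE (toOpens_mono i.le)).op =
      CommRingCat.ofHom (hsRes p (homOfLE (toOpens_mono i.le))) ≫
        CommRingCat.ofHom (HasseSchmidt.toBase (sectionsHom p U.toOpens)) :=
    CommRingCat.hom_ext (toBase_comp_hsRes p _).symm
  rw [constArcsChart, constArcsChart, ← Category.assoc, ← Spec.map_comp, h, Spec.map_comp,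
    Category.assoc, arcChart_w p i]

/-- The section `ι_∞ : X ⟶ X_∞` that sends a point to the constant arc at this point. -/
def constArcs : X ⟶ arcSpace p :=
  (isColimitCocone X).desc
    { pt := arcSpace p
      ι :=
        { app := constArcsChart p
          naturality _ _ i := (map_constArcsChart p i).trans (Category.comp_id _).symm } }

lemma fromSpec_constArcs (U : X.AffineZariskiSite) :
    U.2.fromSpec ≫ constArcs p = constArcsChart p U :=
  (isColimitCocone X).fac _ U

lemma constArcs_proj : constArcs p ≫ arcSpaceProj p = 𝟙 X := by
  refine (isColimitCocone X).hom_ext fun U ↦ ?_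
  change U.2.fromSpec ≫ constArcs p ≫ arcSpaceProj p = U.2.fromSpec ≫ 𝟙 X
  rw [← Category.assoc, fromSpec_constArcs, constArcsChart, Category.assoc, arcChart_proj,
    ← Category.assoc, ← Spec.map_comp, Category.comp_id, ← CommRingCat.ofHom_comp,
    toBase_comp_ofBase]
  exact (congrArg (· ≫ _) (Spec.map_id _)).trans (Category.id_comp _)

lemma exists_affineNhd (x : X) : ∃ U : X.AffineZariskiSite, x ∈ U.toOpens := by
  obtain ⟨_, ⟨U, hU, rfl⟩, hx, -⟩ :=
    X.isBasis_affineOpens.exists_subset_of_mem_open (Set.mem_univ x) isOpen_univ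
  exact ⟨⟨U, hU⟩, hx⟩

/-- A chosen affine open neighbourhood of a point. -/
def affineNhd (x : X) : X.AffineZariskiSite := (exists_affineNhd x).choose

lemma mem_affineNhd (x : X) : x ∈ (affineNhd x).toOpens := (exists_affineNhd x).choose_spec

/-- The point of a scheme underlying a morphism from `Spec k`. -/
def pt {Z : Scheme.{u}} (z : Spec (.of k) ⟶ Z) : Z := z (closedPoint k)

variable {p} in
/-- A `k`-valued point of the arc space as a point of an affine chart. -/
def pointToChart (α : Spec (.of k) ⟶ arcSpace p) :
    Spec (.of k) ⟶
      Spec (.of (HasseSchmidt (sectionsHom p (affineNhd (pt (α ≫ arcSpaceProj p))).toOpens))) :=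
  IsOpenImmersion.lift (arcChart p _) α <| by
    rintro _ ⟨z, rfl⟩
    have hz : z = closedPoint k := Subsingleton.elim (α := PrimeSpectrum k) _ _
    subst hz
    have h : α (closedPoint k) ∈ arcSpaceProj p ⁻¹ᵁ
        (affineNhd (pt (α ≫ arcSpaceProj p))).toOpens := by
      have := mem_affineNhd (pt (α ≫ arcSpaceProj p))
      exact this
    rw [opensRange_arcChart] at h
    exact h

variable {p} in
/-- The arc `Spec k[[t]] ⟶ X` corresponding to a `k`-valued point `α` of `X_∞`: on an affine
neighbourhood `U` of `α(0)` it is given by `f ↦ ∑ f⁽ⁿ⁾(α) tⁿ` for `f ∈ Γ(X, U)`. -/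
def arcOfPoint (α : Spec (.of k) ⟶ arcSpace p) : Spec (.of (PowerSeries k)) ⟶ X :=
  Spec.map (CommRingCat.ofHom
    ((PowerSeries.map (Spec.preimage (pointToChart α)).hom).comp (HasseSchmidt.univArc _))) ≫
  (affineNhd (pt (α ≫ arcSpaceProj p))).2.fromSpec

lemma arcOfPoint_zero (α : Spec (.of k) ⟶ arcSpace p) :
    Spec.map (CommRingCat.ofHom PowerSeries.constantCoeff) ≫ arcOfPoint α =
      α ≫ arcSpaceProj p := by
  have h1 : pointToChart α ≫ arcChart p _ = α := IsOpenImmersion.lift_fac _ _ _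
  conv_rhs => rw [← h1, Category.assoc, arcChart_proj]
  rw [arcOfPoint, ← Category.assoc, ← Category.assoc]
  congr 1
  rw [← Spec.map_comp]
  conv_rhs => rw [← Spec.map_preimage (pointToChart α), ← Spec.map_comp]
  congr 1

lemma arcOfPoint_closedPoint (α : Spec (.of k) ⟶ arcSpace p) :
    arcOfPoint α (closedPoint (PowerSeries k)) = pt (α ≫ arcSpaceProj p) := by
  rw [← arcOfPoint_zero]
  refine (congrArg (arcOfPoint α) ?_).symm
  have : IsLocalHom (PowerSeries.constantCoeff (R := k)) :=
    ⟨fun f hf ↦ PowerSeries.isUnit_iff_constantCoeff.2 hf⟩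
  exact IsLocalRing.comap_closedPoint (PowerSeries.constantCoeff (R := k))

/-- The point `ι_∞(x)` of `X_∞` corresponds to the arc `Spec k[[t]] ⟶ Spec k ⟶ X`. -/
lemma arcOfPoint_constArcs (y : Spec (.of k) ⟶ X) : arcOfPoint (y ≫ constArcs p) =
    Spec.map (CommRingCat.ofHom (PowerSeries.C (R := k))) ≫ y := by
  set α := y ≫ constArcs p with hα
  have hα2 : α ≫ arcSpaceProj p = y := by simp [hα, constArcs_proj]
  set U := affineNhd (pt (α ≫ arcSpaceProj p)) with hU
  have hmem : pt y ∈ U.toOpens := by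
    have := mem_affineNhd (pt (α ≫ arcSpaceProj p))
    rw [hα2] at this
    rw [hU, hα2]
    exact this
  have hrange : Set.range y ⊆ Set.range U.2.fromSpec := by
    rintro _ ⟨z, rfl⟩
    have hz : z = closedPoint k := Subsingleton.elim (α := PrimeSpectrum k) _ _
    subst hz
    rw [U.2.range_fromSpec]; exact hmem
  let y' := IsOpenImmersion.lift U.2.fromSpec y hrange
  have hy' : y' ≫ U.2.fromSpec = y := IsOpenImmersion.lift_fac _ _ _
  have h1 : pointToChart α = y' ≫ Spec.map (CommRingCat.ofHom (HasseSchmidt.toBase (sectionsHom p U.toOpens))) := by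
    rw [← cancel_mono (arcChart p U)]
    refine (IsOpenImmersion.lift_fac _ _ _).trans ?_
    rw [hα, ← hy', Category.assoc, Category.assoc, fromSpec_constArcs]; rfl
  rw [arcOfPoint]
  conv_rhs => rw [← hy', ← Spec.map_preimage y', ← Category.assoc, ← Spec.map_comp]
  congr 2
  refine CommRingCat.hom_ext (RingHom.ext fun a ↦ PowerSeries.ext fun n ↦ ?_)
  have h2 : Spec.preimage (pointToChart α) = CommRingCat.ofHom (HasseSchmidt.toBase (sectionsHom p U.toOpens)) ≫ Spec.preimage y' := by
    apply Spec.map_injective; rw [Spec.map_preimage, Spec.map_comp, Spec.map_preimage, h1]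
  change PowerSeries.coeff n (PowerSeries.map (Spec.preimage (pointToChart α)).hom (HasseSchmidt.univArc _ a)) = PowerSeries.coeff n (PowerSeries.C ((Spec.preimage y').hom a))
  rw [PowerSeries.coeff_map, HasseSchmidt.coeff_univArc, h2]
  change (Spec.preimage y').hom (HasseSchmidt.toBase _ (HasseSchmidt.d _ n a)) = _
  rw [HasseSchmidt.toBase_d, PowerSeries.coeff_C]
  split_ifs <;> simp

/-- A `k`-valued point of `X_∞` is determined by its arc. -/
lemma eq_of_arcOfPoint_eq (α β : Spec (.of k) ⟶ arcSpace p) (h : arcOfPoint α = arcOfPoint β) : α = β := by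
  have h0 : α ≫ arcSpaceProj p = β ≫ arcSpaceProj p := by rw [← arcOfPoint_zero, h, arcOfPoint_zero]
  have key : ∀ (U : X.AffineZariskiSite) (f g : Spec (.of k) ⟶ Spec (.of (HasseSchmidt (sectionsHom p U.toOpens)))),
     Spec.map (CommRingCat.ofHom ((PowerSeries.map (Spec.preimage f).hom).comp (HasseSchmidt.univArc _))) ≫ U.2.fromSpec =
     Spec.map (CommRingCat.ofHom ((PowerSeries.map (Spec.preimage g).hom).comp (HasseSchmidt.univArc _))) ≫ U.2.fromSpec → f = g := by
    intro U f g hfg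
    have h1 := (cancel_mono _).1 hfg
    have h2 := congrArg CommRingCat.Hom.hom (Spec.map_injective h1)
    rw [← Spec.map_preimage f, ← Spec.map_preimage g]
    congr 1
    refine CommRingCat.hom_ext (HasseSchmidt.ringHom_ext fun n a ↦ ?_)
    have := congr(PowerSeries.coeff n ($h2 a))
    simpa using this
  have fac (γ : Spec (.of k) ⟶ arcSpace p) : pointToChart γ ≫ arcChart p _ = γ := IsOpenImmersion.lift_fac _ _ _
  have key2 : ∀ (a b : Spec (.of k) ⟶ X) (hab : a = b)
     (f : Spec (.of k) ⟶ Spec (.of (HasseSchmidt (sectionsHom p (affineNhd (pt a)).toOpens))))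
     (g : Spec (.of k) ⟶ Spec (.of (HasseSchmidt (sectionsHom p (affineNhd (pt b)).toOpens)))),
     Spec.map (CommRingCat.ofHom ((PowerSeries.map (Spec.preimage f).hom).comp (HasseSchmidt.univArc _))) ≫ (affineNhd (pt a)).2.fromSpec =
     Spec.map (CommRingCat.ofHom ((PowerSeries.map (Spec.preimage g).hom).comp (HasseSchmidt.univArc _))) ≫ (affineNhd (pt b)).2.fromSpec → f ≫ arcChart p _ = g ≫ arcChart p _ := by
    rintro a _ rfl f g hfg
    rw [key _ f g hfg]
  rw [← fac α, ← fac β]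
  exact key2 _ _ h0 _ _ h

/-- The local ring `𝒪_{X,x}` at the image of a `k`-valued point, as a `k`-algebra. -/
def LocalRingAt (_p : X ⟶ Spec (.of k)) (x : Spec (.of k) ⟶ X) : Type u := X.presheaf.stalk (pt x)

instance (x : Spec (.of k) ⟶ X) : CommRing (LocalRingAt p x) :=
  inferInstanceAs (CommRing (X.presheaf.stalk (pt x)))

instance (x : Spec (.of k) ⟶ X) : IsLocalRing (LocalRingAt p x) :=
  inferInstanceAs (IsLocalRing (X.presheaf.stalk (pt x)))

instance (x : Spec (.of k) ⟶ X) : Algebra k (LocalRingAt p x) :=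
  ((X.presheaf.germ ⊤ (pt x) trivial).hom.comp (sectionsHom p ⊤)).toAlgebra

/-- The homomorphism `𝒪_{X,x} → k[[t]]` corresponding to an arc `a` with `a(0) = x`. -/
def arcStalkHom (a : Spec (.of (PowerSeries k)) ⟶ X) (x : Spec (.of k) ⟶ X)
    (h : a (closedPoint (PowerSeries k)) = pt x) : LocalRingAt p x →+* PowerSeries k :=
  (X.presheaf.stalkSpecializes (specializes_of_eq h) ≫ Scheme.stalkClosedPointTo a).hom

instance (a : Spec (.of (PowerSeries k)) ⟶ X) (x : Spec (.of k) ⟶ X)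
    (h : a (closedPoint (PowerSeries k)) = pt x) : IsLocalHom (arcStalkHom p a x h) := by
  have : IsIso (X.presheaf.stalkSpecializes (specializes_of_eq h)) :=
    inferInstanceAs (IsIso (X.presheaf.stalkCongr (.of_eq h.symm)).hom)
  exact CommRingCat.isLocalHom_comp (X.presheaf.stalkSpecializes (specializes_of_eq h))
    (Scheme.stalkClosedPointTo a)

lemma arcStalkHom_mem (a : Spec (.of (PowerSeries k)) ⟶ X) (x : Spec (.of k) ⟶ X)
    (h : a (closedPoint (PowerSeries k)) = pt x) :
    maximalIdeal (LocalRingAt p x) ≤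
      (Ideal.span {PowerSeries.X}).comap (arcStalkHom p a x h) := by
  intro f hf
  rw [Ideal.mem_comap, Ideal.mem_span_singleton, PowerSeries.X_dvd_iff]
  by_contra hne
  exact hf (isUnit_of_map_unit (arcStalkHom p a x h) f
    (PowerSeries.isUnit_iff_constantCoeff.2 (isUnit_iff_ne_zero.2 hne)))

end ArcSpace

/-! ### Formal neighborhoods as topological algebras -/

section Topological

/-- The inverse limit topology on the completion `lim R / Iⁿ`, with discrete `R / Iⁿ`. -/
instance adicCompletionTopology {R : Type*} [CommRing R] (I : Ideal R) :
    TopologicalSpace (AdicCompletion I R) :=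
  ⨅ n, TopologicalSpace.induced (AdicCompletion.evalₐ I n) ⊥

/-- The homomorphism `lim A / Iⁿ → B / Jⁿ` induced by a ring homomorphism that maps `I` into `J`. -/
def completionLiftAux {A B : Type*} [CommRing A] [CommRing B] (I : Ideal A) (J : Ideal B)
    (f : A →+* B) (h : I ≤ J.comap f) (n : ℕ) : AdicCompletion I A →+* B ⧸ J ^ n :=
  (Ideal.quotientMap (J ^ n) f ((Ideal.pow_right_mono h n).trans (Ideal.le_comap_pow f n))).comp
    (AdicCompletion.evalₐ I n : AdicCompletion I A →+* A ⧸ I ^ n)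

lemma factorPow_comp_completionLiftAux {A B : Type*} [CommRing A] [CommRing B] (I : Ideal A)
    (J : Ideal B) (f : A →+* B) (h : I ≤ J.comap f) {m n : ℕ} (hle : m ≤ n) :
    (Ideal.Quotient.factorPow J hle).comp (completionLiftAux I J f h n) =
      completionLiftAux I J f h m := by
  ext x
  obtain ⟨y, rfl⟩ := AdicCompletion.mk_surjective I A x
  have hm : Ideal.Quotient.mk (I ^ m) (y.val n) = Ideal.Quotient.mk (I ^ m) (y.val m) :=
    AdicCompletion.Ideal.mk_eq_mk I hle y
  have := congrArg (Ideal.quotientMap (J ^ m) f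
    ((Ideal.pow_right_mono h m).trans (Ideal.le_comap_pow f m))) hm
  simpa [completionLiftAux, AdicCompletion.evalₐ_mk] using this

/-- The extension of a ring homomorphism `A → B` to the `I`-adic completion of `A`, where `B` is
`J`-adically complete and `I` is mapped into `J`. -/
def completionLift {A B : Type*} [CommRing A] [CommRing B] (I : Ideal A) (J : Ideal B)
    [IsAdicComplete J B] (f : A →+* B) (h : I ≤ J.comap f) : AdicCompletion I A →+* B :=
  IsAdicComplete.liftRingHom J (completionLiftAux I J f h)
    (factorPow_comp_completionLiftAux I J f h)

lemma completionLift_of {A B : Type*} [CommRing A] [CommRing B] (I : Ideal A) (J : Ideal B)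
    [IsAdicComplete J B] (f : A →+* B) (h : I ≤ J.comap f) (a : A) :
    completionLift I J f h (algebraMap A _ a) = f a := by
  refine IsHausdorff.eq_iff_smodEq (I := J) |>.2 fun n ↦ ?_
  rw [smul_eq_mul, Ideal.mul_top, SModEq.def]
  refine (IsAdicComplete.mk_liftRingHom J _ (factorPow_comp_completionLiftAux I J f h) n _).trans ?_
  have : AdicCompletion.evalₐ I n (algebraMap A _ a) = Ideal.Quotient.mk (I ^ n) a :=
    AdicCompletion.evalₐ_of I n a
  simp [completionLiftAux, this]

/-- The topological ring `k[[z_i | i ∈ I]]`, the completion of the polynomial ring `k[z_i | i ∈ I]`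
at the ideal generated by the variables. For infinite `I` this is not `MvPowerSeries I k`: the
homogeneous components of its elements are polynomials. -/
abbrev PowerSeriesRing (k : Type u) [Field k] (I : Type v) : Type (max u v) :=
  AdicCompletion (Ideal.span (Set.range (MvPolynomial.X : I → MvPolynomial I k)))
    (MvPolynomial I k)

variable (k : Type u) [Field k]

/-- The open ideals of a topological ring. -/
abbrev OpenIdeal (R : Type*) [CommRing R] [TopologicalSpace R] : Type _ :=
  {𝔞 : Ideal R // IsOpen (𝔞 : Set R)}

section

variable (R : Type v) (S : Type w) [CommRing R] [Algebra k R] [TopologicalSpace R]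
    [CommRing S] [Algebra k S] [TopologicalSpace S]

/-- The quotient map `R/𝔞 ⊗_k S/𝔟 → R/𝔞' ⊗_k S/𝔟'` for `𝔞 ≤ 𝔞'` and `𝔟 ≤ 𝔟'`. -/
def tensorTransition (i j : OpenIdeal R × OpenIdeal S) (h : i ≤ j) :
    ((R ⧸ i.1.1) ⊗[k] (S ⧸ i.2.1)) →ₐ[k] ((R ⧸ j.1.1) ⊗[k] (S ⧸ j.2.1)) :=
  Algebra.TensorProduct.map (Ideal.Quotient.factorₐ k (show i.1.1 ≤ j.1.1 from h.1))
    (Ideal.Quotient.factorₐ k (show i.2.1 ≤ j.2.1 from h.2))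

/-- The completed tensor product `R ⊗̂_k S` of two linearly topologized `k`-algebras (`k` discrete):
the inverse limit of the algebras `R/𝔞 ⊗_k S/𝔟` over all open ideals `𝔞 ⊆ R`, `𝔟 ⊆ S`. It is the
ring of functions of the product of the formal spectra of `R` and `S` over `k`. -/
def completedTensor :
    Subalgebra k (∀ i : OpenIdeal R × OpenIdeal S, (R ⧸ i.1.1) ⊗[k] (S ⧸ i.2.1)) where
  carrier := {f | ∀ i j (h : i ≤ j), tensorTransition k R S i j h (f i) = f j}
  mul_mem' hf hg i j h :=
    (map_mul (tensorTransition k R S i j h) _ _).trans (congrArg₂ _ (hf i j h) (hg i j h))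
  add_mem' hf hg i j h :=
    (map_add (tensorTransition k R S i j h) _ _).trans (congrArg₂ _ (hf i j h) (hg i j h))
  algebraMap_mem' c i j h := (tensorTransition k R S i j h).commutes c

/-- The inverse limit topology, with discrete `R/𝔞 ⊗_k S/𝔟`. -/
instance completedTensorTopology : TopologicalSpace (completedTensor k R S) :=
  ⨅ i, TopologicalSpace.induced (fun f ↦ f.1 i) ⊥

/-- The canonical homomorphism `R → R ⊗̂_k S`, `r ↦ r ⊗ 1`. -/
def completedTensorInl : R →ₐ[k] completedTensor k R S :=
  AlgHom.codRestrict
    (AlgHom.pi fun i ↦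
      (Algebra.TensorProduct.includeLeft : (R ⧸ i.1.1) →ₐ[k] (R ⧸ i.1.1) ⊗[k] (S ⧸ i.2.1)).comp
        (Ideal.Quotient.mkₐ k i.1.1))
    (completedTensor k R S) fun r i j h ↦ by
      change tensorTransition k R S i j h (Ideal.Quotient.mk i.1.1 r ⊗ₜ[k] 1) =
        Ideal.Quotient.mk j.1.1 r ⊗ₜ[k] 1
      rw [tensorTransition, Algebra.TensorProduct.map_tmul, map_one]
      rfl

end

/-- Admissible rings: complete separated linearly topologized rings with an ideal of definition. -/
structure IsAdmissibleRing (S : Type*) [CommRing S] [TopologicalSpace S] : Prop where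
  isTopologicalRing : IsTopologicalRing S
  isLinearTopology : IsLinearTopology S S
  t2 : T2Space S
  complete : letI := IsTopologicalAddGroup.rightUniformSpace S
    CompleteSpace S
  exists_idealOfDefinition : ∃ J : Ideal S, IsOpen (J : Set S) ∧
    ∀ V ∈ nhds (0 : S), ∃ n : ℕ, ((J ^ n : Ideal S) : Set S) ⊆ V

/-- `Spf R` admits a smooth factor: `R ≅ S ⊗̂_k k[[z]]` for an admissible `k`-algebra `S`. -/
def HasSmoothFactor (R : Type u) [CommRing R] [Algebra k R] [TopologicalSpace R] : Prop :=
  ∃ (S : Type u) (_ : CommRing S) (_ : Algebra k S) (_ : TopologicalSpace S),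
    IsAdmissibleRing S ∧ Nonempty (R ≃A[k] completedTensor k S (PowerSeriesRing k PUnit.{1}))

end Topological

section Formal

variable {k : Type u} [Field k] {X : Scheme.{u}} (p : X ⟶ Spec (.of k))

/-- The ring of the formal neighborhood of `X` at a `k`-rational point `x`: the completion of
`𝒪_{X,x}` at its maximal ideal, with the inverse limit topology. -/
abbrev FormalNbhd (x : Spec (.of k) ⟶ X) : Type u :=
  AdicCompletion (maximalIdeal (LocalRingAt p x)) (LocalRingAt p x)

/-- A topological `k`-algebra `R` has a finite formal model: `R ≅ 𝒪^_{Y,y} ⊗̂_k k[[z_i | i ∈ I]]`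
with a `k`-scheme `Y` of finite type and `y ∈ Y(k)`. -/
def HasFiniteFormalModel (k : Type u) [Field k] (R : Type u) [CommRing R] [Algebra k R]
    [TopologicalSpace R] : Prop :=
  ∃ (Y : Scheme.{u}) (q : Y ⟶ Spec (.of k)) (_ : LocallyOfFiniteType q) (_ : QuasiCompact q)
    (y : Spec (.of k) ⟶ Y) (_ : y ≫ q = 𝟙 _) (I : Type u),
    Nonempty (R ≃A[k] completedTensor k (FormalNbhd q y) (PowerSeriesRing k I))

/-- The homomorphism `𝒪^_{X,x} → k[[t]]` corresponding to an arc `a` with `a(0) = x`. -/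
def arcFormalHom (a : Spec (.of (PowerSeries k)) ⟶ X) (x : Spec (.of k) ⟶ X)
    (h : a (closedPoint (PowerSeries k)) = pt x) : FormalNbhd p x →+* PowerSeries k :=
  completionLift _ (Ideal.span {PowerSeries.X}) (arcStalkHom p a x h) (arcStalkHom_mem p a x h)

/-- The homomorphism `𝒪^_{Y,y} → 𝒪^_{X,x}` of the first projection of a product decomposition
`X^_x ≅ Y^_y × Spf k[[z_i | i ∈ I]]`. -/
def projHom {Y : Scheme.{u}} {q : Y ⟶ Spec (.of k)} {x : Spec (.of k) ⟶ X}
    {y : Spec (.of k) ⟶ Y} {I : Type v}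
    (e : FormalNbhd p x ≃A[k] completedTensor k (FormalNbhd q y) (PowerSeriesRing k I)) :
    FormalNbhd q y →+* FormalNbhd p x :=
  (e.symm : _ →+* FormalNbhd p x).comp
    (completedTensorInl k (FormalNbhd q y) (PowerSeriesRing k I)).toRingHom

/-- The image in `Y` of an arc `a` on `X` with `a(0) = x`, under a morphism of formal neighborhoods
given by a homomorphism `φ : 𝒪^_{Y,y} → 𝒪^_{X,x}`. -/
def imageArc {Y : Scheme.{u}} (q : Y ⟶ Spec (.of k)) (x : Spec (.of k) ⟶ X)
    (y : Spec (.of k) ⟶ Y) (φ : FormalNbhd q y →+* FormalNbhd p x)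
    (a : Spec (.of (PowerSeries k)) ⟶ X) (h : a (closedPoint (PowerSeries k)) = pt x) :
    Spec (.of (PowerSeries k)) ⟶ Y :=
  Spec.map (CommRingCat.ofHom (((arcFormalHom p a x h).comp φ).comp
    (algebraMap (LocalRingAt q y) (FormalNbhd q y)))) ≫ Y.fromSpecStalk (pt y)

end Formal

end

end ArcSpaces

open ArcSpaces

/-! Everything takes place among the `FormalPointAlgebra`s: complete separated linearly topologized
`k`-algebras with residue field `k` whose open ideals contain powers of the maximal ideal.
Completions at `k`-points belong to this class, and it is closed under completed tensor products and
under `P ↦ P[[t]]`. Hence formal neighborhoods and products can be handled by their universal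
properties for maps into such `P`, and never by explicit series.

Write `A` for the completed local ring of `Y` at `y`, `Q` for that of `Y_∞` at the constant arc, and
`R` for that of `X_∞` at `α`. The completion of an arc space at an arc represents the deformations
of that arc: maps to `P` correspond to maps from the completed local ring of the scheme to `P[[t]]`
that reduce to the given arc (`IsUniversalArc`, obtained from the Hasse--Schmidt algebra of a chart
in `IsFormalCompletion.exists_isUniversalArc`). If the completed local ring of `X` is `A` with free
variables `z_i`, then a deformation of `α` is a deformation of its image in `Y` together with
arbitrary lifts of the coefficients of the series `z_i(α)`. So `R` is `Q` with free variables
indexed by `I × ℕ`, which is statement 1 (`IsUniversalArc.exists_nonempty_equiv`).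

The core of statements 2 and 3 is `aug_coeff_one_eq_zero`. Let `s : Q → A` be the section of
constant arcs and `h : Q → A[[ε]]` a deformation of `s`. For each `n`, the `ε`-coefficient of
`h(a⁽ⁿ⁾)` is a derivation of `A` in `a`, because `s` kills `a⁽ⁱ⁾` for `i > 0`. In characteristic
zero, a derivation `D` of `A` with `D y` a unit for some `y` in the maximal ideal splits off a
smooth factor: normalize to `D y = 1` and flow along `D` to the locus `y = 0`
(`hasSmoothFactor_of_derivation`). Since `A` has no smooth factor, the first-order part of `h` is
zero modulo the maximal ideal. A smooth factor of `Q` with variable `z` would allow the deformation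
`z ↦ s(z) + ε`, a contradiction; this is statement 2.

For statement 3, let `R` also be a free extension of a completed local ring `C` with `r` topological
generators. A nonzero tangent vector of `A` can be inserted at each of the orders `t⁰, …, tʳ`,
giving `r + 1` independent tangent vectors of `Q`, hence of `R`. A nonzero combination of them
vanishes on the generators of `C`, so it points along the free variables over `C` and extends to a
deformation of the identity of `R`, contrary to `aug_coeff_one_eq_zero`. Thus `A` has zero tangent
space, so `A = k`, the completed local ring of `X` at `x` is a power series ring, and infinitesimal
lifting makes `X` smooth near `x` (`exists_smooth_of_exists_lift`). -/

namespace ArcSpaces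

noncomputable section

open scoped PowerSeries.WithPiTopology Topology

/-! ### Linear topologies and the class of formal point algebras -/

section LinearTopology

variable {R : Type*} [CommRing R]

/-- The initial topology of a directed family of ring homomorphisms to discrete rings is a
ring topology. -/
lemma isTopologicalRing_iInf_induced {ι : Type*} {T : ι → Type*} [∀ i, CommRing (T i)]
    (f : ∀ i, R →+* T i) :
    @IsTopologicalRing R (⨅ i, TopologicalSpace.induced (f i) ⊥) _ := by
  have hmul (i : ι) : @ContinuousMul R (TopologicalSpace.induced (f i) ⊥) _ := by
    let : TopologicalSpace (T i) := ⊥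
    have : DiscreteTopology (T i) := ⟨rfl⟩
    exact continuousMul_induced (f i)
  have hadd (i : ι) : @IsTopologicalAddGroup R (TopologicalSpace.induced (f i) ⊥) _ := by
    let : TopologicalSpace (T i) := ⊥
    have : DiscreteTopology (T i) := ⟨rfl⟩
    exact topologicalAddGroup_induced (f i)
  have h1 := continuousMul_iInf hmul
  have h2 := topologicalAddGroup_iInf hadd
  let : TopologicalSpace R := ⨅ i, TopologicalSpace.induced (f i) ⊥
  exact { toContinuousMul := h1, toContinuousAdd := h2.toContinuousAdd, toContinuousNeg := h2.toContinuousNeg }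

lemma isOpen_ker_iInf_induced {ι : Type*} {T : ι → Type*} [∀ i, CommRing (T i)]
    (f : ∀ i, R →+* T i) (i : ι) :
    IsOpen[⨅ i, TopologicalSpace.induced (f i) ⊥] (RingHom.ker (f i) : Set R) := by
  let : TopologicalSpace (T i) := ⊥
  have : DiscreteTopology (T i) := ⟨rfl⟩
  refine (iInf_le (fun i ↦ TopologicalSpace.induced (f i) ⊥) i) _ ?_
  exact isOpen_induced_iff.2 ⟨{0}, isOpen_discrete _, by ext; simp [RingHom.mem_ker]⟩

lemma hasBasis_nhds_zero_iInf_induced {ι : Type*} [Nonempty ι] {T : ι → Type*}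
    [∀ i, CommRing (T i)] (f : ∀ i, R →+* T i)
    (hf : ∀ i j, ∃ l, RingHom.ker (f l) ≤ RingHom.ker (f i) ⊓ RingHom.ker (f j)) :
    (@nhds R (⨅ i, TopologicalSpace.induced (f i) ⊥) 0).HasBasis (fun _ ↦ True)
      fun i ↦ (RingHom.ker (f i) : Set R) := by
  rw [nhds_iInf]
  have (i : ι) : @nhds R (TopologicalSpace.induced (f i) ⊥) 0 =
      Filter.principal (RingHom.ker (f i) : Set R) := by
    let : TopologicalSpace (T i) := ⊥
    have : DiscreteTopology (T i) := ⟨rfl⟩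
    rw [nhds_induced, nhds_discrete, map_zero, Filter.comap_pure]
    congr 1
  simp_rw [this]
  refine Filter.hasBasis_iInf_principal ?_
  intro i j
  obtain ⟨l, hl⟩ := hf i j
  exact ⟨l, hl.trans inf_le_left, hl.trans inf_le_right⟩

variable [TopologicalSpace R]

lemma isOpen_of_openIdeal_le [IsTopologicalRing R] {𝔞 𝔟 : Ideal R} (h : IsOpen (𝔞 : Set R))
    (hle : 𝔞 ≤ 𝔟) : IsOpen (𝔟 : Set R) :=
  AddSubgroup.isOpen_mono (H₁ := 𝔞.toAddSubgroup) (H₂ := 𝔟.toAddSubgroup) hle h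

lemma continuous_of_isOpen_comap {P : Type*} [CommRing P] [TopologicalSpace P]
    [IsTopologicalRing R] [IsTopologicalRing P] [IsLinearTopology P P] (f : R →+* P)
    (h : ∀ 𝔞 : Ideal P, IsOpen (𝔞 : Set P) → IsOpen (𝔞.comap f : Set R)) : Continuous f := by
  refine continuous_of_continuousAt_zero f ?_
  rw [ContinuousAt, map_zero]
  refine (IsLinearTopology.hasBasis_open_ideal (R := P)).tendsto_right_iff.2 fun 𝔞 h𝔞 ↦ ?_
  exact (h 𝔞 h𝔞).mem_nhds (zero_mem (𝔞.comap f))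

end LinearTopology

/-- Complete separated linearly topologized `k`-algebras `R` with an open maximal ideal `𝔪` such
that `R / 𝔪 = k` and every open ideal contains a power of `𝔪`. -/
class FormalPointAlgebra (k R : Type*) [Field k] [CommRing R] [Algebra k R]
    [TopologicalSpace R] : Prop where
  isTopologicalRing : IsTopologicalRing R
  isLinearTopology : IsLinearTopology R R
  separated : ∀ r : R, (∀ 𝔞 : Ideal R, IsOpen (𝔞 : Set R) → r ∈ 𝔞) → r = 0
  complete : ∀ x : OpenIdeal R → R, (∀ 𝔞 𝔟, 𝔞 ≤ 𝔟 → x 𝔞 - x 𝔟 ∈ 𝔟.1) → ∃ r, ∀ 𝔞, r - x 𝔞 ∈ 𝔞.1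
  exists_aug : ∃ φ : R →ₐ[k] k, IsOpen (RingHom.ker φ : Set R) ∧
    ∀ 𝔞 : Ideal R, IsOpen (𝔞 : Set R) → ∃ n, RingHom.ker φ ^ n ≤ 𝔞

attribute [instance] FormalPointAlgebra.isTopologicalRing FormalPointAlgebra.isLinearTopology

namespace FormalPointAlgebra

/-- A criterion in terms of a basis of open ideals. -/
lemma of_basis {k R : Type*} [Field k] [CommRing R] [Algebra k R] [TopologicalSpace R]
    [IsTopologicalRing R] {ι : Type*} (F : ι → Ideal R)
    (hF : (𝓝 (0 : R)).HasBasis (fun _ ↦ True) fun i ↦ (F i : Set R))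
    (separated : ∀ r : R, (∀ i, r ∈ F i) → r = 0)
    (complete : ∀ x : ι → R, (∀ i j, F i ≤ F j → x i - x j ∈ F j) → ∃ r, ∀ i, r - x i ∈ F i)
    (φ : R →ₐ[k] k) (hφ : ∃ i, F i ≤ RingHom.ker φ) (hφ' : ∀ i, ∃ n, RingHom.ker φ ^ n ≤ F i) :
    FormalPointAlgebra k R := by
  have hopen (i : ι) : IsOpen (F i : Set R) :=
    AddSubgroup.isOpen_of_mem_nhds (F i).toAddSubgroup (hF.mem_of_mem trivial)
  have hle (𝔞 : Ideal R) (h : IsOpen (𝔞 : Set R)) : ∃ i, F i ≤ 𝔞 := by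
    obtain ⟨i, -, hi⟩ := hF.mem_iff.1 (h.mem_nhds (zero_mem 𝔞))
    exact ⟨i, hi⟩
  refine ⟨inferInstance, .mk_of_hasBasis _ hF, fun r hr ↦ separated r fun i ↦ hr _ (hopen i),
    fun x hx ↦ ?_, φ, ?_, fun 𝔞 h𝔞 ↦ ?_⟩
  · obtain ⟨r, hr⟩ := complete (fun i ↦ x ⟨F i, hopen i⟩) fun i j hij ↦ hx ⟨_, _⟩ ⟨_, _⟩ hij
    refine ⟨r, fun 𝔞 ↦ ?_⟩
    obtain ⟨i, hi⟩ := hle 𝔞.1 𝔞.2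
    have := add_mem (hi (hr i)) (hx ⟨F i, hopen i⟩ 𝔞 hi)
    simpa using this
  · obtain ⟨i, hi⟩ := hφ
    exact isOpen_of_openIdeal_le (hopen i) hi
  · obtain ⟨i, hi⟩ := hle 𝔞 h𝔞
    obtain ⟨n, hn⟩ := hφ' i
    exact ⟨n, hn.trans hi⟩

end FormalPointAlgebra

/-! ### Augmentations, density and extension of homomorphisms -/

section Aug

variable {k : Type*} [Field k] {R : Type*} [CommRing R] [Algebra k R] [TopologicalSpace R]
  [FormalPointAlgebra k R]
  {P : Type*} [CommRing P] [Algebra k P] [TopologicalSpace P] [FormalPointAlgebra k P]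

variable (k R) in
/-- The augmentation `R → R / 𝔪 = k`. -/
def aug : R →ₐ[k] k := (FormalPointAlgebra.exists_aug (k := k) (R := R)).choose

variable (k R) in
lemma isOpen_ker_aug : IsOpen (RingHom.ker (aug k R) : Set R) :=
  (FormalPointAlgebra.exists_aug (k := k) (R := R)).choose_spec.1

variable (k) in
lemma exists_ker_aug_pow_le (𝔞 : Ideal R) (h : IsOpen (𝔞 : Set R)) :
    ∃ n, RingHom.ker (aug k R) ^ n ≤ 𝔞 :=
  (FormalPointAlgebra.exists_aug (k := k) (R := R)).choose_spec.2 𝔞 h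

lemma algHom_eq_of_ker_le {A : Type*} [CommRing A] [Algebra k A] {φ ψ : A →ₐ[k] k}
    (h : RingHom.ker φ ≤ RingHom.ker ψ) : φ = ψ := by
  ext a
  have : a - algebraMap k A (φ a) ∈ RingHom.ker φ := by simp [RingHom.mem_ker]
  have := h this
  rw [RingHom.mem_ker, map_sub, AlgHom.commutes, sub_eq_zero] at this
  exact this.symm

/-- An open kernel contains a power of the maximal ideal and, being prime, the maximal ideal itself.
Hence the choice made in `aug` does not matter, and continuity alone makes homomorphisms compatible
with augmentations. -/
lemma eq_aug (φ : R →ₐ[k] k) (h : IsOpen (RingHom.ker φ : Set R)) : φ = aug k R := by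
  obtain ⟨n, hn⟩ := exists_ker_aug_pow_le k _ h
  exact (algHom_eq_of_ker_le
    (((RingHom.ker_isPrime (φ : R →+* k)).le_of_pow_le hn))).symm

lemma aug_comp (F : R →A[k] P) : (aug k P).comp (F : R →ₐ[k] P) = aug k R :=
  eq_aug _ ((isOpen_ker_aug k P).preimage F.continuous)

@[simp] lemma aug_apply (F : R →A[k] P) (r : R) : aug k P (F r) = aug k R r :=
  congr($(aug_comp F) r)

lemma eq_of_forall_sub_mem (k : Type*) [Field k] {P : Type*} [CommRing P] [Algebra k P]
    [TopologicalSpace P] [FormalPointAlgebra k P] {a b : P} (h : ∀ 𝔞 : Ideal P, IsOpen (𝔞 : Set P) → a - b ∈ 𝔞) :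
    a = b :=
  sub_eq_zero.1 (FormalPointAlgebra.separated (k := k) _ h)

/-- Two continuous homomorphisms that agree on a dense subalgebra are equal. -/
lemma continuousAlgHom_ext_of_dense {R : Type*} [CommRing R] [Algebra k R] [TopologicalSpace R]
    {D : Type*} (ι : D → R)
    (hι : ∀ r, ∀ 𝔟 : Ideal R, IsOpen (𝔟 : Set R) → ∃ d, r - ι d ∈ 𝔟)
    {F G : R →A[k] P} (h : ∀ d, F (ι d) = G (ι d)) : F = G := by
  ext r
  refine eq_of_forall_sub_mem k fun 𝔞 h𝔞 ↦ ?_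
  obtain ⟨d, hd⟩ := hι r (𝔞.comap (F : R →+* P) ⊓ 𝔞.comap (G : R →+* P))
    ((h𝔞.preimage F.continuous).inter (h𝔞.preimage G.continuous))
  have h1 : F (r - ι d) ∈ 𝔞 := hd.1
  have h2 : G (r - ι d) ∈ 𝔞 := hd.2
  have := sub_mem h1 h2
  simpa [map_sub, h] using this

/-- Extension of a homomorphism from a dense subalgebra. -/
theorem exists_continuousAlgHom_extension {R : Type*} [CommRing R] [Algebra k R]
    [TopologicalSpace R] [IsTopologicalRing R]
    {D : Type*} [CommRing D] [Algebra k D] (ι : D →ₐ[k] R)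
    (hι : ∀ r, ∀ 𝔟 : Ideal R, IsOpen (𝔟 : Set R) → ∃ d, r - ι d ∈ 𝔟) (f : D →ₐ[k] P)
    (hf : ∀ 𝔞 : Ideal P, IsOpen (𝔞 : Set P) → ∃ 𝔟 : Ideal R, IsOpen (𝔟 : Set R) ∧
      𝔟.comap ι ≤ 𝔞.comap f) :
    ∃ F : R →A[k] P, ∀ d, F (ι d) = f d := by
  choose 𝔟 h𝔟 hle using fun 𝔞 : OpenIdeal P ↦ hf 𝔞.1 𝔞.2
  -- Here `𝔟 𝔞` is a modulus of continuity for `𝔞`. The value at `r` is pinned down by being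
  -- congruent to `f d` modulo `𝔞` for every `d` that approximates `r` modulo `𝔟 𝔞`; additivity and
  -- multiplicativity follow from this characterization.
  have key (r : R) : ∃ p : P, ∀ (𝔞 : OpenIdeal P) (d : D), r - ι d ∈ 𝔟 𝔞 → p - f d ∈ 𝔞.1 := by
    choose d hd using fun 𝔞 : OpenIdeal P ↦ hι r _ (h𝔟 𝔞)
    have aux (𝔞 : OpenIdeal P) (d d' : D) (h : r - ι d ∈ 𝔟 𝔞) (h' : r - ι d' ∈ 𝔟 𝔞) :
        f d - f d' ∈ 𝔞.1 := by
      have : d - d' ∈ (𝔟 𝔞).comap ι := by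
        have := sub_mem h' h
        rw [Ideal.mem_comap, map_sub]
        convert this using 1
        ring
      simpa using hle 𝔞 this
    obtain ⟨p, hp⟩ := FormalPointAlgebra.complete (k := k) (fun 𝔞 : OpenIdeal P ↦ f (d 𝔞))
      fun 𝔞 𝔞' hlt ↦ by
        -- The chosen moduli need not be comparable, so the two approximations are compared through
        -- a third one that is good for both.
        obtain ⟨d', hd'⟩ := hι r (𝔟 𝔞 ⊓ 𝔟 𝔞') ((h𝔟 𝔞).inter (h𝔟 𝔞'))
        have h1 := hlt (aux 𝔞 _ _ (hd 𝔞) hd'.1)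
        have h2 := aux 𝔞' _ _ hd'.2 (hd 𝔞')
        simpa using add_mem h1 h2
    refine ⟨p, fun 𝔞 d' h ↦ ?_⟩
    have := add_mem (hp 𝔞) (aux 𝔞 _ _ (hd 𝔞) h)
    simpa using this
  choose F hF using key
  have hFd (d : D) : F (ι d) = f d := eq_of_forall_sub_mem k fun 𝔞 h𝔞 ↦
    hF _ ⟨𝔞, h𝔞⟩ d (by simp)
  have hadd (r s : R) : F (r + s) = F r + F s := eq_of_forall_sub_mem k fun 𝔞 h𝔞 ↦ by
    obtain ⟨d, hd⟩ := hι r _ (h𝔟 ⟨𝔞, h𝔞⟩)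
    obtain ⟨d', hd'⟩ := hι s _ (h𝔟 ⟨𝔞, h𝔞⟩)
    have h1 := hF _ ⟨𝔞, h𝔞⟩ d hd
    have h2 := hF _ ⟨𝔞, h𝔞⟩ d' hd'
    have h3 := hF (r + s) ⟨𝔞, h𝔞⟩ (d + d') (by
      convert add_mem hd hd' using 1
      rw [map_add]; ring)
    have := sub_mem (sub_mem h3 h1) h2
    rw [map_add] at this
    convert this using 1
    ring
  have hmul (r s : R) : F (r * s) = F r * F s := eq_of_forall_sub_mem k fun 𝔞 h𝔞 ↦ by
    obtain ⟨d, hd⟩ := hι r _ (h𝔟 ⟨𝔞, h𝔞⟩)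
    obtain ⟨d', hd'⟩ := hι s _ (h𝔟 ⟨𝔞, h𝔞⟩)
    have h1 := hF _ ⟨𝔞, h𝔞⟩ d hd
    have h2 := hF _ ⟨𝔞, h𝔞⟩ d' hd'
    have h3 := hF (r * s) ⟨𝔞, h𝔞⟩ (d * d') (by
      convert add_mem (Ideal.mul_mem_right s _ hd) (Ideal.mul_mem_left _ (ι d) hd') using 1
      rw [map_mul]; ring)
    have := sub_mem (sub_mem h3 (Ideal.mul_mem_right (F s) _ h1)) (Ideal.mul_mem_left _ (f d) h2)
    rw [map_mul] at this
    convert this using 1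
    ring
  have hF1 : F 1 = 1 := by rw [← map_one ι, hFd, map_one]
  have hF0 : F 0 = 0 := by rw [← map_zero ι, hFd, map_zero]
  let G : R →ₐ[k] P :=
    { toFun := F
      map_one' := hF1
      map_mul' := hmul
      map_zero' := hF0
      map_add' := hadd
      commutes' c := by rw [← ι.commutes c, hFd, f.commutes] }
  refine ⟨⟨G, continuous_of_isOpen_comap (G : R →+* P) fun 𝔞 h𝔞 ↦
    isOpen_of_openIdeal_le (h𝔟 ⟨𝔞, h𝔞⟩) fun r hr ↦ ?_⟩, hFd⟩
  have : F r - f 0 ∈ 𝔞 := hF r ⟨𝔞, h𝔞⟩ 0 (by simpa using hr)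
  rw [map_zero, sub_zero] at this
  exact this

/-- After scaling by a constant, `a` is `1` minus an element that is nilpotent modulo each open
ideal, so a finite geometric sum inverts it there. Inverses are unique, so the local inverses are
compatible and completeness glues them. -/
lemma isUnit_of_aug_ne_zero {a : P} (h : aug k P a ≠ 0) : IsUnit a := by
  have key (𝔞 : OpenIdeal P) : ∃ b, a * b - 1 ∈ 𝔞.1 := by
    obtain ⟨n, hn⟩ := exists_ker_aug_pow_le k 𝔞.1 𝔞.2
    set c := algebraMap k P (aug k P a)⁻¹
    have hm : 1 - a * c ∈ RingHom.ker (aug k P) := by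
      simp [RingHom.mem_ker, c, h]
    have := hn (Ideal.pow_mem_pow hm n)
    refine ⟨c * ∑ i ∈ Finset.range n, (1 - a * c) ^ i, ?_⟩
    have h2 := mul_neg_geom_sum (1 - a * c) n
    have h3 : a * (c * ∑ i ∈ Finset.range n, (1 - a * c) ^ i) - 1 = - (1 - a * c) ^ n := by
      linear_combination h2
    rw [h3]
    exact neg_mem this
  choose b hb using key
  obtain ⟨r, hr⟩ := FormalPointAlgebra.complete (k := k) b fun 𝔞 𝔞' hlt ↦ by
    have h1 := hlt (hb 𝔞)
    have h2 := hb 𝔞'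
    have := sub_mem (Ideal.mul_mem_left _ (b 𝔞) h2) (Ideal.mul_mem_left _ (b 𝔞') h1)
    have := neg_mem this
    convert this using 1
    ring
  refine IsUnit.of_mul_eq_one r (eq_of_forall_sub_mem k fun 𝔞 h𝔞 ↦ ?_)
  have := add_mem (Ideal.mul_mem_left _ a (hr ⟨𝔞, h𝔞⟩)) (hb ⟨𝔞, h𝔞⟩)
  convert this using 1
  ring

/-- A continuous bijection pair of algebra homomorphisms. -/
def continuousAlgEquivOf {R P : Type*} [CommRing R] [Algebra k R] [TopologicalSpace R]
    [CommRing P] [Algebra k P] [TopologicalSpace P] (F : R →A[k] P) (G : P →A[k] R)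
    (h1 : ∀ r, G (F r) = r) (h2 : ∀ p, F (G p) = p) : R ≃A[k] P where
  toFun := F
  invFun := G
  left_inv := h1
  right_inv := h2
  map_mul' := map_mul F
  map_add' := map_add F
  commutes' := F.toAlgHom.commutes
  continuous_toFun := F.continuous
  continuous_invFun := G.continuous

end Aug

end

end ArcSpaces

namespace ArcSpaces

noncomputable section

open scoped PowerSeries.WithPiTopology Topology

/-! ### Adic completions at a `k`-rational maximal ideal -/

section Completion

variable {O : Type*} [CommRing O] (I : Ideal O)

instance : IsTopologicalRing (AdicCompletion I O) :=
  isTopologicalRing_iInf_induced fun n ↦ (AdicCompletion.evalₐ I n).toRingHom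

lemma evalₐ_eq_of_le {m n : ℕ} (h : m ≤ n) (x : AdicCompletion I O) {o : O}
    (hx : AdicCompletion.evalₐ I n x = Ideal.Quotient.mk _ o) :
    AdicCompletion.evalₐ I m x = Ideal.Quotient.mk _ o := by
  obtain ⟨y, rfl⟩ := AdicCompletion.mk_surjective I O x
  rw [AdicCompletion.evalₐ_mk] at hx ⊢
  rw [← AdicCompletion.Ideal.mk_eq_mk I h]
  rw [Ideal.Quotient.eq] at hx ⊢
  exact Ideal.pow_le_pow_right h hx

lemma ker_evalₐ_antitone {m n : ℕ} (h : m ≤ n) :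
    RingHom.ker (AdicCompletion.evalₐ I n) ≤ RingHom.ker (AdicCompletion.evalₐ I m) := by
  intro x hx
  rw [RingHom.mem_ker] at hx ⊢
  rw [evalₐ_eq_of_le I h x (o := 0) (by rw [hx, map_zero]), map_zero]

lemma hasBasis_nhds_zero_adicCompletion :
    (𝓝 (0 : AdicCompletion I O)).HasBasis (fun _ ↦ True)
      fun n ↦ (RingHom.ker (AdicCompletion.evalₐ I n) : Set (AdicCompletion I O)) :=
  hasBasis_nhds_zero_iInf_induced (fun n ↦ (AdicCompletion.evalₐ I n).toRingHom) fun m n ↦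
    ⟨max m n, le_inf (ker_evalₐ_antitone I (le_max_left m n))
      (ker_evalₐ_antitone I (le_max_right m n))⟩

lemma isOpen_ker_evalₐ (n : ℕ) :
    IsOpen (RingHom.ker (AdicCompletion.evalₐ I n) : Set (AdicCompletion I O)) :=
  isOpen_ker_iInf_induced (fun n ↦ (AdicCompletion.evalₐ I n).toRingHom) n

lemma exists_sub_mem_adicCompletion (c : AdicCompletion I O) (𝔟 : Ideal (AdicCompletion I O))
    (h : IsOpen (𝔟 : Set (AdicCompletion I O))) : ∃ o, c - algebraMap O _ o ∈ 𝔟 := by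
  obtain ⟨n, -, hn⟩ := (hasBasis_nhds_zero_adicCompletion I).mem_iff.1 (h.mem_nhds (zero_mem 𝔟))
  obtain ⟨o, ho⟩ := Ideal.Quotient.mk_surjective (AdicCompletion.evalₐ I n c)
  refine ⟨o, hn ?_⟩
  rw [SetLike.mem_coe, RingHom.mem_ker, map_sub, sub_eq_zero, ← ho]
  exact (AdicCompletion.evalₐ_of I n o).symm

variable (k : Type*) [Field k] [Algebra k O]

/-- The homomorphism from a `k`-algebra to its completion. -/
def completionOf : O →ₐ[k] AdicCompletion I O where
  __ := algebraMap O (AdicCompletion I O)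
  commutes' _ := rfl

lemma evalₐ_completionOf (n : ℕ) (o : O) :
    AdicCompletion.evalₐ I n (completionOf I k o) = Ideal.Quotient.mk _ o :=
  AdicCompletion.evalₐ_of I n o

lemma complete_adicCompletion (x : ℕ → AdicCompletion I O)
    (hx : ∀ i j, RingHom.ker (AdicCompletion.evalₐ I i) ≤ RingHom.ker (AdicCompletion.evalₐ I j) →
      x i - x j ∈ RingHom.ker (AdicCompletion.evalₐ I j)) :
    ∃ r, ∀ i, r - x i ∈ RingHom.ker (AdicCompletion.evalₐ I i) := by
  choose o ho using fun n ↦ Ideal.Quotient.mk_surjective (AdicCompletion.evalₐ I n (x n))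
  refine ⟨AdicCompletion.mk I O (AdicCompletion.AdicCauchySequence.mk I O o fun n ↦ ?_),
    fun n ↦ ?_⟩
  · have := hx (n + 1) n (ker_evalₐ_antitone I n.le_succ)
    rw [RingHom.mem_ker, map_sub, sub_eq_zero,
      evalₐ_eq_of_le I n.le_succ (x (n + 1)) (ho (n + 1)).symm, ← ho n, Ideal.Quotient.eq] at this
    rw [smul_eq_mul, Ideal.mul_top, SModEq.sub_mem, ← neg_sub]
    exact neg_mem this
  · rw [RingHom.mem_ker, map_sub, sub_eq_zero, AdicCompletion.evalₐ_mk, ← ho n]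
    rfl

variable {I k}

/-- The ideal `I` may fail to be finitely generated, as happens on arc spaces, so the kernels of the
maps to `O / I ^ n` serve as the basis instead of powers of an ideal. The `n`-th power of the
maximal ideal still lies in the `n`-th kernel, because the maximal ideal has image in `I / I ^ n`.
-/
lemma formalPointAlgebra_adicCompletion (χ : O →ₐ[k] k) (hI : I = RingHom.ker χ) :
    FormalPointAlgebra k (AdicCompletion I O) := by
  let ψ : O ⧸ I ^ 1 →ₐ[k] k := Ideal.Quotient.liftₐ (I ^ 1) χ fun a ha ↦ by
    rw [pow_one, hI] at ha
    exact ha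
  have hψ (o : O) : ψ (Ideal.Quotient.mk _ o) = χ o := rfl
  let φ : AdicCompletion I O →ₐ[k] k :=
    { __ := (ψ : O ⧸ I ^ 1 →+* k).comp
        (AdicCompletion.evalₐ I 1 : AdicCompletion I O →+* O ⧸ I ^ 1)
      commutes' c := by
        have h1 : algebraMap k (AdicCompletion I O) c = completionOf I k (algebraMap k O c) := rfl
        rw [h1]
        change ψ (AdicCompletion.evalₐ I 1 (completionOf I k (algebraMap k O c))) = _
        rw [evalₐ_completionOf, hψ, AlgHom.commutes] }
  have hφ {n : ℕ} (hn : 1 ≤ n) (x : AdicCompletion I O) (o : O)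
      (h : AdicCompletion.evalₐ I n x = Ideal.Quotient.mk _ o) : φ x = χ o := by
    change ψ (AdicCompletion.evalₐ I 1 x) = _
    rw [evalₐ_eq_of_le I hn x h, hψ]
  refine .of_basis _ (hasBasis_nhds_zero_adicCompletion I) (fun r hr ↦ ?_)
    (complete_adicCompletion I) φ ⟨1, fun x hx ↦ ?_⟩ fun n ↦ ⟨n, ?_⟩
  · exact AdicCompletion.ext_evalₐ fun n ↦ by simpa [RingHom.mem_ker] using hr n
  · rw [RingHom.mem_ker] at hx ⊢
    rw [hφ le_rfl x 0 (by rw [hx, map_zero]), map_zero]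
  · rcases Nat.eq_zero_or_pos n with rfl | hn
    · intro x _
      have : Subsingleton (O ⧸ I ^ 0) := Ideal.Quotient.subsingleton_iff.2 (by simp)
      exact Subsingleton.elim _ _
    · have : RingHom.ker φ ≤ (I.map (Ideal.Quotient.mk (I ^ n))).comap
          (AdicCompletion.evalₐ I n) := by
        intro x hx
        obtain ⟨o, ho⟩ := Ideal.Quotient.mk_surjective (AdicCompletion.evalₐ I n x)
        rw [RingHom.mem_ker, hφ hn x o ho.symm] at hx
        rw [Ideal.mem_comap, ← ho]
        refine Ideal.mem_map_of_mem _ ?_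
        rw [hI]; exact hx
      refine (Ideal.pow_right_mono this n).trans ((Ideal.le_comap_pow _ n).trans ?_)
      rw [← Ideal.map_pow, Ideal.map_quotient_self]
      exact le_rfl

lemma continuousAlgHom_ext_completion {P : Type*} [CommRing P] [Algebra k P] [TopologicalSpace P]
    [FormalPointAlgebra k P] {F G : AdicCompletion I O →A[k] P}
    (h : ∀ o, F (completionOf I k o) = G (completionOf I k o)) : F = G :=
  continuousAlgHom_ext_of_dense (completionOf I k) (exists_sub_mem_adicCompletion I) h

/-- Compatibility with augmentations sends `I` into the maximal ideal of `P`, hence some `I ^ n`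
into any prescribed open ideal. This is the continuity needed for the extension. -/
lemma exists_continuousAlgHom_completion {P : Type*} [CommRing P] [Algebra k P]
    [TopologicalSpace P] [FormalPointAlgebra k P] (χ : O →ₐ[k] k) (hI : I = RingHom.ker χ)
    (f : O →ₐ[k] P) (hf : ∀ o, aug k P (f o) = χ o) :
    ∃ F : AdicCompletion I O →A[k] P, ∀ o, F (completionOf I k o) = f o := by
  refine exists_continuousAlgHom_extension _ (exists_sub_mem_adicCompletion I) f fun 𝔞 h𝔞 ↦ ?_
  obtain ⟨n, hn⟩ := exists_ker_aug_pow_le k 𝔞 h𝔞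
  refine ⟨_, isOpen_ker_evalₐ I n, fun o ho ↦ ?_⟩
  rw [Ideal.mem_comap, RingHom.mem_ker, evalₐ_completionOf, Ideal.Quotient.eq_zero_iff_mem] at ho
  refine hn (Ideal.le_comap_pow f n (Ideal.pow_right_mono ?_ n ho))
  rw [hI]
  intro o ho
  rw [Ideal.mem_comap, RingHom.mem_ker, hf]
  exact ho

lemma aug_completionOf [FormalPointAlgebra k (AdicCompletion I O)] (χ : O →ₐ[k] k)
    (hI : I = RingHom.ker χ) (o : O) : aug k _ (completionOf I k o) = χ o := by
  have : RingHom.ker χ ≤ RingHom.ker ((aug k _).comp (completionOf I k)) := by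
    obtain ⟨n, -, hn⟩ := (hasBasis_nhds_zero_adicCompletion I).mem_iff.1
      ((isOpen_ker_aug k _).mem_nhds (zero_mem (RingHom.ker (aug k (AdicCompletion I O)))))
    have h : I ^ n ≤ RingHom.ker ((aug k _).comp (completionOf I k)) := by
      intro o ho
      have : completionOf I k o ∈ RingHom.ker (AdicCompletion.evalₐ I n) := by
        rw [RingHom.mem_ker, evalₐ_completionOf, Ideal.Quotient.eq_zero_iff_mem]
        exact ho
      exact hn this
    rw [← hI]
    exact (RingHom.ker_isPrime (((aug k _).comp (completionOf I k) : O →ₐ[k] k) :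
      O →+* k)).le_of_pow_le h
  exact congr($((algHom_eq_of_ker_le this).symm) o)

end Completion

/-! ### Power series in arbitrarily many variables and their universal property -/

section PowerSeriesRing

variable {k : Type u} [Field k] {J : Type v}

lemma span_X_eq_ker : Ideal.span (Set.range (MvPolynomial.X : J → MvPolynomial J k)) =
    RingHom.ker (MvPolynomial.aeval (R := k) fun _ : J ↦ (0 : k)) := by
  refine le_antisymm (Ideal.span_le.2 ?_) fun p hp ↦ ?_
  · rintro _ ⟨j, rfl⟩
    simp [RingHom.mem_ker]
  · have h (p : MvPolynomial J k) : p - MvPolynomial.C (MvPolynomial.aeval (fun _ ↦ (0 : k)) p) ∈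
        Ideal.span (Set.range (MvPolynomial.X : J → MvPolynomial J k)) := by
      induction p using MvPolynomial.induction_on with
      | C a => simp
      | add p q hp hq =>
        have := add_mem hp hq
        rw [map_add, map_add]
        convert this using 1
        ring
      | mul_X p j hp =>
        have : MvPolynomial.X j ∈
          Ideal.span (Set.range (MvPolynomial.X : J → MvPolynomial J k)) :=
          Ideal.subset_span ⟨j, rfl⟩
        simpa using Ideal.mul_mem_left _ p this
    rw [RingHom.mem_ker] at hp
    simpa [hp] using h p

instance : FormalPointAlgebra k (PowerSeriesRing k J) :=
  formalPointAlgebra_adicCompletion _ span_X_eq_ker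

variable (k) in
/-- The variable `z_j`. -/
def zvar (j : J) : PowerSeriesRing k J := completionOf _ k (MvPolynomial.X j)

@[simp] lemma aug_zvar (j : J) : aug k _ (zvar k j) = 0 := by
  rw [zvar, aug_completionOf _ span_X_eq_ker]
  simp

variable {P : Type*} [CommRing P] [Algebra k P] [TopologicalSpace P] [FormalPointAlgebra k P]

lemma exists_continuousAlgHom_powerSeriesRing (b : J → P) (hb : ∀ j, aug k P (b j) = 0) :
    ∃ F : PowerSeriesRing k J →A[k] P, ∀ j, F (zvar k j) = b j := by
  obtain ⟨F, hF⟩ := exists_continuousAlgHom_completion _ span_X_eq_ker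
    (MvPolynomial.aeval (R := k) b) fun p ↦ by
      have : (aug k P).comp (MvPolynomial.aeval b) = MvPolynomial.aeval fun _ ↦ (0 : k) := by
        ext j
        simp [hb]
      exact congr($this p)
  exact ⟨F, fun j ↦ by rw [zvar, hF]; simp⟩

lemma continuousAlgHom_ext_powerSeriesRing {F G : PowerSeriesRing k J →A[k] P}
    (h : ∀ j, F (zvar k j) = G (zvar k j)) : F = G := by
  refine continuousAlgHom_ext_completion fun p ↦ ?_
  have : (F : PowerSeriesRing k J →ₐ[k] P).comp (completionOf _ k) =
      (G : PowerSeriesRing k J →ₐ[k] P).comp (completionOf _ k) := by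
    ext j
    exact h j
  exact congr($this p)

end PowerSeriesRing


end

end ArcSpaces

namespace ArcSpaces

noncomputable section

open scoped PowerSeries.WithPiTopology Topology

/-! ### The completed tensor product as a coproduct -/

section Tensor

variable {k : Type u} [Field k] {S : Type v} {T : Type w} [CommRing S] [Algebra k S]
  [TopologicalSpace S] [CommRing T] [Algebra k T] [TopologicalSpace T]

variable (k S T) in
/-- The type of elements of the completed tensor product. -/
def CTensor : Type _ := completedTensor k S T

instance : CommRing (CTensor k S T) := inferInstanceAs (CommRing (completedTensor k S T))

instance : Algebra k (CTensor k S T) := inferInstanceAs (Algebra k (completedTensor k S T))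

instance : TopologicalSpace (CTensor k S T) := completedTensorTopology k S T

variable (k S T) in
/-- The identity map. -/
def ctensorEquiv : completedTensor k S T ≃A[k] CTensor k S T :=
  { AlgEquiv.refl (R := k) (A₁ := completedTensor k S T) with
    continuous_toFun := continuous_id
    continuous_invFun := continuous_id }

variable (k S T) in
/-- The projections from the completed tensor product. -/
def completedTensorEval (i : OpenIdeal S × OpenIdeal T) :
    CTensor k S T →ₐ[k] (S ⧸ i.1.1) ⊗[k] (T ⧸ i.2.1) :=
  (Pi.evalAlgHom k _ i).comp (completedTensor k S T).val

variable (k S T) in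
/-- The canonical homomorphism `s ↦ s ⊗ 1`. -/
def ctensorInl : S →ₐ[k] CTensor k S T := completedTensorInl k S T

variable (k S T) in
/-- The canonical homomorphism `t ↦ 1 ⊗ t`. -/
def ctensorInr : T →ₐ[k] CTensor k S T :=
  AlgHom.codRestrict
    (AlgHom.pi fun i ↦
      (Algebra.TensorProduct.includeRight : (T ⧸ i.2.1) →ₐ[k] (S ⧸ i.1.1) ⊗[k] (T ⧸ i.2.1)).comp
        (Ideal.Quotient.mkₐ k i.2.1))
    (completedTensor k S T) fun r i j h ↦ by
      change tensorTransition k S T i j h (1 ⊗ₜ[k] Ideal.Quotient.mk i.2.1 r) =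
        1 ⊗ₜ[k] Ideal.Quotient.mk j.2.1 r
      rw [tensorTransition, Algebra.TensorProduct.map_tmul, map_one]
      rfl

@[simp] lemma completedTensorEval_inl (i : OpenIdeal S × OpenIdeal T) (s : S) :
    completedTensorEval k S T i (ctensorInl k S T s) = Ideal.Quotient.mk _ s ⊗ₜ 1 := rfl

@[simp] lemma completedTensorEval_inr (i : OpenIdeal S × OpenIdeal T) (t : T) :
    completedTensorEval k S T i (ctensorInr k S T t) = 1 ⊗ₜ Ideal.Quotient.mk _ t := rfl

lemma tensorTransition_eval {i j : OpenIdeal S × OpenIdeal T} (h : i ≤ j)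
    (f : CTensor k S T) :
    tensorTransition k S T i j h (completedTensorEval k S T i f) = completedTensorEval k S T j f :=
  f.2 i j h

lemma ker_completedTensorEval_mono {i j : OpenIdeal S × OpenIdeal T} (h : i ≤ j) :
    RingHom.ker (completedTensorEval k S T i) ≤ RingHom.ker (completedTensorEval k S T j) := by
  intro f hf
  rw [RingHom.mem_ker] at hf ⊢
  rw [← tensorTransition_eval h, hf, map_zero]

/-- The infimum of two pairs of open ideals. -/
def infOpenIdeals (i j : OpenIdeal S × OpenIdeal T) : OpenIdeal S × OpenIdeal T :=
  (⟨i.1.1 ⊓ j.1.1, i.1.2.inter j.1.2⟩, ⟨i.2.1 ⊓ j.2.1, i.2.2.inter j.2.2⟩)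

lemma infOpenIdeals_le_left (i j : OpenIdeal S × OpenIdeal T) : infOpenIdeals i j ≤ i :=
  ⟨(inf_le_left : i.1.1 ⊓ j.1.1 ≤ i.1.1), (inf_le_left : i.2.1 ⊓ j.2.1 ≤ i.2.1)⟩

lemma infOpenIdeals_le_right (i j : OpenIdeal S × OpenIdeal T) : infOpenIdeals i j ≤ j :=
  ⟨(inf_le_right : i.1.1 ⊓ j.1.1 ≤ j.1.1), (inf_le_right : i.2.1 ⊓ j.2.1 ≤ j.2.1)⟩

instance : IsTopologicalRing (CTensor k S T) :=
  isTopologicalRing_iInf_induced fun i ↦ (completedTensorEval k S T i).toRingHom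

lemma isOpen_ker_completedTensorEval (i : OpenIdeal S × OpenIdeal T) :
    IsOpen (RingHom.ker (completedTensorEval k S T i) : Set (CTensor k S T)) :=
  isOpen_ker_iInf_induced (fun i ↦ (completedTensorEval k S T i).toRingHom) i

lemma hasBasis_nhds_zero_completedTensor :
    (𝓝 (0 : CTensor k S T)).HasBasis (fun _ ↦ True)
      fun i ↦ (RingHom.ker (completedTensorEval k S T i) : Set (CTensor k S T)) := by
  have : Nonempty (OpenIdeal S × OpenIdeal T) :=
    ⟨⟨⟨⊤, isOpen_univ⟩, ⟨⊤, isOpen_univ⟩⟩⟩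
  exact hasBasis_nhds_zero_iInf_induced (fun i ↦ (completedTensorEval k S T i).toRingHom)
    fun i j ↦ ⟨infOpenIdeals i j,
      le_inf (ker_completedTensorEval_mono (infOpenIdeals_le_left i j))
        (ker_completedTensorEval_mono (infOpenIdeals_le_right i j))⟩

instance : IsLinearTopology (CTensor k S T) (CTensor k S T) :=
  .mk_of_hasBasis _ hasBasis_nhds_zero_completedTensor

lemma continuous_ctensorInl [IsTopologicalRing S] :
    Continuous (ctensorInl k S T) := by
  refine continuous_of_isOpen_comap (ctensorInl k S T : S →+* CTensor k S T) fun 𝔞 h𝔞 ↦ ?_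
  obtain ⟨i, -, hi⟩ :=
    hasBasis_nhds_zero_completedTensor.mem_iff.1 (h𝔞.mem_nhds (zero_mem 𝔞))
  refine isOpen_of_openIdeal_le i.1.2 fun s hs ↦ hi ?_
  rw [SetLike.mem_coe, RingHom.mem_ker]
  refine (completedTensorEval_inl i s).trans ?_
  rw [Ideal.Quotient.eq_zero_iff_mem.2 hs, zero_tmul]

lemma continuous_ctensorInr [IsTopologicalRing T] :
    Continuous (ctensorInr k S T) := by
  refine continuous_of_isOpen_comap (ctensorInr k S T : T →+* CTensor k S T) fun 𝔞 h𝔞 ↦ ?_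
  obtain ⟨i, -, hi⟩ :=
    hasBasis_nhds_zero_completedTensor.mem_iff.1 (h𝔞.mem_nhds (zero_mem 𝔞))
  refine isOpen_of_openIdeal_le i.2.2 fun s hs ↦ hi ?_
  rw [SetLike.mem_coe, RingHom.mem_ker]
  refine (completedTensorEval_inr i s).trans ?_
  rw [Ideal.Quotient.eq_zero_iff_mem.2 hs, tmul_zero]

variable (k S T) in
/-- `s ↦ s ⊗ 1` as a continuous homomorphism. -/
def tensorInl [IsTopologicalRing S] : S →A[k] CTensor k S T :=
  ⟨ctensorInl k S T, continuous_ctensorInl⟩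

variable (k S T) in
/-- `t ↦ 1 ⊗ t` as a continuous homomorphism. -/
def tensorInr [IsTopologicalRing T] : T →A[k] CTensor k S T :=
  ⟨ctensorInr k S T, continuous_ctensorInr⟩

variable (k S T) in
/-- The homomorphism from the tensor product to the completed tensor product. -/
def toCompletedTensor : S ⊗[k] T →ₐ[k] CTensor k S T :=
  Algebra.TensorProduct.productMap (ctensorInl k S T) (ctensorInr k S T)

lemma completedTensorEval_toCompletedTensor (i : OpenIdeal S × OpenIdeal T) (d : S ⊗[k] T) :
    completedTensorEval k S T i (toCompletedTensor k S T d) =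
      Algebra.TensorProduct.map (Ideal.Quotient.mkₐ k i.1.1) (Ideal.Quotient.mkₐ k i.2.1) d := by
  have : (completedTensorEval k S T i).comp (toCompletedTensor k S T) =
      Algebra.TensorProduct.map (Ideal.Quotient.mkₐ k i.1.1) (Ideal.Quotient.mkₐ k i.2.1) := by
    ext <;> simp [toCompletedTensor]
  exact congr($this d)

/-- The algebraic tensor product is dense because it surjects onto every `S/𝔞 ⊗ T/𝔟`. -/
lemma exists_sub_mem_completedTensor (f : CTensor k S T)
    (𝔟 : Ideal (CTensor k S T)) (h : IsOpen (𝔟 : Set (CTensor k S T))) :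
    ∃ d, f - toCompletedTensor k S T d ∈ 𝔟 := by
  obtain ⟨i, -, hi⟩ :=
    hasBasis_nhds_zero_completedTensor.mem_iff.1 (h.mem_nhds (zero_mem 𝔟))
  obtain ⟨d, hd⟩ := Algebra.TensorProduct.map_surjective _ _ (Ideal.Quotient.mkₐ_surjective k i.1.1)
    (Ideal.Quotient.mkₐ_surjective k i.2.1) (completedTensorEval k S T i f)
  refine ⟨d, hi ?_⟩
  rw [SetLike.mem_coe, RingHom.mem_ker, map_sub, sub_eq_zero,
    completedTensorEval_toCompletedTensor]
  exact hd.symm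

variable {P : Type*} [CommRing P] [Algebra k P] [TopologicalSpace P] [FormalPointAlgebra k P]

lemma continuousAlgHom_ext_completedTensor {F G : CTensor k S T →A[k] P}
    (hl : ∀ s, F (ctensorInl k S T s) = G (ctensorInl k S T s))
    (hr : ∀ t, F (ctensorInr k S T t) = G (ctensorInr k S T t)) : F = G := by
  refine continuousAlgHom_ext_of_dense (toCompletedTensor k S T) exists_sub_mem_completedTensor ?_
  intro d
  have : (F : CTensor k S T →ₐ[k] P).comp (toCompletedTensor k S T) =
      (G : CTensor k S T →ₐ[k] P).comp (toCompletedTensor k S T) := by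
    ext x
    · simpa [toCompletedTensor] using hl x
    · simpa [toCompletedTensor] using hr x
  exact congr($this d)

/-- Modulo an open ideal `𝔞` of `P`, the product of `f` and `g` factors through the single level
given by the preimages of `𝔞` under `f` and `g`. This gives continuity on the dense subalgebra `S ⊗
T`. -/
lemma exists_continuousAlgHom_completedTensor (f : S →A[k] P) (g : T →A[k] P) :
    ∃ F : CTensor k S T →A[k] P, (∀ s, F (ctensorInl k S T s) = f s) ∧
      ∀ t, F (ctensorInr k S T t) = g t := by
  obtain ⟨F, hF⟩ := exists_continuousAlgHom_extension (toCompletedTensor k S T)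
    exists_sub_mem_completedTensor
    (Algebra.TensorProduct.productMap (f : S →ₐ[k] P) (g : T →ₐ[k] P)) fun 𝔞 h𝔞 ↦ by
      let i : OpenIdeal S × OpenIdeal T := (⟨𝔞.comap (f : S →ₐ[k] P), h𝔞.preimage f.continuous⟩,
        ⟨𝔞.comap (g : T →ₐ[k] P), h𝔞.preimage g.continuous⟩)
      refine ⟨_, isOpen_ker_completedTensorEval i, fun d hd ↦ ?_⟩
      rw [Ideal.mem_comap, RingHom.mem_ker, completedTensorEval_toCompletedTensor] at hd
      let h : (S ⧸ i.1.1) ⊗[k] (T ⧸ i.2.1) →ₐ[k] P ⧸ 𝔞 :=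
        Algebra.TensorProduct.productMap (Ideal.quotientMapₐ 𝔞 (f : S →ₐ[k] P) le_rfl)
          (Ideal.quotientMapₐ 𝔞 (g : T →ₐ[k] P) le_rfl)
      have : h.comp (Algebra.TensorProduct.map (Ideal.Quotient.mkₐ k i.1.1)
          (Ideal.Quotient.mkₐ k i.2.1)) = (Ideal.Quotient.mkₐ k 𝔞).comp
            (Algebra.TensorProduct.productMap (f : S →ₐ[k] P) (g : T →ₐ[k] P)) := by
        ext x <;> simp [h]
      have := congr($this d)
      rw [AlgHom.comp_apply, hd, map_zero] at this
      exact (Ideal.Quotient.eq_zero_iff_mem (I := 𝔞)).1 this.symm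
  refine ⟨F, fun s ↦ ?_, fun t ↦ ?_⟩
  · simpa [toCompletedTensor] using hF (s ⊗ₜ 1)
  · simpa [toCompletedTensor] using hF (1 ⊗ₜ t)

instance [FormalPointAlgebra k S] [FormalPointAlgebra k T] :
    FormalPointAlgebra k (CTensor k S T) := by
  let i₀ : OpenIdeal S × OpenIdeal T := (⟨_, isOpen_ker_aug k S⟩, ⟨_, isOpen_ker_aug k T⟩)
  let ψ : (S ⧸ i₀.1.1) ⊗[k] (T ⧸ i₀.2.1) →ₐ[k] k :=
    Algebra.TensorProduct.productMap (Ideal.Quotient.liftₐ _ (aug k S) fun _ h ↦ h)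
      (Ideal.Quotient.liftₐ _ (aug k T) fun _ h ↦ h)
  let φ : CTensor k S T →ₐ[k] k := ψ.comp (completedTensorEval k S T i₀)
  have hφ : φ.comp (toCompletedTensor k S T) =
      Algebra.TensorProduct.productMap (aug k S) (aug k T) := by
    ext x
    · change ψ (completedTensorEval k S T i₀ (toCompletedTensor k S T (x ⊗ₜ 1))) = _
      rw [completedTensorEval_toCompletedTensor]
      simp [ψ, i₀]
      rfl
    · change ψ (completedTensorEval k S T i₀ (toCompletedTensor k S T (1 ⊗ₜ x))) = _
      rw [completedTensorEval_toCompletedTensor]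
      simp [ψ, i₀]
      rfl
  refine .of_basis _ hasBasis_nhds_zero_completedTensor (fun r hr ↦ ?_) (fun x hx ↦ ?_) φ
    ⟨i₀, fun f hf ↦ ?_⟩ fun i ↦ ?_
  · exact Subtype.ext (funext fun i ↦ hr i)
  · let r : CTensor k S T := (⟨fun i ↦ completedTensorEval k S T i (x i), fun i j h ↦ by
      rw [tensorTransition_eval h, ← sub_eq_zero, ← map_sub]
      exact RingHom.mem_ker.1 (hx i j (ker_completedTensorEval_mono h))⟩ : completedTensor k S T)
    refine ⟨r, fun i ↦ ?_⟩
    rw [RingHom.mem_ker, map_sub, sub_eq_zero]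
    rfl
  · rw [RingHom.mem_ker] at hf ⊢
    rw [AlgHom.comp_apply, hf, map_zero]
  · obtain ⟨a, ha⟩ := exists_ker_aug_pow_le k i.1.1 i.1.2
    obtain ⟨b, hb⟩ := exists_ker_aug_pow_le k i.2.1 i.2.2
    let A := (RingHom.ker (aug k S)).map (ctensorInl k S T)
    let B := (RingHom.ker (aug k T)).map (ctensorInr k S T)
    -- Up to the kernel of the given level, the maximal ideal is generated by the maximal ideals of
    -- the two factors: it is so for elements of `S ⊗ T`, and these approximate everything.
    have hle : RingHom.ker φ ≤ (A ⊔ B) ⊔ RingHom.ker (completedTensorEval k S T i) := by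
      have hd (d : S ⊗[k] T) : toCompletedTensor k S T d -
          algebraMap k _ (Algebra.TensorProduct.productMap (aug k S) (aug k T) d) ∈ A ⊔ B := by
        induction d using TensorProduct.induction_on with
        | zero => simp
        | add x y hx hy =>
          have := add_mem hx hy
          rw [map_add, map_add, map_add]
          convert this using 1
          ring
        | tmul s t =>
          have h1 : ctensorInl k S T (s - algebraMap k S (aug k S s)) ∈ A :=
            Ideal.mem_map_of_mem _ (by simp [RingHom.mem_ker])
          have h2 : ctensorInr k S T (t - algebraMap k T (aug k T t)) ∈ B :=
            Ideal.mem_map_of_mem _ (by simp [RingHom.mem_ker])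
          have h3 := add_mem ((le_sup_left : A ≤ A ⊔ B)
              (A.mul_mem_right (ctensorInr k S T t) h1))
            ((le_sup_right : B ≤ A ⊔ B)
              (B.mul_mem_left (algebraMap k _ (aug k S s)) h2))
          rw [map_sub, map_sub, AlgHom.commutes, AlgHom.commutes] at h3
          rw [toCompletedTensor, Algebra.TensorProduct.productMap_apply_tmul,
            Algebra.TensorProduct.productMap_apply_tmul, map_mul]
          convert h3 using 1
          ring
      intro f hf
      -- The approximation has to be good at level `i`, and also at `i₀`, so that `φ` takes the same
      -- value on it.
      obtain ⟨d, hd'⟩ := exists_sub_mem_completedTensor f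
        (RingHom.ker (completedTensorEval k S T (infOpenIdeals i i₀)))
        (isOpen_ker_completedTensorEval _)
      have h1 := ker_completedTensorEval_mono (infOpenIdeals_le_left i i₀) hd'
      have h2 := ker_completedTensorEval_mono (infOpenIdeals_le_right i i₀) hd'
      have h3 : φ (toCompletedTensor k S T d) = 0 := by
        have : φ (f - toCompletedTensor k S T d) = 0 := by
          rw [RingHom.mem_ker] at h2
          exact (congrArg ψ h2).trans (map_zero ψ)
        rw [map_sub, RingHom.mem_ker.1 hf, zero_sub, neg_eq_zero] at this
        exact this
      have h4 := hd d
      rw [← hφ, AlgHom.comp_apply, h3, map_zero, sub_zero] at h4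
      have := add_mem
        ((le_sup_left : A ⊔ B ≤ (A ⊔ B) ⊔ RingHom.ker (completedTensorEval k S T i)) h4)
        ((le_sup_right : _ ≤ (A ⊔ B) ⊔ RingHom.ker (completedTensorEval k S T i)) h1)
      simpa using this
    -- The exponents `a` and `b` kill the contributions of the two factors at level `i`; the last
    -- `1` belongs to the kernel summand.
    refine ⟨a + b + 1, (Ideal.pow_right_mono hle _).trans ?_⟩
    have h1 : A ^ a ≤ RingHom.ker (completedTensorEval k S T i) := by
      rw [← Ideal.map_pow, Ideal.map_le_iff_le_comap]
      intro s hs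
      rw [Ideal.mem_comap, RingHom.mem_ker, completedTensorEval_inl,
        Ideal.Quotient.eq_zero_iff_mem.2 (ha hs), zero_tmul]
    have h2 : B ^ b ≤ RingHom.ker (completedTensorEval k S T i) := by
      rw [← Ideal.map_pow, Ideal.map_le_iff_le_comap]
      intro s hs
      rw [Ideal.mem_comap, RingHom.mem_ker, completedTensorEval_inr,
        Ideal.Quotient.eq_zero_iff_mem.2 (hb hs), tmul_zero]
    have h3 : (A ⊔ B) ^ (a + b) ≤ RingHom.ker (completedTensorEval k S T i) :=
      Ideal.sup_pow_add_le_pow_sup_pow.trans (sup_le h1 h2)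
    exact Ideal.sup_pow_add_le_pow_sup_pow.trans (sup_le h3 (pow_one _).le)

end Tensor

end

end ArcSpaces

namespace ArcSpaces

noncomputable section

open scoped PowerSeries.WithPiTopology Topology

/-! ### Power series over a formal point algebra: coefficients, evaluation, functoriality -/

section PowerSeries

variable {k : Type*} [Field k] {P : Type*} [CommRing P]

/-- The power series whose coefficients of degree less than `n` lie in `𝔞`. -/
def coeffIdeal (𝔞 : Ideal P) (n : ℕ) : Ideal (PowerSeries P) where
  carrier := {f | ∀ i < n, PowerSeries.coeff i f ∈ 𝔞}
  zero_mem' i _ := by simp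
  add_mem' hf hg i hi := by simpa using add_mem (hf i hi) (hg i hi)
  smul_mem' c f hf i hi := by
    rw [smul_eq_mul, PowerSeries.coeff_mul]
    refine Ideal.sum_mem _ fun x hx ↦ Ideal.mul_mem_left _ _ (hf _ ?_)
    have := Finset.HasAntidiagonal.mem_antidiagonal.1 hx
    omega

lemma mem_coeffIdeal {𝔞 : Ideal P} {n : ℕ} {f : PowerSeries P} :
    f ∈ coeffIdeal 𝔞 n ↔ ∀ i < n, PowerSeries.coeff i f ∈ 𝔞 := Iff.rfl

lemma coeffIdeal_mono {𝔞 𝔟 : Ideal P} {m n : ℕ} (h : 𝔞 ≤ 𝔟) (hmn : m ≤ n) :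
    coeffIdeal 𝔞 n ≤ coeffIdeal 𝔟 m := fun _ hf i hi ↦ h (hf i (hi.trans_le hmn))

variable [Algebra k P] [TopologicalSpace P]

lemma isOpen_coeffIdeal [IsTopologicalRing P] {𝔞 : Ideal P} (h : IsOpen (𝔞 : Set P)) (n : ℕ) :
    IsOpen (coeffIdeal 𝔞 n : Set (PowerSeries P)) := by
  have : (coeffIdeal 𝔞 n : Set (PowerSeries P)) =
      ⋂ i ∈ Finset.range n, PowerSeries.coeff (R := P) i ⁻¹' (𝔞 : Set P) := by
    ext f
    simp [mem_coeffIdeal]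
  rw [this]
  exact isOpen_biInter_finset fun i _ ↦
    h.preimage (PowerSeries.WithPiTopology.continuous_coeff P i)

variable (P) in
lemma hasBasis_nhds_zero_powerSeries [IsTopologicalRing P] [IsLinearTopology P P] :
    (𝓝 (0 : PowerSeries P)).HasBasis (fun _ ↦ True)
      fun i : OpenIdeal P × ℕ ↦ (coeffIdeal i.1.1 i.2 : Set (PowerSeries P)) := by
  have : Nonempty (OpenIdeal P × ℕ) := ⟨⟨⟨⊤, isOpen_univ⟩, 0⟩⟩
  have hL := Filter.hasBasis_iInf_principal
    (s := fun i : OpenIdeal P × ℕ ↦ (coeffIdeal i.1.1 i.2 : Set (PowerSeries P)))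
    fun i j ↦ ⟨⟨⟨i.1.1 ⊓ j.1.1, i.1.2.inter j.1.2⟩, max i.2 j.2⟩,
      coeffIdeal_mono inf_le_left (le_max_left _ _),
      coeffIdeal_mono inf_le_right (le_max_right _ _)⟩
  convert hL
  refine le_antisymm (le_iInf fun i ↦ ?_) ?_
  · rw [Filter.le_principal_iff]
    exact (isOpen_coeffIdeal i.1.2 i.2).mem_nhds (zero_mem (coeffIdeal i.1.1 i.2))
  · rw [← Filter.tendsto_id']
    rw [PowerSeries.WithPiTopology.tendsto_iff_coeff_tendsto]
    intro d
    rw [map_zero]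
    refine (IsLinearTopology.hasBasis_open_ideal (R := P)).tendsto_right_iff.2 fun 𝔟 h𝔟 ↦ ?_
    have := hL.mem_of_mem (i := (⟨𝔟, h𝔟⟩, d + 1)) trivial
    filter_upwards [this] with f hf
    exact hf d d.lt_succ_self

/-- This closure property lets `P[[t]]` be a target in every universal property, both for arcs (with
variable `t`) and for one-parameter deformations (with variable `ε`). The maximal ideal is generated
by that of `P` and the variable, which bounds its powers. -/
instance [FormalPointAlgebra k P] : FormalPointAlgebra k (PowerSeries P) := by
  let φ : PowerSeries P →ₐ[k] k :=
    { __ := (aug k P : P →+* k).comp PowerSeries.constantCoeff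
      commutes' c := by
        change aug k P (PowerSeries.constantCoeff (algebraMap k (PowerSeries P) c)) = _
        rw [PowerSeries.algebraMap_apply]
        simp }
  have hφ (f : PowerSeries P) : φ f = aug k P (PowerSeries.constantCoeff f) := rfl
  refine .of_basis _ (hasBasis_nhds_zero_powerSeries P) (fun r hr ↦ ?_) (fun x hx ↦ ?_) φ
    ⟨(⟨_, isOpen_ker_aug k P⟩, 1), fun f hf ↦ ?_⟩ fun i ↦ ?_
  · ext d
    rw [map_zero]
    exact FormalPointAlgebra.separated (k := k) _ fun 𝔞 h𝔞 ↦ hr (⟨𝔞, h𝔞⟩, d + 1) d d.lt_succ_self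
  · have (d : ℕ) := FormalPointAlgebra.complete (k := k)
      (fun 𝔞 : OpenIdeal P ↦ PowerSeries.coeff d (x (𝔞, d + 1))) fun 𝔞 𝔟 h ↦ by
        have := hx (𝔞, d + 1) (𝔟, d + 1) (coeffIdeal_mono h le_rfl) d d.lt_succ_self
        simpa using this
    choose r hr using this
    refine ⟨PowerSeries.mk r, fun i d hd ↦ ?_⟩
    have h1 := hr d i.1
    have h2 := hx i (i.1, d + 1) (coeffIdeal_mono le_rfl hd) d d.lt_succ_self
    rw [map_sub] at h2 ⊢
    rw [PowerSeries.coeff_mk]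
    have := sub_mem h1 h2
    convert this using 1
    ring
  · rw [RingHom.mem_ker, hφ]
    have := hf 0 zero_lt_one
    rw [PowerSeries.coeff_zero_eq_constantCoeff_apply] at this
    exact this
  · obtain ⟨a, ha⟩ := exists_ker_aug_pow_le k i.1.1 i.1.2
    let A := (RingHom.ker (aug k P)).map (PowerSeries.C (R := P))
    let B : Ideal (PowerSeries P) := Ideal.span {PowerSeries.X}
    have hle : RingHom.ker φ ≤ A ⊔ B := by
      intro f hf
      rw [RingHom.mem_ker, hφ] at hf
      rw [PowerSeries.eq_shift_mul_X_add_const f]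
      refine add_mem ((le_sup_right : B ≤ A ⊔ B) (B.mul_mem_left _
        (Ideal.mem_span_singleton_self _))) ((le_sup_left : A ≤ A ⊔ B)
          (Ideal.mem_map_of_mem _ hf))
    refine ⟨a + i.2, (Ideal.pow_right_mono hle _).trans
      (Ideal.sup_pow_add_le_pow_sup_pow.trans (sup_le ?_ ?_))⟩
    · rw [← Ideal.map_pow, Ideal.map_le_iff_le_comap]
      intro p hp d _
      rw [PowerSeries.coeff_C]
      split_ifs
      · exact ha hp
      · exact zero_mem _
    · rw [Ideal.span_singleton_pow, Ideal.span_singleton_le_iff_mem]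
      intro d hd
      rw [PowerSeries.coeff_X_pow, if_neg hd.ne]
      exact zero_mem _

variable {P' : Type*} [CommRing P'] [Algebra k P'] [TopologicalSpace P']

variable (k P) in
/-- Constant power series. -/
def psC [IsTopologicalRing P] : P →A[k] PowerSeries P where
  __ := (PowerSeries.C : P →+* PowerSeries P)
  commutes' c := by
    rw [PowerSeries.algebraMap_apply]
    rfl
  cont := PowerSeries.WithPiTopology.continuous_C

@[simp] lemma psC_apply [IsTopologicalRing P] (p : P) : psC k P p = PowerSeries.C p := rfl

variable (k P) in
/-- The constant coefficient. -/
def psConst [IsTopologicalRing P] : PowerSeries P →A[k] P where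
  __ := (PowerSeries.constantCoeff : PowerSeries P →+* P)
  commutes' c := by
    change PowerSeries.constantCoeff (algebraMap k (PowerSeries P) c) = _
    rw [PowerSeries.algebraMap_apply]
    simp
  cont := PowerSeries.WithPiTopology.continuous_constantCoeff P

@[simp] lemma psConst_apply [IsTopologicalRing P] (f : PowerSeries P) :
    psConst k P f = PowerSeries.constantCoeff f := rfl

@[simp] lemma aug_powerSeries [FormalPointAlgebra k P] (f : PowerSeries P) :
    aug k _ f = aug k P (PowerSeries.constantCoeff f) :=
  (aug_apply (psConst k P) f).symm

/-- The homomorphism of power series rings induced by a homomorphism of coefficients. -/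
def psMap (g : P →A[k] P') : PowerSeries P →A[k] PowerSeries P' where
  __ := PowerSeries.map (g : P →+* P')
  commutes' c := by
    change PowerSeries.map (g : P →+* P') (algebraMap k (PowerSeries P) c) = _
    rw [PowerSeries.algebraMap_apply, PowerSeries.algebraMap_apply, PowerSeries.map_C]
    congr 1
    exact g.toAlgHom.commutes c
  cont := by
    refine continuous_iff_continuousAt.2 fun f ↦ ?_
    refine (PowerSeries.WithPiTopology.tendsto_iff_coeff_tendsto P' _ _ _).2 fun d ↦ ?_
    have := (g.continuous.comp (PowerSeries.WithPiTopology.continuous_coeff P d)).tendsto f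
    refine (this.congr fun f ↦ (PowerSeries.coeff_map _ _ _).symm).trans_eq ?_
    exact congrArg 𝓝 (PowerSeries.coeff_map _ _ _).symm

@[simp] lemma coeff_psMap (g : P →A[k] P') (f : PowerSeries P) (n : ℕ) :
    PowerSeries.coeff n (psMap g f) = g (PowerSeries.coeff n f) :=
  PowerSeries.coeff_map _ _ _

@[simp] lemma constantCoeff_psMap (g : P →A[k] P') (f : PowerSeries P) :
    PowerSeries.constantCoeff (psMap g f) = g (PowerSeries.constantCoeff f) := by
  rw [← PowerSeries.coeff_zero_eq_constantCoeff_apply, coeff_psMap,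
    PowerSeries.coeff_zero_eq_constantCoeff_apply]

lemma exists_sub_mem_powerSeries [IsTopologicalRing P] [IsLinearTopology P P] (f : PowerSeries P)
    (𝔟 : Ideal (PowerSeries P)) (h : IsOpen (𝔟 : Set (PowerSeries P))) :
    ∃ p : Polynomial P, f - p ∈ 𝔟 := by
  obtain ⟨i, -, hi⟩ :=
    (hasBasis_nhds_zero_powerSeries P).mem_iff.1 (h.mem_nhds (zero_mem 𝔟))
  refine ⟨PowerSeries.trunc i.2 f, hi fun d hd ↦ ?_⟩
  rw [map_sub, Polynomial.coeff_coe, PowerSeries.coeff_trunc, if_pos hd, sub_self]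
  exact zero_mem _

variable [FormalPointAlgebra k P] [FormalPointAlgebra k P']

lemma continuousAlgHom_ext_powerSeries {F G : PowerSeries P →A[k] P'}
    (hC : ∀ p, F (PowerSeries.C p) = G (PowerSeries.C p))
    (hX : F PowerSeries.X = G PowerSeries.X) : F = G := by
  refine continuousAlgHom_ext_of_dense (fun p : Polynomial P ↦ (p : PowerSeries P))
    exists_sub_mem_powerSeries fun p ↦ ?_
  have : (F : PowerSeries P →+* P').comp Polynomial.coeToPowerSeries.ringHom =
      (G : PowerSeries P →+* P').comp Polynomial.coeToPowerSeries.ringHom := by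
    refine Polynomial.ringHom_ext (fun p ↦ ?_) ?_
    · simpa using hC p
    · simpa using hX
  exact congr($this p)

/-- Polynomials are dense, and evaluating them at `τ` is continuous: coefficients of degree at least
`n` contribute multiples of `τ ^ n`, which lie in the given open ideal. -/
lemma exists_psEval (F : P →A[k] P') {τ : P'} (hτ : aug k P' τ = 0) :
    ∃ G : PowerSeries P →A[k] P', (∀ p, G (PowerSeries.C p) = F p) ∧ G PowerSeries.X = τ := by
  let ι : Polynomial P →ₐ[k] PowerSeries P := Polynomial.coeToPowerSeries.algHom (A := P) |>.restrictScalars k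
  let f : Polynomial P →ₐ[k] P' := 
    { __ := Polynomial.eval₂RingHom (F : P →+* P') τ
      commutes' c := by
        change Polynomial.eval₂ (F : P →+* P') τ (algebraMap k (Polynomial P) c) = _
        rw [Polynomial.algebraMap_apply, Polynomial.eval₂_C]
        exact F.toAlgHom.commutes c }
  obtain ⟨G, hG⟩ := exists_continuousAlgHom_extension (P := P') ι (exists_sub_mem_powerSeries) f
    fun 𝔞 h𝔞 ↦ by
      obtain ⟨n, hn⟩ := exists_ker_aug_pow_le k 𝔞 h𝔞
      refine ⟨coeffIdeal (𝔞.comap (F : P →+* P')) n,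
        isOpen_coeffIdeal (h𝔞.preimage F.continuous) n, fun p hp ↦ ?_⟩
      change Polynomial.eval₂ (F : P →+* P') τ p ∈ 𝔞
      rw [Polynomial.eval₂_eq_sum_range]
      refine Ideal.sum_mem _ fun i _ ↦ ?_
      by_cases hi : i < n
      · have := hp i hi
        refine Ideal.mul_mem_right _ _ ?_
        rw [← Polynomial.coeff_coe] 
        exact this
      · refine Ideal.mul_mem_left _ _ (hn (Ideal.pow_le_pow_right (not_lt.1 hi) ?_))
        exact Ideal.pow_mem_pow hτ i
  refine ⟨G, fun p ↦ ?_, ?_⟩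
  · have := hG (Polynomial.C p)
    simpa [ι, f] using this
  · have := hG Polynomial.X
    simpa [ι, f] using this

/-- Evaluation of power series at a topologically nilpotent element. -/
def psEval (F : P →A[k] P') (τ : P') (hτ : aug k P' τ = 0) : PowerSeries P →A[k] P' :=
  (exists_psEval F hτ).choose

@[simp] lemma psEval_C (F : P →A[k] P') (τ : P') (hτ : aug k P' τ = 0) (p : P) :
    psEval F τ hτ (PowerSeries.C p) = F p := (exists_psEval F hτ).choose_spec.1 p

@[simp] lemma psEval_X (F : P →A[k] P') (τ : P') (hτ : aug k P' τ = 0) :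
    psEval F τ hτ PowerSeries.X = τ := (exists_psEval F hτ).choose_spec.2

/-- The tail of `f` is a multiple of `X ^ n`, which is sent to a multiple of `τ ^ n`. As `psEval`
comes from an extension property and not from a formula, these congruences are how it is computed.
-/
lemma psEval_sub_sum_mem (F : P →A[k] P') (τ : P') (hτ : aug k P' τ = 0) {𝔞 : Ideal P'} {n : ℕ}
    (hn : RingHom.ker (aug k P') ^ n ≤ 𝔞) (f : PowerSeries P) :
    psEval F τ hτ f - ∑ i ∈ Finset.range n, F (PowerSeries.coeff i f) * τ ^ i ∈ 𝔞 := by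
  have h1 : f = (PowerSeries.trunc n f : PowerSeries P) +
      PowerSeries.X ^ n * PowerSeries.mk fun i ↦ PowerSeries.coeff (n + i) f := by
    ext d
    rw [map_add, Polynomial.coeff_coe, PowerSeries.coeff_trunc, PowerSeries.coeff_X_pow_mul']
    split_ifs with h h' h'
    · omega
    · simp
    · simp [Nat.add_sub_cancel' h']
    · omega
  have h2 : psEval F τ hτ (PowerSeries.trunc n f : PowerSeries P) =
      ∑ i ∈ Finset.range n, F (PowerSeries.coeff i f) * τ ^ i := by
    have : PowerSeries.trunc n f = ∑ i ∈ Finset.range n,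
        Polynomial.C (PowerSeries.coeff i f) * Polynomial.X ^ i := by
      ext d
      simp [PowerSeries.coeff_trunc, Polynomial.coeff_X_pow]
    rw [this, ← Polynomial.coeToPowerSeries.ringHom_apply, map_sum, map_sum]
    simp
  conv in psEval F τ hτ f => rw [h1]
  rw [map_add, h2, add_sub_cancel_left, map_mul, map_pow, psEval_X]
  exact Ideal.mul_mem_right _ _ (hn (Ideal.pow_mem_pow hτ n))

end PowerSeries

/-! ### Discrete test algebras -/

section Discrete

variable {k : Type*} [Field k]

lemma formalPointAlgebra_of_discrete {D : Type*} [CommRing D] [Algebra k D] [TopologicalSpace D]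
    [DiscreteTopology D] (φ : D →ₐ[k] k) (hφ : IsNilpotent (RingHom.ker φ)) :
    FormalPointAlgebra k D := by
  have : IsTopologicalRing D := {}
  obtain ⟨n, hn⟩ := hφ
  refine .of_basis (fun _ : Unit ↦ (⊥ : Ideal D)) ?_ (fun r hr ↦ by simpa using hr ())
    (fun x _ ↦ ⟨x (), fun i ↦ by simp⟩) φ ⟨(), bot_le⟩ fun _ ↦ ⟨n, hn.le⟩
  rw [nhds_discrete]
  exact Filter.hasBasis_pure _

/-- A homomorphism to a discrete algebra is continuous if its kernel is open. -/
def continuousAlgHomOfDiscrete {R D : Type*} [CommRing R] [Algebra k R] [TopologicalSpace R]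
    [IsTopologicalRing R] [CommRing D] [Algebra k D] [TopologicalSpace D] [DiscreteTopology D]
    (f : R →ₐ[k] D) (hf : IsOpen (RingHom.ker f : Set R)) : R →A[k] D where
  __ := f
  cont := by
    have : IsTopologicalRing D := {}
    exact continuous_of_isOpen_comap (f : R →+* D) fun 𝔞 _ ↦
      isOpen_of_openIdeal_le hf (Ideal.comap_mono bot_le)

end Discrete

/-! ### Dual numbers with coefficients in a vector space: maps to them are tangent vectors -/

section SqZero

variable (k : Type u) [Field k] (V : Type v) [AddCommGroup V] [Module k V] [Module kᵐᵒᵖ V]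
  [IsCentralScalar k V]

/-- The discrete algebra `k ⊕ V` with `V² = 0`. -/
def SqZeroAlg : Type _ := TrivSqZeroExt k V

namespace SqZeroAlg

instance : CommRing (SqZeroAlg k V) := inferInstanceAs (CommRing (TrivSqZeroExt k V))

instance : Algebra k (SqZeroAlg k V) := inferInstanceAs (Algebra k (TrivSqZeroExt k V))

instance : TopologicalSpace (SqZeroAlg k V) := ⊥

instance : DiscreteTopology (SqZeroAlg k V) := ⟨rfl⟩

variable {k V}

/-- The component in `V`. -/
def snd : SqZeroAlg k V →ₗ[k] V := TrivSqZeroExt.sndHom k V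

variable (k V) in
/-- The component in `k`. -/
def fst : SqZeroAlg k V →ₐ[k] k := TrivSqZeroExt.fstHom k k V

@[ext] lemma ext {x y : SqZeroAlg k V} (h1 : fst k V x = fst k V y) (h2 : snd x = snd y) :
    x = y := TrivSqZeroExt.ext h1 h2

lemma snd_mul (x y : SqZeroAlg k V) :
    snd (x * y) = fst k V x • snd y + fst k V y • snd x := by
  have := TrivSqZeroExt.snd_mul (R := k) (M := V) x y
  rw [op_smul_eq_smul] at this
  exact this

/-- The element `c + v`. -/
def mk (c : k) (v : V) : SqZeroAlg k V := (c, v)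

@[simp] lemma fst_mk (c : k) (v : V) : fst k V (mk c v) = c := rfl

@[simp] lemma snd_mk (c : k) (v : V) : snd (mk c v) = v := rfl

@[simp] lemma snd_one : snd (1 : SqZeroAlg k V) = 0 :=
  TrivSqZeroExt.snd_one (R := k) (M := V)

@[simp] lemma snd_algebraMap (c : k) : snd (algebraMap k (SqZeroAlg k V) c) = 0 :=
  TrivSqZeroExt.snd_inl V c

instance : FormalPointAlgebra k (SqZeroAlg k V) := by
  refine formalPointAlgebra_of_discrete (fst k V) ⟨2, ?_⟩
  rw [Ideal.zero_eq_bot, eq_bot_iff, pow_two, Ideal.mul_le]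
  intro x hx y hy
  rw [RingHom.mem_ker] at hx hy
  rw [Ideal.mem_bot]
  ext
  · rw [map_mul, hx, zero_mul, map_zero]
  · rw [snd_mul, hx, hy, zero_smul, zero_smul, add_zero, map_zero]

@[simp] lemma aug_eq : aug k (SqZeroAlg k V) = fst k V :=
  (eq_aug _ (isOpen_discrete _)).symm

section

variable {A : Type*} [CommRing A] [Algebra k A] (χ : A →ₐ[k] k) (δ : A →ₗ[k] V)
  (hδ : ∀ a b, δ (a * b) = χ a • δ b + χ b • δ a)

omit [Module kᵐᵒᵖ V] [IsCentralScalar k V] in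
lemma map_one_of_leibniz (χ : A →ₐ[k] k) (δ : A →ₗ[k] V)
    (hδ : ∀ a b, δ (a * b) = χ a • δ b + χ b • δ a) : δ 1 = 0 := by
  have := hδ 1 1
  rwa [mul_one, map_one χ, one_smul, left_eq_add] at this

/-- The homomorphism `a ↦ χ a + δ a` for a derivation `δ`. -/
def ofDerivation : A →ₐ[k] SqZeroAlg k V where
  toFun a := mk (χ a) (δ a)
  map_one' := by ext <;> simp [map_one_of_leibniz χ δ hδ]
  map_mul' a b := by ext <;> simp [snd_mul, hδ]
  map_zero' := by ext <;> simp
  map_add' a b := by ext <;> simp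
  commutes' c := by
    ext
    · simp
    · simp [Algebra.algebraMap_eq_smul_one, map_one_of_leibniz χ δ hδ]

@[simp] lemma fst_ofDerivation (a : A) : fst k V (ofDerivation χ δ hδ a) = χ a := rfl

@[simp] lemma snd_ofDerivation (a : A) : snd (ofDerivation χ δ hδ a) = δ a := rfl

end

end SqZeroAlg

end SqZero

end

end ArcSpaces

namespace ArcSpaces

noncomputable section

open scoped PowerSeries.WithPiTopology Topology

/-! ### The zero tangent vector -/

section TrivialTangent

variable (k : Type*) [Field k] (R : Type*) [CommRing R] [Algebra k R] [TopologicalSpace R]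
  [FormalPointAlgebra k R] (V : Type*) [AddCommGroup V] [Module k V] [Module kᵐᵒᵖ V]
  [IsCentralScalar k V]

/-- The augmentation as a homomorphism to `k ⊕ V`. -/
def augSqZero : R →A[k] SqZeroAlg k V :=
  continuousAlgHomOfDiscrete (SqZeroAlg.ofDerivation (aug k R) 0 (by simp)) <| by
    refine isOpen_of_openIdeal_le (isOpen_ker_aug k R) fun r hr ↦ ?_
    rw [RingHom.mem_ker] at hr ⊢
    ext <;> simp [hr]

@[simp] lemma fst_augSqZero (r : R) : SqZeroAlg.fst k V (augSqZero k R V r) = aug k R r := rfl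

@[simp] lemma snd_augSqZero (r : R) : SqZeroAlg.snd (augSqZero k R V r) = 0 := rfl

end TrivialTangent

/-! ### Free extensions: products with formal affine spaces -/

section FreeExtension

variable {k : Type u} [Field k] {C R : Type u} [CommRing C] [Algebra k C] [TopologicalSpace C]
  [CommRing R] [Algebra k R] [TopologicalSpace R] [FormalPointAlgebra k R] {I : Type v}

/-- `R` is the completed tensor product of `C` and a formal power series ring in the variables
`z_i`, expressed by its universal property. -/
structure IsFreeExtension (a : C →A[k] R) (z : I → R) : Prop where
  aug_eq_zero : ∀ i, aug k R (z i) = 0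
  exists_hom : ∀ (P : Type w) [CommRing P] [Algebra k P] [TopologicalSpace P]
    [FormalPointAlgebra k P] (f : C →A[k] P) (b : I → P), (∀ i, aug k P (b i) = 0) →
      ∃ F : R →A[k] P, (∀ c, F (a c) = f c) ∧ ∀ i, F (z i) = b i
  hom_ext : ∀ (P : Type w) [CommRing P] [Algebra k P] [TopologicalSpace P]
    [FormalPointAlgebra k P] (F G : R →A[k] P), (∀ c, F (a c) = G (a c)) →
      (∀ i, F (z i) = G (z i)) → F = G

lemma isFreeExtension_of_equiv [IsTopologicalRing C]
    (e : R ≃A[k] completedTensor k C (PowerSeriesRing k I)) :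
    IsFreeExtension.{u, v, w} ((e.trans (ctensorEquiv k C _)).symm.toContinuousAlgHom.comp
      (tensorInl k C (PowerSeriesRing k I)))
      fun i ↦ (e.trans (ctensorEquiv k C _)).symm (ctensorInr k C _ (zvar k i)) := by
  let E := e.trans (ctensorEquiv k C (PowerSeriesRing k I))
  refine ⟨fun i ↦ ?_, fun P _ _ _ _ f b hb ↦ ?_, fun P _ _ _ _ F G h1 h2 ↦ ?_⟩
  · have := aug_apply (k := k) (E.symm.toContinuousAlgHom.comp (tensorInr k C (PowerSeriesRing k I)))
      (zvar k i)
    rw [aug_zvar] at this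
    exact this
  · obtain ⟨g, hg⟩ := exists_continuousAlgHom_powerSeriesRing b hb
    obtain ⟨F, hF1, hF2⟩ := exists_continuousAlgHom_completedTensor f g
    refine ⟨F.comp E.toContinuousAlgHom, fun c ↦ ?_, fun i ↦ ?_⟩
    · exact (congrArg F (E.apply_symm_apply _)).trans (hF1 c)
    · exact (congrArg F (E.apply_symm_apply _)).trans ((hF2 _).trans (hg i))
  · have h : F.comp E.symm.toContinuousAlgHom = G.comp E.symm.toContinuousAlgHom := by
      refine continuousAlgHom_ext_completedTensor h1 fun t ↦ ?_
      have : (F.comp E.symm.toContinuousAlgHom).comp (tensorInr k C (PowerSeriesRing k I)) =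
          (G.comp E.symm.toContinuousAlgHom).comp (tensorInr k C (PowerSeriesRing k I)) :=
        continuousAlgHom_ext_powerSeriesRing h2
      exact congr($this t)
    ext r
    have := congr($h (E r))
    change F (E.symm (E r)) = G (E.symm (E r)) at this
    rwa [E.symm_apply_apply] at this

lemma IsFreeExtension.reindex {a : C →A[k] R} {z : I → R}
    (h : IsFreeExtension.{u, v, w} a z) {I' : Type*} (σ : I' ≃ I) : IsFreeExtension.{u, _, w} a (z ∘ σ) := by
  refine ⟨fun i ↦ h.aug_eq_zero _, fun P _ _ _ _ f b hb ↦ ?_, fun P _ _ _ _ F G h1 h2 ↦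
    h.hom_ext P F G h1 fun i ↦ ?_⟩
  · obtain ⟨F, h1, h2⟩ := h.exists_hom P f (b ∘ σ.symm) fun i ↦ hb _
    exact ⟨F, h1, fun i ↦ by simp [h2]⟩
  · have := h2 (σ.symm i)
    simpa using this

/-- A tangent vector with value `1` on one variable and `0` on the others separates the variables.
Injectivity bounds the index set by `R`, so that it can be replaced by one in the universe of `R`.
-/
lemma IsFreeExtension.injective {a : C →A[k] R} {z : I → R}
    (h : IsFreeExtension.{u, v, u} a z)
    [FormalPointAlgebra k C] : Function.Injective z := by
  classical
  intro i j hij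
  by_contra hne
  obtain ⟨F, -, h2⟩ := h.exists_hom (SqZeroAlg k k) (augSqZero k C k)
    (fun l ↦ if l = i then SqZeroAlg.mk 0 1 else 0) fun l ↦ by split_ifs <;> simp
  have h3 := h2 j
  rw [← hij, h2 i, if_pos rfl, if_neg (Ne.symm hne)] at h3
  have := congrArg SqZeroAlg.snd h3
  simp at this

/-- Both sides have the same universal property. The two hypotheses express it for two universes of
test algebras: that of the completed tensor product and that of `R`. -/
theorem IsFreeExtension.nonempty_equiv {a : C →A[k] R} {z : I → R}
    (h : IsFreeExtension.{u, v, max u v} a z)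
    (h' : IsFreeExtension.{u, v, u} a z) [FormalPointAlgebra k C] :
    Nonempty (R ≃A[k] completedTensor k C (PowerSeriesRing k I)) := by
  obtain ⟨F, hF1, hF2⟩ := h.exists_hom (CTensor k C (PowerSeriesRing k I)) (tensorInl k C _)
    (fun j ↦ tensorInr k C _ (zvar k j)) fun j ↦ by simp
  obtain ⟨g, hg⟩ := exists_continuousAlgHom_powerSeriesRing z h.aug_eq_zero
  obtain ⟨G, hG1, hG2⟩ := exists_continuousAlgHom_completedTensor a g
  have h1 : G.comp F = ContinuousAlgHom.id k R := by
    refine h'.hom_ext R (G.comp F) (ContinuousAlgHom.id k R) (fun c ↦ ?_) fun i ↦ ?_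
    · exact (congrArg G (hF1 c)).trans (hG1 c)
    · exact (congrArg G (hF2 i)).trans ((hG2 _).trans (hg i))
  have h2 : F.comp G = ContinuousAlgHom.id k _ := by
    refine continuousAlgHom_ext_completedTensor (fun c ↦ ?_) fun t ↦ ?_
    · exact (congrArg F (hG1 c)).trans (hF1 c)
    · have : (F.comp G).comp (tensorInr k C _) = tensorInr k C (PowerSeriesRing k I) := by
        refine continuousAlgHom_ext_powerSeriesRing fun j ↦ ?_
        exact (congrArg F ((hG2 _).trans (hg j))).trans (hF2 j)
      exact congr($this t)
  exact ⟨(continuousAlgEquivOf F G (fun r ↦ congr($h1 r)) fun p ↦ congr($h2 p)).trans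
    (ctensorEquiv k C (PowerSeriesRing k I)).symm⟩

end FreeExtension

/-! ### Universal deformations of arcs, and statement 1 -/

section UniversalArc

variable {k : Type u} [Field k] {C Q : Type u} [CommRing C] [Algebra k C] [TopologicalSpace C]
  [CommRing Q] [Algebra k Q] [TopologicalSpace Q] [FormalPointAlgebra k Q]

/-- The universal deformation of an arc on a formal scheme. -/
structure IsUniversalArc (a : C →A[k] PowerSeries Q) : Prop where
  exists_lift : ∀ (P : Type u) [CommRing P] [Algebra k P] [TopologicalSpace P]
    [FormalPointAlgebra k P] (F : C →A[k] PowerSeries P),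
    (∀ c n, aug k P (PowerSeries.coeff n (F c)) = aug k Q (PowerSeries.coeff n (a c))) →
      ∃ g : Q →A[k] P, ∀ c n, g (PowerSeries.coeff n (a c)) = PowerSeries.coeff n (F c)
  hom_ext : ∀ (P : Type u) [CommRing P] [Algebra k P] [TopologicalSpace P]
    [FormalPointAlgebra k P] (g g' : Q →A[k] P),
    (∀ c n, g (PowerSeries.coeff n (a c)) = g' (PowerSeries.coeff n (a c))) → g = g'

variable {C' Q' : Type u} [CommRing C'] [Algebra k C'] [TopologicalSpace C']
  [CommRing Q'] [Algebra k Q'] [TopologicalSpace Q'] [FormalPointAlgebra k Q']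
  [FormalPointAlgebra k C']

/-- The universal deformation of an arc `γ` on `Spf C' = Spf C × Spf k[[z_i]]` is a free extension
of the universal deformation of the image of `γ` in `Spf C`. -/
theorem IsUniversalArc.exists_isFreeExtension {u : C →A[k] PowerSeries Q}
    {u' : C' →A[k] PowerSeries Q'} (hu : IsUniversalArc u) (hu' : IsUniversalArc u') {I : Type v}
    {a : C →A[k] C'} {z : I → C'} (h : IsFreeExtension.{u, v, u} a z)
    (heq : ∀ c n, aug k Q' (PowerSeries.coeff n (u' (a c))) = aug k Q (PowerSeries.coeff n (u c))) :
    ∃ (b : Q →A[k] Q') (w : I × ℕ → Q'), IsFreeExtension.{u, v, u} b w := by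
  obtain ⟨b, hb⟩ := hu.exists_lift Q' (u'.comp a) heq
  -- The new variables are the coefficients of the universal series for `z_i`. Their values at `γ`
  -- are subtracted because `γ` need not be constant in the direction of `z_i`, while variables must
  -- lie in the maximal ideal.
  let w : I × ℕ → Q' := fun i ↦ PowerSeries.coeff i.2 (u' (z i.1)) -
    algebraMap k Q' (aug k Q' (PowerSeries.coeff i.2 (u' (z i.1))))
  refine ⟨b, w, fun i ↦ by simp [w], fun P _ _ _ _ f v hv ↦ ?_, fun P _ _ _ _ F G h1 h2 ↦ ?_⟩
  -- On `C` take the deformation given by `f`, and let `z_i` go to the series of `γ` perturbed by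
  -- the prescribed values `v`. The constant term is in the maximal ideal because `z_i` vanishes at
  -- `γ(0)`.
  · obtain ⟨F, hF1, hF2⟩ := h.exists_hom (PowerSeries P) ((psMap f).comp u)
      (fun i ↦ PowerSeries.mk fun n ↦
        algebraMap k P (aug k Q' (PowerSeries.coeff n (u' (z i)))) + v (i, n)) fun i ↦ by
        rw [aug_powerSeries, ← PowerSeries.coeff_zero_eq_constantCoeff_apply,
          PowerSeries.coeff_mk, map_add, hv, AlgHom.commutes, add_zero,
          PowerSeries.coeff_zero_eq_constantCoeff_apply, ← aug_powerSeries, aug_apply,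
          h.aug_eq_zero]
        rfl
    -- With the augmentation viewed as a continuous map to the discrete algebra `k ⊕ k`, uniqueness
    -- in the universal property of `C'` shows that `F` reduces to `γ`.
    have hF : (psMap (augSqZero k P k)).comp F = (psMap (augSqZero k Q' k)).comp u' := by
      refine h.hom_ext _ _ _ (fun c ↦ ?_) fun i ↦ ?_
      · ext n
        · simp only [ContinuousAlgHom.comp_apply, coeff_psMap, fst_augSqZero, hF1, heq, aug_apply]
        · simp only [ContinuousAlgHom.comp_apply, coeff_psMap, snd_augSqZero]
      · ext n
        · simp only [ContinuousAlgHom.comp_apply, coeff_psMap, fst_augSqZero, hF2]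
          simp [hv]
        · simp only [ContinuousAlgHom.comp_apply, coeff_psMap, snd_augSqZero]
    obtain ⟨g, hg⟩ := hu'.exists_lift P F fun c n ↦ by
      have := congr(SqZeroAlg.fst k k (PowerSeries.coeff n ($hF c)))
      simpa only [ContinuousAlgHom.comp_apply, coeff_psMap, fst_augSqZero] using this
    refine ⟨g, fun q ↦ ?_, fun i ↦ ?_⟩
    · have : g.comp b = f := by
        refine hu.hom_ext _ _ _ fun c n ↦ ?_
        simp only [ContinuousAlgHom.comp_apply] at hb hF1 ⊢
        rw [hb, hg, hF1, coeff_psMap]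
      exact congr($this q)
    · simp only [w, map_sub, hg, hF2, PowerSeries.coeff_mk]
      rw [AlgHomClass.commutes g]
      ring
  · refine hu'.hom_ext _ _ _ fun c n ↦ ?_
    have : (psMap F).comp u' = (psMap G).comp u' := by
      refine h.hom_ext _ _ _ (fun c ↦ ?_) fun i ↦ ?_
      · ext n
        have := hb c n
        simp only [ContinuousAlgHom.comp_apply] at this
        simp only [ContinuousAlgHom.comp_apply, coeff_psMap, ← this, h1]
      · ext n
        have := h2 (i, n)
        simp only [w, map_sub, AlgHomClass.commutes] at this
        simpa only [ContinuousAlgHom.comp_apply, coeff_psMap] using sub_left_injective this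
    have := congr(PowerSeries.coeff n ($this c))
    simpa only [ContinuousAlgHom.comp_apply, coeff_psMap] using this

/-- The first statement of the theorem for abstract universal arcs. -/
theorem IsUniversalArc.exists_nonempty_equiv {u : C →A[k] PowerSeries Q}
    {u' : C' →A[k] PowerSeries Q'} (hu : IsUniversalArc u) (hu' : IsUniversalArc u') {I : Type v}
    [FormalPointAlgebra k C]
    {a : C →A[k] C'} {z : I → C'} (h : IsFreeExtension.{u, v, u} a z)
    (heq : ∀ c n, aug k Q' (PowerSeries.coeff n (u' (a c))) = aug k Q (PowerSeries.coeff n (u c))) :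
    ∃ J : Type u, Nonempty (Q' ≃A[k] completedTensor k Q (PowerSeriesRing k J)) := by
  have : Small.{u} I := small_of_injective h.injective
  have h' := h.reindex (equivShrink I).symm
  obtain ⟨b, w, hw⟩ := hu.exists_isFreeExtension hu' h' heq
  exact ⟨_, hw.nonempty_equiv hw⟩

end UniversalArc

end

end ArcSpaces

namespace ArcSpaces

noncomputable section

open scoped PowerSeries.WithPiTopology Topology

/-! ### Divided powers and the exponential of a derivation in characteristic zero -/

section Exponential

variable {k A : Type*} [Field k] [CommRing A] [Algebra k A] (D : Derivation k A A)

/-- The divided powers `Dⁿ / n!` of a derivation. -/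
def divPow (n : ℕ) : A →ₗ[k] A := ((n.factorial : k)⁻¹) • (D : A →ₗ[k] A) ^ n

@[simp] lemma divPow_zero (a : A) : divPow D 0 a = a := by simp [divPow]

variable [CharZero k]

lemma succ_smul_divPow (n : ℕ) (a : A) :
    ((n : k) + 1) • divPow D (n + 1) a = D (divPow D n a) := by
  have h1 : (n.factorial : k) ≠ 0 := by exact_mod_cast n.factorial_ne_zero
  have h2 : (n : k) + 1 ≠ 0 := by exact_mod_cast n.succ_ne_zero
  simp only [divPow, LinearMap.smul_apply, smul_smul, pow_succ', Module.End.mul_apply]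
  rw [Nat.factorial_succ, Nat.cast_mul, Nat.cast_succ, mul_inv, mul_inv_cancel_left₀ h2]
  exact (D.map_smul _ _).symm

/-- Induction through the recursion `succ_smul_divPow`, which avoids factorials. This higher Leibniz
rule is what makes `expDerivation` multiplicative. -/
lemma divPow_mul (n : ℕ) (a b : A) : divPow D n (a * b) =
    ∑ x ∈ Finset.HasAntidiagonal.antidiagonal n, divPow D x.1 a * divPow D x.2 b := by
  induction n with
  | zero => simp
  | succ n ih =>
    have h : (n : k) + 1 ≠ 0 := by exact_mod_cast n.succ_ne_zero
    refine smul_right_injective A h ?_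
    change ((n : k) + 1) • divPow D (n + 1) (a * b) = ((n : k) + 1) • _
    rw [succ_smul_divPow, ih, map_sum]
    -- The factor `n + 1` is split as `x.1 + x.2` on the antidiagonal; each half loses its zero term
    -- and is reindexed by the successor, matching the two terms of the Leibniz rule.
    have h1 : ((n : k) + 1) • ∑ x ∈ Finset.HasAntidiagonal.antidiagonal (n + 1),
        divPow D x.1 a * divPow D x.2 b =
        (∑ x ∈ Finset.HasAntidiagonal.antidiagonal (n + 1),
          (x.1 : k) • (divPow D x.1 a * divPow D x.2 b)) +
        ∑ x ∈ Finset.HasAntidiagonal.antidiagonal (n + 1),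
          (x.2 : k) • (divPow D x.1 a * divPow D x.2 b) := by
      rw [Finset.smul_sum, ← Finset.sum_add_distrib]
      refine Finset.sum_congr rfl fun x hx ↦ ?_
      rw [← add_smul, ← Nat.cast_add, Finset.HasAntidiagonal.mem_antidiagonal.1 hx, Nat.cast_succ]
    rw [h1, Finset.Nat.sum_antidiagonal_succ, Finset.Nat.sum_antidiagonal_succ']
    simp only [Nat.cast_zero, zero_smul, zero_add, Nat.cast_succ]
    rw [← Finset.sum_add_distrib]
    refine Finset.sum_congr rfl fun x _ ↦ ?_
    rw [D.leibniz, ← smul_mul_assoc, ← mul_smul_comm, succ_smul_divPow, succ_smul_divPow,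
      smul_eq_mul, smul_eq_mul]
    ring

lemma divPow_divPow (i j : ℕ) (a : A) :
    divPow D j (divPow D i a) = (i + j).choose i • divPow D (i + j) a := by
  have h1 : (i.factorial : k) ≠ 0 := by exact_mod_cast i.factorial_ne_zero
  have h2 : (j.factorial : k) ≠ 0 := by exact_mod_cast j.factorial_ne_zero
  have h3 : ((i + j).factorial : k) ≠ 0 := by exact_mod_cast (i + j).factorial_ne_zero
  simp only [divPow, LinearMap.smul_apply, map_smul, smul_smul, ← Nat.cast_smul_eq_nsmul k]
  rw [← Module.End.mul_apply, ← pow_add, add_comm j i]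
  congr 1
  have := Nat.add_choose_mul_factorial_mul_factorial j i
  rw [add_comm j i, mul_right_comm] at this
  have : ((i + j).choose i : k) * i.factorial * j.factorial = (i + j).factorial := by
    exact_mod_cast this
  field_simp
  rw [← this]
  ring

variable [TopologicalSpace A] [IsTopologicalRing A] (hD : Continuous D)

/-- The exponential `a ↦ ∑ Dⁿ(a) εⁿ / n!` of a continuous derivation. -/
def expDerivation (hD : Continuous D) : A →A[k] PowerSeries A where
  toFun a := PowerSeries.mk fun n ↦ divPow D n a
  map_one' := by
    ext n
    rw [PowerSeries.coeff_mk, PowerSeries.coeff_one]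
    cases n with
    | zero => simp
    | succ n =>
      have h : (n : k) + 1 ≠ 0 := by exact_mod_cast n.succ_ne_zero
      refine smul_right_injective A h ?_
      change ((n : k) + 1) • divPow D (n + 1) 1 = ((n : k) + 1) • _
      rw [succ_smul_divPow, if_neg n.succ_ne_zero, smul_zero]
      simp only [divPow, LinearMap.smul_apply]
      rw [D.map_smul, ← Derivation.coeFn_coe, ← Module.End.mul_apply, ← pow_succ', pow_succ,
        Module.End.mul_apply, Derivation.coeFn_coe, Derivation.map_one_eq_zero, map_zero, smul_zero]
  map_mul' a b := by
    ext n
    simp [PowerSeries.coeff_mul, divPow_mul]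
  map_zero' := by
    ext n
    simp
  map_add' a b := by
    ext n
    simp
  commutes' c := by
    ext n
    rw [PowerSeries.algebraMap_apply, PowerSeries.coeff_mk, PowerSeries.coeff_C]
    cases n with
    | zero => simp
    | succ n =>
      have h : (n : k) + 1 ≠ 0 := by exact_mod_cast n.succ_ne_zero
      refine smul_right_injective A h ?_
      change ((n : k) + 1) • divPow D (n + 1) _ = ((n : k) + 1) • _
      rw [succ_smul_divPow, if_neg n.succ_ne_zero, smul_zero]
      simp only [divPow, LinearMap.smul_apply]
      rw [D.map_smul, ← Derivation.coeFn_coe, ← Module.End.mul_apply, ← pow_succ', pow_succ,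
        Module.End.mul_apply, Derivation.coeFn_coe, Derivation.map_algebraMap, map_zero, smul_zero]
  cont := by
    refine continuous_iff_continuousAt.2 fun a ↦
      (PowerSeries.WithPiTopology.tendsto_iff_coeff_tendsto A _ _ _).2 fun n ↦ ?_
    have h (n : ℕ) : Continuous ((D : A →ₗ[k] A) ^ n) := by
      induction n with
      | zero => exact continuous_id
      | succ n ih =>
        rw [pow_succ']
        exact hD.comp ih
    have h2 : Continuous (divPow D n) := by
      have : (divPow D n : A → A) =
          fun a ↦ algebraMap k A (n.factorial : k)⁻¹ * ((D : A →ₗ[k] A) ^ n) a := by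
        ext a
        rw [divPow, LinearMap.smul_apply, Algebra.smul_def]
      rw [this]
      exact continuous_const.mul (h n)
    refine (h2.tendsto a).congr (fun f ↦ (PowerSeries.coeff_mk _ _).symm) |>.trans_eq ?_
    exact congrArg 𝓝 (PowerSeries.coeff_mk n fun n ↦ divPow D n a).symm

@[simp] lemma coeff_expDerivation (n : ℕ) (a : A) :
    PowerSeries.coeff n (expDerivation D hD a) = divPow D n a :=
  PowerSeries.coeff_mk n fun n ↦ divPow D n a

end Exponential

/-- The square `i, j < n` and the triangle `i + j < n` differ only by terms of total degree at least
`n`. -/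
lemma sum_range_sum_range_sub_sum_antidiagonal_mem {P : Type*} [CommRing P] (𝔞 : Ideal P) (n : ℕ)
    (T : ℕ × ℕ → P) (hT : ∀ x : ℕ × ℕ, n ≤ x.1 + x.2 → T x ∈ 𝔞) :
    ∑ i ∈ Finset.range n, ∑ j ∈ Finset.range n, T (i, j) -
      ∑ l ∈ Finset.range n, ∑ x ∈ Finset.HasAntidiagonal.antidiagonal l, T x ∈ 𝔞 := by
  classical
  rw [← Finset.sum_product', ← Finset.sum_filter_add_sum_filter_not
    (Finset.range n ×ˢ Finset.range n) (fun x ↦ x.1 + x.2 < n)]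
  have : ∑ l ∈ Finset.range n, ∑ x ∈ Finset.HasAntidiagonal.antidiagonal l, T x =
      ∑ x ∈ Finset.range n ×ˢ Finset.range n with x.1 + x.2 < n, T x := by
    rw [← Finset.sum_fiberwise_of_maps_to (t := Finset.range n) (g := fun x : ℕ × ℕ ↦ x.1 + x.2)
      fun x hx ↦ Finset.mem_range.2 (Finset.mem_filter.1 hx).2]
    refine Finset.sum_congr rfl fun l hl ↦ Finset.sum_congr ?_ fun _ _ ↦ rfl
    ext x
    simp only [Finset.HasAntidiagonal.mem_antidiagonal, Finset.mem_filter, Finset.mem_product,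
      Finset.mem_range] at hl ⊢
    omega
  rw [this, add_sub_cancel_left]
  exact Ideal.sum_mem _ fun x hx ↦ hT x (not_lt.1 (Finset.mem_filter.1 hx).2)

/-! ### The flow of a derivation -/

section Flow

variable {k A : Type*} [Field k] [CharZero k] [CommRing A] [Algebra k A] [TopologicalSpace A]
  [FormalPointAlgebra k A] (D : Derivation k A A) (hD : Continuous D)
  {P : Type*} [CommRing P] [Algebra k P] [TopologicalSpace P] [FormalPointAlgebra k P]

/-- The homomorphism `a ↦ ∑ F(Dⁿ(a)) τⁿ / n!`. -/
def flow (F : A →A[k] P) (τ : P) (hτ : aug k P τ = 0) : A →A[k] P :=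
  (psEval F τ hτ).comp (expDerivation D hD)

lemma flow_zero (F : A →A[k] P) : flow D hD F 0 (map_zero _) = F := by
  have : psEval F 0 (map_zero (aug k P)) = F.comp (psConst k A) :=
    continuousAlgHom_ext_powerSeries (fun p ↦ by simp) (by simp)
  ext a
  rw [flow, this]
  change F (PowerSeries.constantCoeff (expDerivation D hD a)) = F a
  rw [← PowerSeries.coeff_zero_eq_constantCoeff_apply, coeff_expDerivation, divPow_zero]

lemma comp_flow {P' : Type*} [CommRing P'] [Algebra k P'] [TopologicalSpace P']
    [FormalPointAlgebra k P'] (G : P →A[k] P') (F : A →A[k] P) (τ : P) (hτ : aug k P τ = 0) :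
    G.comp (flow D hD F τ hτ) = flow D hD (G.comp F) (G τ) (by rw [aug_apply, hτ]) := by
  have : G.comp (psEval F τ hτ) = psEval (G.comp F) (G τ) (by rw [aug_apply, hτ]) :=
    continuousAlgHom_ext_powerSeries (fun p ↦ by simp) (by simp)
  rw [flow, flow, ← this]
  rfl

lemma flow_sub_sum_mem (F : A →A[k] P) (τ : P) (hτ : aug k P τ = 0) {𝔞 : Ideal P} {n : ℕ}
    (hn : RingHom.ker (aug k P) ^ n ≤ 𝔞) (a : A) :
    flow D hD F τ hτ a - ∑ i ∈ Finset.range n, F (divPow D i a) * τ ^ i ∈ 𝔞 := by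
  have := psEval_sub_sum_mem F τ hτ hn (expDerivation D hD a)
  simp only [coeff_expDerivation] at this
  exact this

/-- The one-parameter group law. Modulo an open ideal both sides are finite sums: the composite runs
over a square of exponents, the binomial expansion of `(τ + σ) ^ l` over a triangle, and the
difference has high order in `τ` and `σ`. -/
lemma flow_flow (F : A →A[k] P) (σ τ : P) (hσ : aug k P σ = 0) (hτ : aug k P τ = 0) :
    flow D hD (flow D hD F σ hσ) τ hτ = flow D hD F (τ + σ) (by rw [map_add, hσ, hτ, add_zero]) := by
  ext a
  refine eq_of_forall_sub_mem k fun 𝔞 h𝔞 ↦ ?_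
  obtain ⟨n, hn⟩ := exists_ker_aug_pow_le k 𝔞 h𝔞
  have h1 := flow_sub_sum_mem D hD (flow D hD F σ hσ) τ hτ hn a
  have h2 := flow_sub_sum_mem D hD F (τ + σ) (by rw [map_add, hσ, hτ, add_zero]) hn a
  have h3 : ∑ i ∈ Finset.range n, flow D hD F σ hσ (divPow D i a) * τ ^ i -
      ∑ i ∈ Finset.range n, (∑ j ∈ Finset.range n, F (divPow D j (divPow D i a)) * σ ^ j) * τ ^ i
      ∈ 𝔞 := by
    rw [← Finset.sum_sub_distrib]
    refine Ideal.sum_mem _ fun i _ ↦ ?_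
    rw [← sub_mul]
    exact Ideal.mul_mem_right _ _ (flow_sub_sum_mem D hD F σ hσ hn _)
  let T : ℕ × ℕ → P := fun x ↦
    (x.1 + x.2).choose x.1 • (F (divPow D (x.1 + x.2) a) * (τ ^ x.1 * σ ^ x.2))
  have h4 := sum_range_sum_range_sub_sum_antidiagonal_mem 𝔞 n T fun x hx ↦ by
    refine nsmul_mem (Ideal.mul_mem_left _ _ (hn (Ideal.pow_le_pow_right hx ?_))) _
    rw [pow_add]
    exact Ideal.mul_mem_mul (Ideal.pow_mem_pow hτ _) (Ideal.pow_mem_pow hσ _)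
  have h5 : ∑ i ∈ Finset.range n,
      (∑ j ∈ Finset.range n, F (divPow D j (divPow D i a)) * σ ^ j) * τ ^ i =
      ∑ i ∈ Finset.range n, ∑ j ∈ Finset.range n, T (i, j) := by
    refine Finset.sum_congr rfl fun i _ ↦ ?_
    rw [Finset.sum_mul]
    refine Finset.sum_congr rfl fun j _ ↦ ?_
    rw [divPow_divPow, map_nsmul, smul_mul_assoc, smul_mul_assoc]
    congr 1
    ring
  have h6 : ∑ i ∈ Finset.range n, F (divPow D i a) * (τ + σ) ^ i =
      ∑ l ∈ Finset.range n, ∑ x ∈ Finset.HasAntidiagonal.antidiagonal l, T x := by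
    refine Finset.sum_congr rfl fun l _ ↦ ?_
    rw [(Commute.all τ σ).add_pow', Finset.mul_sum]
    refine Finset.sum_congr rfl fun x hx ↦ ?_
    rw [← Finset.HasAntidiagonal.mem_antidiagonal.1 hx, mul_smul_comm]
  rw [h5] at h3
  rw [h6] at h2
  have := sub_mem (add_mem (add_mem h1 h3) h4) h2
  convert this using 1
  ring

end Flow

/-! ### Formal point algebras are admissible -/

section Admissible

/-- A Cauchy filter has, for each open ideal, a member of that size; points chosen in these members
form a compatible family, whose limit is a limit of the filter. The maximal ideal is an ideal of
definition. -/
lemma FormalPointAlgebra.isAdmissibleRing (k : Type*) [Field k] {S : Type*} [CommRing S]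
    [Algebra k S] [TopologicalSpace S] [FormalPointAlgebra k S] : IsAdmissibleRing S := by
  have hbasis := IsLinearTopology.hasBasis_open_ideal (R := S)
  refine ⟨inferInstance, inferInstance, ?_, ?_, RingHom.ker (aug k S), isOpen_ker_aug k S, ?_⟩
  · refine IsTopologicalAddGroup.t2Space_of_zero_sep fun x hx ↦ ?_
    by_contra! h
    refine hx (FormalPointAlgebra.separated (k := k) x fun 𝔞 h𝔞 ↦ ?_)
    exact h _ (h𝔞.mem_nhds (zero_mem 𝔞))
  · let := IsTopologicalAddGroup.rightUniformSpace S
    have : IsUniformAddGroup S := isUniformAddGroup_of_addCommGroup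
    refine ⟨fun {f} hf ↦ ?_⟩
    have hne := hf.1
    have key (𝔞 : OpenIdeal S) : ∃ t ∈ f, ∀ x ∈ t, ∀ y ∈ t, x - y ∈ 𝔞.1 := by
      have hU : {p : S × S | p.2 - p.1 ∈ 𝔞.1} ∈ uniformity S := by
        rw [uniformity_eq_comap_nhds_zero]
        exact Filter.preimage_mem_comap (𝔞.2.mem_nhds (zero_mem 𝔞.1))
      obtain ⟨t, ht, h⟩ := (cauchy_iff.1 hf).2 _ hU
      exact ⟨t, ht, fun x hx y hy ↦ h (Set.mk_mem_prod hy hx)⟩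
    choose t ht h using key
    choose x hx using fun 𝔞 ↦ hne.nonempty_of_mem (ht 𝔞)
    obtain ⟨r, hr⟩ := FormalPointAlgebra.complete (k := k) x fun 𝔞 𝔟 hle ↦ by
      obtain ⟨y, hy1, hy2⟩ := hne.nonempty_of_mem (Filter.inter_mem (ht 𝔞) (ht 𝔟))
      have := add_mem (hle (h 𝔞 _ (hx 𝔞) y hy1)) (h 𝔟 y hy2 _ (hx 𝔟))
      simpa using this
    refine ⟨r, fun U hU ↦ ?_⟩
    have hU' : (fun z ↦ r + z) ⁻¹' U ∈ 𝓝 (0 : S) := by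
      refine (continuous_const.add continuous_id).continuousAt.preimage_mem_nhds ?_
      simpa using hU
    obtain ⟨𝔞, h𝔞, hle⟩ := hbasis.mem_iff.1 hU'
    filter_upwards [ht ⟨𝔞, h𝔞⟩] with y hy
    have h1 := sub_mem (h ⟨𝔞, h𝔞⟩ y hy _ (hx ⟨𝔞, h𝔞⟩)) (hr ⟨𝔞, h𝔞⟩)
    have h2 : y - r ∈ 𝔞 := by simpa using h1
    have := hle h2
    simpa using this
  · intro V hV
    obtain ⟨𝔞, h𝔞, hle⟩ := hbasis.mem_iff.1 hV
    obtain ⟨n, hn⟩ := exists_ker_aug_pow_le k 𝔞 h𝔞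
    exact ⟨n, Set.Subset.trans hn hle⟩

end Admissible

/-! ### Splitting off a smooth factor along a derivation -/

section SmoothFactor

variable {k : Type u} [Field k] [CharZero k] {O : Type u} [CommRing O] [Algebra k O] {I : Ideal O}

/-- A continuous derivation that does not preserve the maximal ideal gives rise to a smooth
factor. -/
theorem hasSmoothFactor_of_derivation (χ : O →ₐ[k] k) (hI : I = RingHom.ker χ)
    [FormalPointAlgebra k (AdicCompletion I O)]
    (D : Derivation k (AdicCompletion I O) (AdicCompletion I O)) (hD : Continuous D)
    (a : AdicCompletion I O) (ha : aug k _ (D a) ≠ 0) :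
    HasSmoothFactor k (AdicCompletion I O) := by
  -- By density the derivation is already nonzero modulo the maximal ideal on an element of `O`.
  -- This allows the complementary factor to be the completion of a quotient of `O`.
  obtain ⟨o, ho⟩ : ∃ o : O, aug k _ (D (completionOf I k o)) ≠ 0 := by
    have h0 : D ⁻¹' (RingHom.ker (aug k (AdicCompletion I O)) : Set (AdicCompletion I O)) ∈ 𝓝 0 :=
      ((isOpen_ker_aug k _).preimage hD).mem_nhds (by simp)
    obtain ⟨𝔟, h𝔟, hle⟩ := (IsLinearTopology.hasBasis_open_ideal
      (R := AdicCompletion I O)).mem_iff.1 h0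
    obtain ⟨o, ho⟩ := exists_sub_mem_adicCompletion I a 𝔟 h𝔟
    refine ⟨o, fun h ↦ ha ?_⟩
    have h1 : aug k _ (D (a - completionOf I k o)) = 0 := hle ho
    rwa [map_sub, map_sub, h, sub_zero] at h1
  let y : O := o - algebraMap k O (χ o)
  have hy : χ y = 0 := by simp [y]
  let y' := completionOf I k y
  have hy' : aug k _ y' = 0 := by rw [aug_completionOf χ hI, hy]
  have hDy : D y' = D (completionOf I k o) := by
    simp only [y', y, map_sub, AlgHom.commutes, Derivation.map_algebraMap, sub_zero]
  rw [← hDy] at ho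
  obtain ⟨v, hv⟩ := isUnit_of_aug_ne_zero ho
  -- Rescaled so that `D' y' = 1`. Then all higher iterates kill `y'`, and the flow acts on `y'` by
  -- translation.
  let D' : Derivation k (AdicCompletion I O) (AdicCompletion I O) := (↑v⁻¹ : AdicCompletion I O) • D
  have hD' : Continuous D' := continuous_const.mul hD
  have hDy' : D' y' = 1 := by
    change (↑v⁻¹ : AdicCompletion I O) * D y' = 1
    rw [← hv, Units.inv_mul]
  have hflow {P : Type u} [CommRing P] [Algebra k P] [TopologicalSpace P] [FormalPointAlgebra k P]
      (F : AdicCompletion I O →A[k] P) (τ : P) (hτ : aug k P τ = 0) :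
      flow D' hD' F τ hτ y' = F y' + τ := by
    have h1 : expDerivation D' hD' y' = PowerSeries.C y' + PowerSeries.X := by
      refine PowerSeries.ext fun n ↦ ?_
      rw [coeff_expDerivation, map_add, PowerSeries.coeff_C, PowerSeries.coeff_X]
      match n with
      | 0 => simp
      | 1 => 
        have := succ_smul_divPow D' 0 y'
        simpa [hDy'] using this
      | n + 2 =>
        simp only [divPow, LinearMap.smul_apply, pow_succ, Module.End.mul_apply,
          Derivation.coeFn_coe, hDy', Derivation.map_one_eq_zero, map_zero, smul_zero]
        simp
    change psEval F τ hτ (expDerivation D' hD' y') = _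
    rw [h1, map_add, psEval_C, psEval_X]
  let O₁ := O ⧸ Ideal.span {y}
  let χ₁ : O₁ →ₐ[k] k := Ideal.Quotient.liftₐ _ χ fun b hb ↦ by
    obtain ⟨c, rfl⟩ := Ideal.mem_span_singleton'.1 hb
    rw [map_mul, hy, mul_zero]
  let I₁ : Ideal O₁ := RingHom.ker χ₁
  let S := AdicCompletion I₁ O₁
  have : FormalPointAlgebra k S := formalPointAlgebra_adicCompletion χ₁ rfl
  obtain ⟨π, hπ⟩ := exists_continuousAlgHom_completion χ hI
    ((completionOf I₁ k).comp (Ideal.Quotient.mkₐ k (Ideal.span {y}))) fun b ↦ by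
      rw [AlgHom.comp_apply, aug_completionOf χ₁ rfl]
      rfl
  have hπy : π y' = 0 := by
    rw [hπ, AlgHom.comp_apply, Ideal.Quotient.mkₐ_eq_mk,
      Ideal.Quotient.eq_zero_iff_mem.2 (Ideal.mem_span_singleton_self y), map_zero]
  have hny : aug k _ (-y') = 0 := by rw [map_neg, hy', neg_zero]
  -- Flowing for the time `-y'` retracts onto the locus `y' = 0`. So `θ` kills `y'` and factors as
  -- `σ ∘ π` through the completion `S` of `O / (y)`.
  let θ := flow D' hD' (ContinuousAlgHom.id k _) (-y') hny
  have hθy : θ y' = 0 := (hflow _ _ _).trans (add_neg_cancel y')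
  obtain ⟨σ, hσ⟩ := exists_continuousAlgHom_completion (P := AdicCompletion I O) χ₁ rfl
    (Ideal.Quotient.liftₐ _ ((θ : _ →ₐ[k] _).comp (completionOf I k)) fun b hb ↦ by
      obtain ⟨c, rfl⟩ := Ideal.mem_span_singleton'.1 hb
      rw [map_mul]
      exact (congrArg (_ * ·) hθy).trans (mul_zero _)) fun b ↦ by
    obtain ⟨b, rfl⟩ := Ideal.Quotient.mk_surjective b
    exact (aug_apply θ _).trans (aug_completionOf χ hI b)
  have hσπ : σ.comp π = θ := by
    refine continuousAlgHom_ext_completion fun b ↦ ?_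
    change σ (π _) = _
    rw [hπ]
    exact hσ _
  have hfree : IsFreeExtension.{u, 0, u} σ fun _ : PUnit.{1} ↦ y' := by
    refine ⟨fun _ ↦ hy', fun P _ _ _ _ f b hb ↦ ?_, fun P _ _ _ _ F G h1 h2 ↦ ?_⟩
    -- Start on the locus `y' = 0` and flow away for the time `b`, which makes `b` the value of
    -- `y'`. Retracting by `θ` undoes this by the group law, so the restriction to `S` is `f`.
    · let F := flow D' hD' (f.comp π) (b ⟨⟩) (hb ⟨⟩)
      have hF : F y' = b ⟨⟩ := by
        refine (hflow _ _ _).trans ?_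
        change f (π y') + _ = _
        rw [hπy, map_zero, zero_add]
      refine ⟨F, fun c ↦ ?_, fun _ ↦ hF⟩
      have h1 : F.comp σ = f := by
        refine continuousAlgHom_ext_completion fun b' ↦ ?_
        obtain ⟨b', rfl⟩ := Ideal.Quotient.mk_surjective b'
        have h2 : F.comp θ = f.comp π := by
          refine (comp_flow D' hD' F _ _ _).trans ?_
          have h3 : F (-y') = -b ⟨⟩ := by rw [map_neg, hF]
          simp only [h3]
          refine (flow_flow D' hD' (f.comp π) _ _ _ _).trans ?_
          simp only [neg_add_cancel]
          exact flow_zero D' hD' _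
        rw [← hσπ] at h2
        have h4 := congr($h2 (completionOf I k b'))
        change F (σ (π _)) = f (π _) at h4
        rw [hπ] at h4
        exact h4
      exact congr($h1 c)
    -- Conversely, every map is recovered from its retraction to `y' = 0` by flowing for the time `F
    -- y'`, because flowing `θ` for the time `y'` gives the identity.
    · have key (F : AdicCompletion I O →A[k] P) : F = flow D' hD' ((F.comp σ).comp π) (F y')
          (by rw [aug_apply, hy']) := by
        have h1 : (F.comp σ).comp π = F.comp θ := by rw [← hσπ]; rfl
        simp only [h1]
        rw [← comp_flow D' hD' F θ y' hy']
        have h2 : flow D' hD' θ y' hy' = ContinuousAlgHom.id k _ := by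
          refine (flow_flow D' hD' _ _ _ _ _).trans ?_
          simp only [add_neg_cancel]
          exact flow_zero D' hD' _
        rw [h2]
        rfl
      have hFG : F.comp σ = G.comp σ := by
        ext c
        exact h1 c
      rw [key F, key G]
      simp only [hFG, h2 ⟨⟩]
  exact ⟨S, inferInstance, inferInstance, inferInstance,
    FormalPointAlgebra.isAdmissibleRing k, hfree.nonempty_equiv hfree⟩

end SmoothFactor

end

end ArcSpaces

namespace ArcSpaces

noncomputable section

open scoped PowerSeries.WithPiTopology Topology

/-! ### Tangent vectors from square-zero elements and from one-parameter deformations -/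

section TangentOfPowerSeries

variable (k : Type*) [Field k]

namespace SqZeroAlg

variable {k}

/-- The homomorphism `a + b ε ↦ a + b τ` for an element `τ` of square zero. -/
def eval {P : Type*} [CommRing P] [Algebra k P] [TopologicalSpace P] (τ : P) (hτ : τ * τ = 0) :
    SqZeroAlg k k →A[k] P where
  toFun x := algebraMap k P (fst k k x) + algebraMap k P (snd x) * τ
  map_one' := by simp
  map_mul' x y := by
    simp only [map_mul, snd_mul, smul_eq_mul, map_add]
    linear_combination -(algebraMap k P (snd x) * algebraMap k P (snd y)) * hτ
  map_zero' := by simp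
  map_add' x y := by simp; ring
  commutes' c := by simp
  cont := continuous_of_discreteTopology

lemma eval_apply {P : Type*} [CommRing P] [Algebra k P] [TopologicalSpace P] (τ : P)
    (hτ : τ * τ = 0) (x : SqZeroAlg k k) :
    eval τ hτ x = algebraMap k P (fst k k x) + algebraMap k P (snd x) * τ := rfl

variable {V W : Type*} [AddCommGroup V] [Module k V] [Module kᵐᵒᵖ V] [IsCentralScalar k V]
  [AddCommGroup W] [Module k W] [Module kᵐᵒᵖ W] [IsCentralScalar k W]

/-- Functoriality of `k ⊕ V` in `V`. -/
def map (l : V →ₗ[k] W) : SqZeroAlg k V →A[k] SqZeroAlg k W :=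
  have : IsTopologicalRing (SqZeroAlg k V) := {}
  continuousAlgHomOfDiscrete (ofDerivation (fst k V) (l ∘ₗ snd) fun a b ↦ by simp [snd_mul])
    (isOpen_discrete _)

end SqZeroAlg

variable (A : Type*) [CommRing A] [Algebra k A] [TopologicalSpace A] [FormalPointAlgebra k A]

/-- The homomorphism `f₀ + f₁ t + ⋯ ↦ f₀(0) + f₁(0) ε`. -/
def psTangent : PowerSeries A →A[k] SqZeroAlg k k :=
  psEval (augSqZero k A k) (SqZeroAlg.mk 0 1) (by simp)

lemma psTangent_apply (f : PowerSeries A) : psTangent k A f =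
    SqZeroAlg.mk (aug k A (PowerSeries.constantCoeff f)) (aug k A (PowerSeries.coeff 1 f)) := by
  have hn : RingHom.ker (aug k (SqZeroAlg k k)) ^ 2 ≤ ⊥ := by
    rw [pow_two, Ideal.mul_le]
    intro x hx y hy
    rw [RingHom.mem_ker, SqZeroAlg.aug_eq] at hx hy
    rw [Ideal.mem_bot]
    ext <;> simp [SqZeroAlg.snd_mul, hx, hy]
  have h := psEval_sub_sum_mem (augSqZero k A k) (SqZeroAlg.mk 0 1) (by simp) hn f
  rw [Ideal.mem_bot, sub_eq_zero] at h
  refine h.trans ?_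
  rw [Finset.sum_range_succ, Finset.sum_range_one]
  ext <;> simp [SqZeroAlg.snd_mul]

@[simp] lemma fst_psTangent (f : PowerSeries A) :
    SqZeroAlg.fst k k (psTangent k A f) = aug k A (PowerSeries.constantCoeff f) := by
  rw [psTangent_apply, SqZeroAlg.fst_mk]

@[simp] lemma snd_psTangent (f : PowerSeries A) :
    SqZeroAlg.snd (psTangent k A f) = aug k A (PowerSeries.coeff 1 f) := by
  rw [psTangent_apply, SqZeroAlg.snd_mk]

end TangentOfPowerSeries

/-! ### Deformations of the section of constant arcs, and statement 2 -/

section NoSmoothFactor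

variable {k : Type u} [Field k] {O : Type u} [CommRing O] [Algebra k O] {I : Ideal O}
  {Q : Type u} [CommRing Q] [Algebra k Q] [TopologicalSpace Q] [FormalPointAlgebra k Q]

/-- If `A` has no smooth factor, a deformation of the section of constant arcs moves the base
point only to higher order. -/
theorem aug_coeff_one_eq_zero [CharZero k] (χ : O →ₐ[k] k) (hI : I = RingHom.ker χ)
    [FormalPointAlgebra k (AdicCompletion I O)] (hA : ¬ HasSmoothFactor k (AdicCompletion I O))
    {u : AdicCompletion I O →A[k] PowerSeries Q} (hu : IsUniversalArc u)
    (s : Q →A[k] AdicCompletion I O)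
    (hs : ∀ a n, s (PowerSeries.coeff n (u a)) = if n = 0 then a else 0)
    (h : Q →A[k] PowerSeries (AdicCompletion I O))
    (h0 : ∀ q, PowerSeries.constantCoeff (h q) = s q) (q : Q) :
    aug k _ (PowerSeries.coeff 1 (h q)) = 0 := by
  -- For fixed `n`, the first-order part of `h` on the `n`-th universal coefficient is a derivation
  -- of the base ring, so it cannot take a value outside the maximal ideal.
  have hD (n : ℕ) (a : AdicCompletion I O) :
      aug k _ (PowerSeries.coeff 1 (h (PowerSeries.coeff n (u a)))) = 0 := by
    let l : AdicCompletion I O →ₗ[k] AdicCompletion I O :=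
      { toFun := fun a ↦ PowerSeries.coeff 1 (h (PowerSeries.coeff n (u a)))
        map_add' := fun a b ↦ by simp
        map_smul' := fun c a ↦ by
          have h1 {P : Type u} [CommRing P] [Algebra k P] (n : ℕ) (f : PowerSeries P) :
              PowerSeries.coeff n (c • f) = c • PowerSeries.coeff n f := by
            rw [Algebra.smul_def, PowerSeries.algebraMap_apply, PowerSeries.coeff_C_mul,
              Algebra.smul_def]
          rw [map_smul u, h1, map_smul h, h1]
          rfl }
    let D : Derivation k (AdicCompletion I O) (AdicCompletion I O) := Derivation.mk' l fun a b ↦ by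
      change PowerSeries.coeff 1 (h (PowerSeries.coeff n (u (a * b)))) =
        a * PowerSeries.coeff 1 (h (PowerSeries.coeff n (u b))) +
        b * PowerSeries.coeff 1 (h (PowerSeries.coeff n (u a)))
      have h1 (x y : PowerSeries (AdicCompletion I O)) : PowerSeries.coeff 1 (x * y) =
          PowerSeries.constantCoeff x * PowerSeries.coeff 1 y +
          PowerSeries.constantCoeff y * PowerSeries.coeff 1 x := by
        rw [PowerSeries.coeff_mul, Finset.Nat.antidiagonal_succ]
        simp [mul_comm]
      rw [map_mul u, PowerSeries.coeff_mul, map_sum h, map_sum]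
      -- At `ε = 0` the coefficients of positive index vanish, so in the convolution only the pairs
      -- `(0, n)` and `(n, 0)` survive and give the two Leibniz terms.
      simp only [map_mul, h1, h0, hs, Finset.sum_add_distrib, ite_mul, zero_mul]
      congr 1
      · rw [Finset.sum_eq_single (0, n)]
        · simp
        · rintro ⟨i, j⟩ hij hne
          rw [Finset.HasAntidiagonal.mem_antidiagonal] at hij
          refine if_neg fun h ↦ hne ?_
          simp_all
        · simp
      · rw [Finset.sum_eq_single (n, 0)]
        · simp
        · rintro ⟨i, j⟩ hij hne
          rw [Finset.HasAntidiagonal.mem_antidiagonal] at hij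
          refine if_neg fun h ↦ hne ?_
          simp_all
        · simp
    by_contra hne
    refine hA (hasSmoothFactor_of_derivation χ hI D ?_ a hne)
    exact (PowerSeries.WithPiTopology.continuous_coeff _ 1).comp
      (h.cont.comp ((PowerSeries.WithPiTopology.continuous_coeff _ n).comp u.cont))
  -- A tangent vector of `Q` is determined by its values on the coefficients of the universal arc,
  -- and there it has just been shown to be zero.
  have key : (psTangent k _).comp h = augSqZero k Q k := by
    refine hu.hom_ext _ _ _ fun a n ↦ ?_
    ext
    · rw [ContinuousAlgHom.comp_apply, fst_psTangent, fst_augSqZero, h0, aug_apply]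
    · rw [ContinuousAlgHom.comp_apply, snd_psTangent, snd_augSqZero, hD]
  have := congr(SqZeroAlg.snd ($key q))
  rwa [ContinuousAlgHom.comp_apply, snd_psTangent, snd_augSqZero] at this

/-- The section given by constant arcs. -/
lemma IsUniversalArc.exists_section {A : Type u} [CommRing A] [Algebra k A] [TopologicalSpace A]
    [FormalPointAlgebra k A] {u : A →A[k] PowerSeries Q} (hu : IsUniversalArc u)
    (hc : ∀ a n, aug k Q (PowerSeries.coeff n (u a)) = if n = 0 then aug k A a else 0) :
    ∃ s : Q →A[k] A, ∀ a n, s (PowerSeries.coeff n (u a)) = if n = 0 then a else 0 := by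
  obtain ⟨s, hs⟩ := hu.exists_lift A (psC k A) fun a n ↦ by
    rw [hc, psC_apply, PowerSeries.coeff_C]
    split_ifs <;> simp
  refine ⟨s, fun a n ↦ ?_⟩
  rw [hs, psC_apply, PowerSeries.coeff_C]

/-- Translating a free variable of `Q` by `ε` deforms the section of constant arcs, with first-order
coefficient `1` on that variable. This contradicts `aug_coeff_one_eq_zero`. -/
theorem not_hasSmoothFactor_of_isUniversalArc [CharZero k] (χ : O →ₐ[k] k) (hI : I = RingHom.ker χ)
    [FormalPointAlgebra k (AdicCompletion I O)] (hA : ¬ HasSmoothFactor k (AdicCompletion I O))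
    {u : AdicCompletion I O →A[k] PowerSeries Q} (hu : IsUniversalArc u)
    (hc : ∀ a n, aug k Q (PowerSeries.coeff n (u a)) = if n = 0 then aug k _ a else 0) :
    ¬ HasSmoothFactor k Q := by
  rintro ⟨S, _, _, _, hS, ⟨e⟩⟩
  have := hS.isTopologicalRing
  have hfree := isFreeExtension_of_equiv.{u, 0, u} e
  set a := (e.trans (ctensorEquiv k S _)).symm.toContinuousAlgHom.comp
      (tensorInl k S (PowerSeriesRing k PUnit.{1}))
  set z := fun i : PUnit.{1} ↦ (e.trans (ctensorEquiv k S _)).symm (ctensorInr k S _ (zvar k i))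
  obtain ⟨s, hs⟩ := hu.exists_section hc
  obtain ⟨h, h1, h2⟩ := hfree.exists_hom (PowerSeries (AdicCompletion I O))
    ((psC k _).comp (s.comp a)) (fun i ↦ PowerSeries.C (s (z i)) + PowerSeries.X) fun i ↦ by
    simp only [aug_powerSeries, map_add, PowerSeries.constantCoeff_C,
      PowerSeries.constantCoeff_X, aug_apply, hfree.aug_eq_zero, map_zero, add_zero]
  have h0 : (psConst k _).comp h = s := by
    refine hfree.hom_ext _ _ _ (fun c ↦ ?_) fun i ↦ ?_
    · rw [ContinuousAlgHom.comp_apply, h1]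
      simp
    · rw [ContinuousAlgHom.comp_apply, h2]
      simp
  have := aug_coeff_one_eq_zero χ hI hA hu s hs h (fun q ↦ congr($h0 q)) (z ⟨⟩)
  rw [h2] at this
  simp at this

end NoSmoothFactor

/-! ### A finite formal model forces a trivial tangent space -/

section NoFiniteModel

lemma exists_linearMap_ne_zero {k : Type*} [Field k] {r : ℕ} (x : Fin r → Fin (r + 1) → k) :
    ∃ l : (Fin (r + 1) → k) →ₗ[k] k, l ≠ 0 ∧ ∀ i, l (x i) = 0 := by
  have h : Submodule.span k (Set.range x) < ⊤ := by
    refine lt_top_iff_ne_top.2 fun h ↦ ?_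
    have h1 := finrank_range_le_card (R := k) x
    rw [Set.finrank, h, finrank_top] at h1
    simp at h1
  obtain ⟨l, hl, hle⟩ := Submodule.exists_le_ker_of_lt_top _ h
  exact ⟨l, hl, fun i ↦ hle (Submodule.subset_span ⟨i, rfl⟩)⟩

variable {k : Type u} [Field k] [CharZero k] {O : Type u} [CommRing O] [Algebra k O] {I : Ideal O}
  {Q : Type u} [CommRing Q] [Algebra k Q] [TopologicalSpace Q] [FormalPointAlgebra k Q]
  {R : Type u} [CommRing R] [Algebra k R] [TopologicalSpace R] [FormalPointAlgebra k R]
  {C : Type u} [CommRing C] [Algebra k C] [TopologicalSpace C] [FormalPointAlgebra k C]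

/-- If `R` is a free extension of `Q` and of a topologically finitely generated algebra `C`, where
`Q` represents the deformations of a constant arc on `Spf A` without smooth factor, then the
tangent space of `A` is trivial. -/
theorem snd_eq_zero_of_isFreeExtension (χ : O →ₐ[k] k) (hI : I = RingHom.ker χ)
    [FormalPointAlgebra k (AdicCompletion I O)] (hA : ¬ HasSmoothFactor k (AdicCompletion I O))
    {u : AdicCompletion I O →A[k] PowerSeries Q} (hu : IsUniversalArc u)
    (hc : ∀ a n, aug k Q (PowerSeries.coeff n (u a)) = if n = 0 then aug k _ a else 0)
    {J L : Type u} {b : Q →A[k] R} {w : J → R} (hb : IsFreeExtension.{u, u, u} b w)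
    {a : C →A[k] R} {z : L → R} (ha : IsFreeExtension.{u, u, u} a z) {r : ℕ} (c : Fin r → C)
    (hgen : ∀ F G : C →A[k] SqZeroAlg k k, (∀ i, F (c i) = G (c i)) → F = G)
    (v : AdicCompletion I O →A[k] SqZeroAlg k k) (x : AdicCompletion I O) :
    SqZeroAlg.snd (v x) = 0 := by
  by_contra hx
  obtain ⟨s, hs⟩ := hu.exists_section hc
  let V := Fin (r + 1) → k
  -- The series `e₀ + e₁ t + ⋯ + eᵣ tʳ` with the basis vectors of `V` as coefficients. It has square
  -- zero, so substituting it for `ε` in the tangent vector `v` deforms the constant arc in `r + 1`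
  -- independent ways.
  let τ : PowerSeries (SqZeroAlg k V) := PowerSeries.mk fun n ↦
    if h : n < r + 1 then SqZeroAlg.mk 0 (Pi.single ⟨n, h⟩ 1) else 0
  have hτ0 (n : ℕ) : SqZeroAlg.fst k V (PowerSeries.coeff n τ) = 0 := by
    rw [PowerSeries.coeff_mk]
    split_ifs <;> simp
  have hτ : τ * τ = 0 := by
    refine PowerSeries.ext fun n ↦ ?_
    rw [PowerSeries.coeff_mul, map_zero]
    refine Finset.sum_eq_zero fun i _ ↦ ?_
    ext <;> simp [SqZeroAlg.snd_mul, hτ0]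
  have hω (y : AdicCompletion I O) (n : ℕ) : PowerSeries.coeff n (SqZeroAlg.eval τ hτ (v y)) =
      algebraMap k _ (if n = 0 then aug k _ y else 0) +
        algebraMap k _ (SqZeroAlg.snd (v y)) * PowerSeries.coeff n τ := by
    have h1 : SqZeroAlg.fst k k (v y) = aug k _ y := by rw [← SqZeroAlg.aug_eq, aug_apply]
    rw [SqZeroAlg.eval_apply, map_add, PowerSeries.algebraMap_apply, PowerSeries.algebraMap_apply,
      PowerSeries.coeff_C, PowerSeries.coeff_C_mul, h1]
    split_ifs <;> simp
  obtain ⟨G, hG⟩ := hu.exists_lift (SqZeroAlg k V) ((SqZeroAlg.eval τ hτ).comp v) fun y n ↦ by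
    rw [hc, ContinuousAlgHom.comp_apply, hω]
    simp [hτ0]
  obtain ⟨G', hG', -⟩ := hb.exists_hom _ G (fun _ ↦ 0) fun _ ↦ map_zero _
  -- There is one more dimension than there are generators of `C`, so some nonzero projection of `V`
  -- to a line makes the tangent vector trivial on `C`.
  obtain ⟨l, hl, hl0⟩ := exists_linearMap_ne_zero fun i ↦ SqZeroAlg.snd (G' (a (c i)))
  let g : R →A[k] SqZeroAlg k k := (SqZeroAlg.map l).comp G'
  have hga : g.comp a = augSqZero k C k := by
    refine hgen _ _ fun i ↦ ?_
    ext
    · rw [← SqZeroAlg.aug_eq, aug_apply, aug_apply]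
    · exact hl0 i
  -- A tangent vector that is zero along `C` is a combination of the coordinate directions `z_i`.
  -- Translation by `ε` times its values integrates it to a deformation of the identity of `R`.
  obtain ⟨h, h1, h2⟩ := ha.exists_hom (PowerSeries R) ((psC k R).comp a) (fun i ↦
    PowerSeries.C (z i) + PowerSeries.C (algebraMap k R (SqZeroAlg.snd (g (z i)))) *
      PowerSeries.X) fun i ↦ by simp [ha.aug_eq_zero]
  have hh0 : (psConst k R).comp h = ContinuousAlgHom.id k R := by
    refine ha.hom_ext _ _ _ (fun c ↦ ?_) fun i ↦ ?_
    · rw [ContinuousAlgHom.comp_apply, h1]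
      simp
    · rw [ContinuousAlgHom.comp_apply, h2]
      simp
  have hhg : (psTangent k R).comp h = g := by
    refine ha.hom_ext _ _ _ (fun c ↦ ?_) fun i ↦ ?_
    · rw [ContinuousAlgHom.comp_apply, h1, ← ContinuousAlgHom.comp_apply g a, hga]
      ext <;> simp
    · rw [ContinuousAlgHom.comp_apply, h2]
      ext
      · rw [← SqZeroAlg.aug_eq, aug_apply, aug_apply, aug_powerSeries]
        simp
      · simp [snd_psTangent, -map_add, map_add (PowerSeries.coeff 1), PowerSeries.coeff_C]
  -- The retraction with `w = 0`. Conjugating `h` by `b` and `s ∘ ρ` yields a deformation of `s` to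
  -- which `aug_coeff_one_eq_zero` applies.
  obtain ⟨ρ, hρ, -⟩ := hb.exists_hom Q (ContinuousAlgHom.id k Q) (fun _ ↦ 0) fun _ ↦ map_zero _
  have key (q : Q) : l (SqZeroAlg.snd (G q)) = 0 := by
    have h3 := aug_coeff_one_eq_zero χ hI hA hu s hs ((psMap (s.comp ρ)).comp (h.comp b))
      (fun q ↦ by
        rw [ContinuousAlgHom.comp_apply, constantCoeff_psMap, ContinuousAlgHom.comp_apply]
        have h4 := congr($hh0 (b q))
        change PowerSeries.constantCoeff (h (b q)) = b q at h4
        rw [ContinuousAlgHom.comp_apply, h4, hρ]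
        rfl) q
    rw [ContinuousAlgHom.comp_apply, coeff_psMap, aug_apply, ← snd_psTangent] at h3
    have h5 := congr(SqZeroAlg.snd ($hhg (b q)))
    refine Eq.trans ?_ (h5.symm.trans h3)
    change _ = l (SqZeroAlg.snd (G' (b q)))
    rw [hG']
  refine hl (LinearMap.pi_ext' fun n ↦ LinearMap.ext_ring ?_)
  -- On this element `G` has second component `snd (v x)` times the `n`-th basis vector, so `l`
  -- vanishes on every basis vector.
  have h6 := key (PowerSeries.coeff n (u x))
  rw [hG, ContinuousAlgHom.comp_apply, hω, PowerSeries.coeff_mk, dif_pos n.2] at h6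
  simpa [SqZeroAlg.snd_mul, hx, V] using h6

end NoFiniteModel

end

end ArcSpaces

namespace ArcSpaces

noncomputable section

open scoped PowerSeries.WithPiTopology Topology

/-! ### Completions by universal property, and the universal arc from the Hasse--Schmidt algebra -/

section FormalCompletion

variable {k : Type u} [Field k] {B Q : Type u} [CommRing B] [CommRing Q] [Algebra k Q]
  [TopologicalSpace Q] [FormalPointAlgebra k Q]

/-- `Q` is the completion of the `k`-algebra `s : k → B` at a `k`-valued point, expressed by its
universal property. -/
structure IsFormalCompletion (s : k →+* B) (ι : B →+* Q) : Prop where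
  map_algebraMap : ∀ c, ι (s c) = algebraMap k Q c
  exists_lift : ∀ (P : Type u) [CommRing P] [Algebra k P] [TopologicalSpace P]
    [FormalPointAlgebra k P] (f : B →+* P), (∀ c, f (s c) = algebraMap k P c) →
      (∀ b, aug k P (f b) = aug k Q (ι b)) → ∃ F : Q →A[k] P, ∀ b, F (ι b) = f b
  hom_ext : ∀ (P : Type u) [CommRing P] [Algebra k P] [TopologicalSpace P]
    [FormalPointAlgebra k P] (F G : Q →A[k] P), (∀ b, F (ι b) = G (ι b)) → F = G

/-- The two deformations may live over different bases. Their reductions are compared in `(k ⊕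
k)[[t]]`, where uniqueness for the completion reduces the claim to `B`. -/
lemma IsFormalCompletion.aug_coeff_eq {s : k →+* B} {ι : B →+* Q} (h : IsFormalCompletion s ι)
    {R R' : Type u} [CommRing R] [Algebra k R] [TopologicalSpace R] [FormalPointAlgebra k R]
    [CommRing R'] [Algebra k R'] [TopologicalSpace R'] [FormalPointAlgebra k R']
    (F : Q →A[k] PowerSeries R) (G : Q →A[k] PowerSeries R')
    (hFG : ∀ b n, aug k R (PowerSeries.coeff n (F (ι b))) = aug k R' (PowerSeries.coeff n (G (ι b))))
    (c : Q) (n : ℕ) :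
    aug k R (PowerSeries.coeff n (F c)) = aug k R' (PowerSeries.coeff n (G c)) := by
  have : (psMap (augSqZero k R k)).comp F = (psMap (augSqZero k R' k)).comp G := by
    refine h.hom_ext _ _ _ fun b ↦ PowerSeries.ext fun n ↦ ?_
    ext
    · simp only [ContinuousAlgHom.comp_apply, coeff_psMap, fst_augSqZero, hFG]
    · simp only [ContinuousAlgHom.comp_apply, coeff_psMap, snd_augSqZero]
  simpa only [ContinuousAlgHom.comp_apply, coeff_psMap, fst_augSqZero] using
    congr(SqZeroAlg.fst k k (PowerSeries.coeff n ($this c)))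

/-- The universal arc of a formal neighbourhood, constructed from the completion of the
Hasse--Schmidt algebra. -/
theorem IsFormalCompletion.exists_isUniversalArc {s : k →+* B} {ι : B →+* Q}
    (h : IsFormalCompletion s ι) {Q' : Type u} [CommRing Q'] [Algebra k Q'] [TopologicalSpace Q']
    [FormalPointAlgebra k Q'] {ι' : HasseSchmidt s →+* Q'}
    (h' : IsFormalCompletion ((HasseSchmidt.ofBase s).comp s) ι')
    (h0 : ∀ b, aug k Q' (ι' (HasseSchmidt.d s 0 b)) = aug k Q (ι b)) :
    ∃ u : Q →A[k] PowerSeries Q',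
      (∀ b n, PowerSeries.coeff n (u (ι b)) = ι' (HasseSchmidt.d s n b)) ∧ IsUniversalArc u := by
  obtain ⟨u, hu⟩ := h.exists_lift (PowerSeries Q')
    ((PowerSeries.map ι').comp (HasseSchmidt.univArc s)) (fun c ↦ by
      refine PowerSeries.ext fun n ↦ ?_
      rw [RingHom.comp_apply, PowerSeries.coeff_map, HasseSchmidt.coeff_univArc,
        PowerSeries.algebraMap_apply, PowerSeries.coeff_C]
      cases n with
      | zero =>
        rw [if_pos rfl, ← HasseSchmidt.ofBase_apply]
        exact h'.map_algebraMap c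
      | succ n => rw [HasseSchmidt.d_succ_const, map_zero, if_neg n.succ_ne_zero]) fun b ↦ by
      rw [aug_powerSeries, ← PowerSeries.coeff_zero_eq_constantCoeff_apply, RingHom.comp_apply,
        PowerSeries.coeff_map, HasseSchmidt.coeff_univArc, h0]
  have hu' (b : B) (n : ℕ) : PowerSeries.coeff n (u (ι b)) = ι' (HasseSchmidt.d s n b) := by
    rw [hu, RingHom.comp_apply, PowerSeries.coeff_map, HasseSchmidt.coeff_univArc]
  refine ⟨u, hu', fun P _ _ _ _ F hF ↦ ?_, fun P _ _ _ _ g g' hg ↦ ?_⟩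
  · have hs (c : k) : F (ι (s c)) = PowerSeries.C (algebraMap k P c) := by
      rw [h.map_algebraMap, AlgHomClass.commutes F]
      exact PowerSeries.algebraMap_apply ..
    -- An arc over `P` restricted to `B` is a homomorphism out of the Hasse--Schmidt algebra; it
    -- reduces to the given point, so it extends to the completion.
    let f : HasseSchmidt s →+* P := HasseSchmidt.lift ((F : Q →+* PowerSeries P).comp ι)
      fun n c ↦ by
        change PowerSeries.coeff (n + 1) (F (ι (s c))) = 0
        rw [hs, PowerSeries.coeff_C, if_neg n.succ_ne_zero]
    have hf (n : ℕ) (b : B) : f (HasseSchmidt.d s n b) = PowerSeries.coeff n (F (ι b)) :=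
      HasseSchmidt.lift_d ..
    obtain ⟨g, hg⟩ := h'.exists_lift P f (fun c ↦ by
      rw [RingHom.comp_apply, HasseSchmidt.ofBase_apply, hf, hs, PowerSeries.coeff_C,
        if_pos rfl]) fun b ↦ by
      have : ((aug k P : P →+* k).comp f) = (aug k Q' : Q' →+* k).comp ι' := by
        refine HasseSchmidt.ringHom_ext fun n b ↦ ?_
        change aug k P (f _) = aug k Q' (ι' _)
        rw [hf, hF, hu']
      exact congr($this b)
    have hgu : (psMap g).comp u = F := by
      refine h.hom_ext _ _ _ fun b ↦ PowerSeries.ext fun n ↦ ?_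
      rw [ContinuousAlgHom.comp_apply, coeff_psMap, hu', hg, hf]
    refine ⟨g, fun c n ↦ ?_⟩
    rw [← hgu, ContinuousAlgHom.comp_apply, coeff_psMap]
  · refine h'.hom_ext _ _ _ fun b ↦ ?_
    have : ((g : Q' →+* P).comp ι') = (g' : Q' →+* P).comp ι' := by
      refine HasseSchmidt.ringHom_ext fun n b ↦ ?_
      change g (ι' _) = g' (ι' _)
      rw [← hu', hg]
    exact congr($this b)

/-- Both maps extend the same map on `O`, so `c` is replaced by an approximation in `O`. The ideal
`𝔟` is chosen such that neither side changes in degree `n`: on the left by continuity of `v`, on the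
right because elements vanishing in `O / I ^ (n + 1)` go to multiples of `X ^ (n + 1)`. -/
lemma aug_coeff_eq_coeff_completionLift {O : Type u} [CommRing O] [Algebra k O] {I : Ideal O}
    [FormalPointAlgebra k (AdicCompletion I O)] (f : O →+* PowerSeries k)
    (hf : I ≤ (Ideal.span {PowerSeries.X}).comap f) (v : AdicCompletion I O →A[k] PowerSeries Q)
    (h : ∀ o n, aug k Q (PowerSeries.coeff n (v (algebraMap O _ o))) = PowerSeries.coeff n (f o))
    (c : AdicCompletion I O) (n : ℕ) : aug k Q (PowerSeries.coeff n (v c)) =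
      PowerSeries.coeff n (completionLift I (Ideal.span {PowerSeries.X}) f hf c) := by
  let 𝔟 : Ideal (AdicCompletion I O) :=
    (coeffIdeal (RingHom.ker (aug k Q)) (n + 1)).comap (v : _ →+* PowerSeries Q) ⊓
      RingHom.ker (AdicCompletion.evalₐ I (n + 1))
  have h𝔟 : IsOpen (𝔟 : Set (AdicCompletion I O)) :=
    ((isOpen_coeffIdeal (isOpen_ker_aug k Q) (n + 1)).preimage v.cont).inter
      (isOpen_ker_evalₐ ..)
  obtain ⟨o, ho1, ho2⟩ := exists_sub_mem_adicCompletion I c 𝔟 h𝔟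
  have h1 : aug k Q (PowerSeries.coeff n (v (c - algebraMap O _ o))) = 0 := ho1 n n.lt_succ_self
  have h2 : completionLift I (Ideal.span {PowerSeries.X}) f hf (c - algebraMap O _ o) ∈
      Ideal.span {(PowerSeries.X : PowerSeries k)} ^ (n + 1) := by
    rw [← Ideal.Quotient.eq_zero_iff_mem]
    refine (IsAdicComplete.mk_liftRingHom _ _ (factorPow_comp_completionLiftAux I _ f hf)
      (n + 1) _).trans ?_
    refine Eq.trans (b := Ideal.quotientMap _ f ((Ideal.pow_right_mono hf _).trans
      (Ideal.le_comap_pow f _)) (AdicCompletion.evalₐ I (n + 1) _)) rfl ?_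
    exact (congrArg _ ho2).trans (map_zero _)
  rw [Ideal.span_singleton_pow, Ideal.mem_span_singleton, PowerSeries.X_pow_dvd_iff] at h2
  have h3 := h2 n n.lt_succ_self
  rw [map_sub, map_sub, completionLift_of, sub_eq_zero] at h3
  rw [map_sub, map_sub, map_sub, h, sub_eq_zero] at h1
  rw [h1, h3]

end FormalCompletion

end

end ArcSpaces

namespace ArcSpaces

noncomputable section

open scoped PowerSeries.WithPiTopology Topology

/-! ### Local rings at rational points, and completions computed on affine charts -/

section LocalRing

variable {k : Type u} [Field k] {Z : Scheme.{u}} (r : Z ⟶ Spec (.of k)) (z : Spec (.of k) ⟶ Z)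

/-- The canonical morphism from the spectrum of the local ring. -/
def fromLocal : Spec (.of (LocalRingAt r z)) ⟶ Z := Z.fromSpecStalk (pt z)

instance : Mono (fromLocal r z) := inferInstanceAs (Mono (Z.fromSpecStalk (pt z)))

lemma structure_eq : r = Z.toSpecΓ ≫ Spec.map ((Scheme.ΓSpecIso (.of k)).inv ≫ r.appTop) := by
  rw [Spec.map_comp, ← Scheme.toSpecΓ_naturality_assoc, toSpecΓ_SpecMap_ΓSpecIso_inv,
    Category.comp_id]

lemma fromLocal_comp : fromLocal r z ≫ r =
    Spec.map (CommRingCat.ofHom (algebraMap k (LocalRingAt r z))) := by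
  have h : CommRingCat.ofHom (algebraMap k (LocalRingAt r z)) =
      ((Scheme.ΓSpecIso (.of k)).inv ≫ r.appTop) ≫
        Z.presheaf.germ ⊤ (pt z) (TopologicalSpace.Opens.mem_top _) := by
    refine CommRingCat.hom_ext (RingHom.ext fun c ↦ ?_)
    change Z.presheaf.germ ⊤ (pt z) _ (Z.presheaf.map (𝟙 _) _) = _
    rw [Z.presheaf.map_id]
    rfl
  refine (congrArg (fromLocal r z ≫ ·) (structure_eq r)).trans ?_
  refine (Category.assoc _ _ _).symm.trans ?_
  refine (congrArg (· ≫ _) (Scheme.fromSpecStalk_toSpecΓ Z (pt z))).trans ?_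
  exact (Spec.map_comp _ _).symm.trans (congrArg Spec.map h.symm)

lemma fromSpec_comp (U : Z.AffineZariskiSite) : U.2.fromSpec ≫ r =
    Spec.map (CommRingCat.ofHom (sectionsHom r U.toOpens)) := by
  conv_lhs => rw [structure_eq r]
  rw [← Category.assoc, U.2.fromSpec_toSpecΓ, ← Spec.map_comp]
  rfl

variable {r z}

lemma localHom_ext {R : Type u} [CommRing R] {f g : LocalRingAt r z →+* R}
    (h : Spec.map (CommRingCat.ofHom f) ≫ fromLocal r z =
      Spec.map (CommRingCat.ofHom g) ≫ fromLocal r z) : f = g :=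
  congrArg CommRingCat.Hom.hom (Spec.map_injective ((cancel_mono _).1 h))

lemma exists_localHom {R : Type u} [CommRing R] [IsLocalRing R] (a : Spec (.of R) ⟶ Z)
    (h : a (closedPoint R) = pt z) : ∃ f : LocalRingAt r z →+* R,
      Spec.map (CommRingCat.ofHom f) ≫ fromLocal r z = a ∧ IsLocalHom f := by
  have : IsIso (Z.presheaf.stalkSpecializes (specializes_of_eq h)) :=
    inferInstanceAs (IsIso (Z.presheaf.stalkCongr (.of_eq h.symm)).hom)
  refine ⟨(Z.presheaf.stalkSpecializes (specializes_of_eq h) ≫ Scheme.stalkClosedPointTo a).hom,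
    ?_, CommRingCat.isLocalHom_comp (Z.presheaf.stalkSpecializes (specializes_of_eq h))
      (Scheme.stalkClosedPointTo a)⟩
  refine Eq.trans ?_ (Scheme.Spec_stalkClosedPointTo_fromSpecStalk a)
  rw [← Scheme.SpecMap_stalkSpecializes_fromSpecStalk (specializes_of_eq h), ← Category.assoc,
    ← Spec.map_comp]
  rfl

lemma spec_arcStalkHom (a : Spec (.of (PowerSeries k)) ⟶ Z)
    (h : a (closedPoint (PowerSeries k)) = pt z) :
    Spec.map (CommRingCat.ofHom (arcStalkHom r a z h)) ≫ fromLocal r z = a := by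
  refine Eq.trans ?_ (Scheme.Spec_stalkClosedPointTo_fromSpecStalk a)
  rw [← Scheme.SpecMap_stalkSpecializes_fromSpecStalk (specializes_of_eq h), ← Category.assoc,
    ← Spec.map_comp]
  rfl

lemma exists_residueHom (hz : z ≫ r = 𝟙 _) : ∃ χ : LocalRingAt r z →ₐ[k] k,
    maximalIdeal (LocalRingAt r z) = RingHom.ker χ ∧
      Spec.map (CommRingCat.ofHom (χ : LocalRingAt r z →+* k)) ≫ fromLocal r z = z := by
  obtain ⟨f, hf, hloc⟩ := exists_localHom (r := r) (z := z) z rfl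
  have h : f.comp (algebraMap k (LocalRingAt r z)) = RingHom.id k := by
    have h1 : Spec.map (CommRingCat.ofHom (f.comp (algebraMap k (LocalRingAt r z)))) = 𝟙 _ := by
      rw [CommRingCat.ofHom_comp, Spec.map_comp, ← fromLocal_comp, ← Category.assoc, hf, hz]
    rw [← Spec.map_id] at h1
    exact congrArg CommRingCat.Hom.hom (Spec.map_injective h1)
  refine ⟨{ f with commutes' := fun c ↦ congr($h c) }, ?_, hf⟩
  ext o
  rw [mem_maximalIdeal, mem_nonunits_iff, RingHom.mem_ker]
  refine (not_congr (isUnit_map_iff f o)).symm.trans ?_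
  rw [isUnit_iff_ne_zero, not_not]
  rfl

variable (r z) in
/-- Evaluation at a `k`-valued point. -/
def residueHom (hz : z ≫ r = 𝟙 _) : LocalRingAt r z →ₐ[k] k := (exists_residueHom hz).choose

lemma maximalIdeal_eq_ker (hz : z ≫ r = 𝟙 _) :
    maximalIdeal (LocalRingAt r z) = RingHom.ker (residueHom r z hz) :=
  (exists_residueHom hz).choose_spec.1

lemma spec_residueHom (hz : z ≫ r = 𝟙 _) :
    Spec.map (CommRingCat.ofHom (residueHom r z hz : LocalRingAt r z →+* k)) ≫ fromLocal r z = z :=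
  (exists_residueHom hz).choose_spec.2

lemma formalPointAlgebra_formalNbhd (hz : z ≫ r = 𝟙 _) :
    FormalPointAlgebra k (FormalNbhd r z) :=
  formalPointAlgebra_adicCompletion (residueHom r z hz) (maximalIdeal_eq_ker hz)

variable {B : Type u} [CommRing B] (j : Spec (.of B) ⟶ Z)

lemma exists_chartHom [IsOpenImmersion j] (hj : pt z ∈ Set.range j) : ∃ ρ : B →+* LocalRingAt r z,
    Spec.map (CommRingCat.ofHom ρ) ≫ j = fromLocal r z := by
  have h : Set.range (fromLocal r z) ⊆ Set.range j := by
    refine Scheme.range_fromSpecStalk.subset.trans fun y hy ↦ ?_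
    exact Specializes.mem_open hy j.opensRange.2 hj
  refine ⟨(Spec.preimage (IsOpenImmersion.lift j (fromLocal r z) h)).hom, ?_⟩
  rw [CommRingCat.ofHom_hom, Spec.map_preimage, IsOpenImmersion.lift_fac]

variable {j} {ρ : B →+* LocalRingAt r z}

lemma localHom_ext_chart (hρ : Spec.map (CommRingCat.ofHom ρ) ≫ j = fromLocal r z)
    {R : Type u} [CommRing R] {f g : LocalRingAt r z →+* R} (h : ∀ b, f (ρ b) = g (ρ b)) :
    f = g := by
  refine localHom_ext ?_
  rw [← hρ, ← Category.assoc, ← Category.assoc, ← Spec.map_comp, ← Spec.map_comp,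
    ← CommRingCat.ofHom_comp, ← CommRingCat.ofHom_comp]
  congr 3
  ext b
  exact h b

lemma eq_of_spec_comp [IsOpenImmersion j] (hρ : Spec.map (CommRingCat.ofHom ρ) ≫ j = fromLocal r z)
    {R : Type u} [CommRing R] {f : LocalRingAt r z →+* R} {g : B →+* R}
    (h : Spec.map (CommRingCat.ofHom f) ≫ fromLocal r z = Spec.map (CommRingCat.ofHom g) ≫ j)
    (b : B) : f (ρ b) = g b := by
  rw [← hρ, ← Category.assoc, cancel_mono, ← Spec.map_comp, ← CommRingCat.ofHom_comp] at h
  have := congrArg CommRingCat.Hom.hom (Spec.map_injective h)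
  exact congr($this b)

lemma residueHom_chart [IsOpenImmersion j] (hρ : Spec.map (CommRingCat.ofHom ρ) ≫ j = fromLocal r z)
    (hz : z ≫ r = 𝟙 _) {ζ : B →+* k} (hζ : Spec.map (CommRingCat.ofHom ζ) ≫ j = z) (b : B) :
    residueHom r z hz (ρ b) = ζ b :=
  eq_of_spec_comp hρ (f := (residueHom r z hz : LocalRingAt r z →+* k))
    ((spec_residueHom hz).trans hζ.symm) b

lemma aug_formalNbhd (hz : z ≫ r = 𝟙 _) [FormalPointAlgebra k (FormalNbhd r z)]
    (o : LocalRingAt r z) : aug k (FormalNbhd r z) (algebraMap _ _ o) = residueHom r z hz o :=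
  aug_completionOf _ (maximalIdeal_eq_ker hz) o

/-- A formal point algebra `P` is local, so a map `B → P` reducing to the point `z` gives a morphism
from `Spec P` with closed point over `z`. It factors through the local ring and then through its
completion. Thus completions can be tested on any affine chart. -/
theorem isFormalCompletion_formalNbhd [IsOpenImmersion j]
    (hρ : Spec.map (CommRingCat.ofHom ρ) ≫ j = fromLocal r z) (hz : z ≫ r = 𝟙 _)
    [FormalPointAlgebra k (FormalNbhd r z)] {s : k →+* B}
    (hs : j ≫ r = Spec.map (CommRingCat.ofHom s)) :
    IsFormalCompletion s ((algebraMap (LocalRingAt r z) (FormalNbhd r z)).comp ρ) := by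
  have hρs (c : k) : ρ (s c) = algebraMap k (LocalRingAt r z) c := by
    have h : Spec.map (CommRingCat.ofHom (ρ.comp s)) =
        Spec.map (CommRingCat.ofHom (algebraMap k (LocalRingAt r z))) := by
      rw [← fromLocal_comp, ← hρ, Category.assoc, hs, ← Spec.map_comp, CommRingCat.ofHom_comp]
    have := congrArg CommRingCat.Hom.hom (Spec.map_injective h)
    exact congr($this c)
  refine ⟨fun c ↦ ?_, fun P _ _ _ _ f hf hb ↦ ?_, fun P _ _ _ _ F G h ↦ ?_⟩
  · rw [RingHom.comp_apply, hρs]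
    rfl
  · have hloc : IsLocalHom (aug k P : P →+* k) :=
      ⟨fun p hp ↦ isUnit_of_aug_ne_zero hp.ne_zero⟩
    have : IsLocalRing P := (aug k P : P →+* k).domain_isLocalRing
    have hcl : (Spec.map (CommRingCat.ofHom f) ≫ j) (closedPoint P) = pt z := by
      have h1 : Spec.map (CommRingCat.ofHom (aug k P : P →+* k)) (closedPoint k) = closedPoint P :=
        IsLocalRing.comap_closedPoint (aug k P : P →+* k)
      have h2 : Spec.map (CommRingCat.ofHom ((aug k P : P →+* k).comp f)) ≫ j = z := by
        refine Eq.trans ?_ (spec_residueHom hz)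
        rw [← hρ, ← Category.assoc, ← Spec.map_comp, ← CommRingCat.ofHom_comp]
        congr 3
        ext b
        exact (hb b).trans (aug_formalNbhd hz (ρ b))
      rw [CommRingCat.ofHom_comp, Spec.map_comp, Category.assoc] at h2
      exact (congrArg _ h1.symm).trans congr($h2 (closedPoint k))
    obtain ⟨g, hg, -⟩ := exists_localHom (r := r) (z := z) _ hcl
    have hgρ := eq_of_spec_comp hρ hg
    have hgk (c : k) : g (algebraMap k _ c) = algebraMap k P c := by rw [← hρs, hgρ, hf]
    let g' : LocalRingAt r z →ₐ[k] P := { g with commutes' := hgk }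
    obtain ⟨F, hF⟩ := exists_continuousAlgHom_completion (residueHom r z hz)
      (maximalIdeal_eq_ker hz) g' fun o ↦ by
        have : (aug k P : P →+* k).comp g = (residueHom r z hz : LocalRingAt r z →+* k) := by
          refine localHom_ext_chart hρ fun b ↦ ?_
          rw [RingHom.comp_apply, hgρ]
          exact (hb b).trans (aug_formalNbhd hz (ρ b))
        exact congr($this o)
    exact ⟨F, fun b ↦ (hF (ρ b)).trans (hgρ b)⟩
  · refine continuousAlgHom_ext_completion fun o ↦ ?_
    have : (F : FormalNbhd r z →+* P).comp (algebraMap _ _) =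
        (G : FormalNbhd r z →+* P).comp (algebraMap (LocalRingAt r z) _) :=
      localHom_ext_chart hρ h
    exact congr($this o)

end LocalRing

end

end ArcSpaces

namespace ArcSpaces

noncomputable section

open scoped PowerSeries.WithPiTopology Topology

/-! ### Universal arcs at points of the arc space -/

section UniversalArcOfScheme

open Scheme.AffineZariskiSite

variable {k : Type u} [Field k] {X : Scheme.{u}} {p : X ⟶ Spec (.of k)}

lemma arcChart_comp_arcSpaceStr (U : X.AffineZariskiSite) : arcChart p U ≫ arcSpaceStr p =
    Spec.map (CommRingCat.ofHom
      ((HasseSchmidt.ofBase (sectionsHom p U.toOpens)).comp (sectionsHom p U.toOpens))) := by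
  rw [arcSpaceStr, ← Category.assoc, arcChart_proj, Category.assoc, fromSpec_comp,
    CommRingCat.ofHom_comp, Spec.map_comp]

/-- The universal arc on the formal neighbourhood of `α(0)`, in terms of an affine chart. -/
theorem exists_isUniversalArc {α : Spec (.of k) ⟶ arcSpace p} (hα : α ≫ arcSpaceStr p = 𝟙 _)
    {x : Spec (.of k) ⟶ X} (hx : x ≫ p = 𝟙 _) (hαx : α ≫ arcSpaceProj p = x)
    [FormalPointAlgebra k (FormalNbhd p x)]
    [FormalPointAlgebra k (FormalNbhd (arcSpaceStr p) α)] (U : X.AffineZariskiSite)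
    (ζ : HasseSchmidt (sectionsHom p U.toOpens) →+* k)
    (hζ : Spec.map (CommRingCat.ofHom ζ) ≫ arcChart p U = α) :
    ∃ (ρ : Γ(X, U.toOpens) →+* LocalRingAt p x)
      (u : FormalNbhd p x →A[k] PowerSeries (FormalNbhd (arcSpaceStr p) α)),
      Spec.map (CommRingCat.ofHom ρ) ≫ U.2.fromSpec = fromLocal p x ∧
      IsFormalCompletion (sectionsHom p U.toOpens) ((algebraMap _ (FormalNbhd p x)).comp ρ) ∧
      IsUniversalArc u ∧ ∀ b n, aug k _ (PowerSeries.coeff n (u (algebraMap _ _ (ρ b)))) =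
        ζ (HasseSchmidt.d _ n b) := by
  have hζ0 : Spec.map (CommRingCat.ofHom (ζ.comp (HasseSchmidt.ofBase _))) ≫ U.2.fromSpec = x := by
    rw [← hαx, ← hζ, Category.assoc, arcChart_proj, ← Category.assoc, ← Spec.map_comp]
    rfl
  obtain ⟨ρ, hρ⟩ := exists_chartHom (r := p) (z := x) U.2.fromSpec
    ⟨Spec.map (CommRingCat.ofHom (ζ.comp (HasseSchmidt.ofBase _))) (closedPoint k),
      congr($hζ0 (closedPoint k))⟩
  obtain ⟨ρ', hρ'⟩ := exists_chartHom (r := arcSpaceStr p) (z := α) (arcChart p U)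
    ⟨Spec.map (CommRingCat.ofHom ζ) (closedPoint k), congr($hζ (closedPoint k))⟩
  have h1 := isFormalCompletion_formalNbhd hρ hx (fromSpec_comp p U)
  have h2 := isFormalCompletion_formalNbhd hρ' hα (arcChart_comp_arcSpaceStr U)
  have h3 (b : HasseSchmidt (sectionsHom p U.toOpens)) :
      aug k (FormalNbhd (arcSpaceStr p) α) (algebraMap _ _ (ρ' b)) = ζ b := by
    rw [aug_formalNbhd hα, residueHom_chart hρ' hα hζ]
  obtain ⟨u, hu, huniv⟩ := h1.exists_isUniversalArc h2 fun b ↦ by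
    refine (h3 _).trans (Eq.symm ?_)
    refine (aug_formalNbhd hx (ρ b)).trans ?_
    rw [residueHom_chart hρ hx hζ0, RingHom.comp_apply, HasseSchmidt.ofBase_apply]
  exact ⟨ρ, u, hρ, h1, huniv, fun b n ↦ (congrArg _ (hu b n)).trans (h3 _)⟩

/-- The reduction of the universal arc has to be matched with the homomorphism of the geometric arc:
on a chart this is the construction of `arcOfPoint`, and it passes to the local ring and then to the
completion. -/
theorem exists_isUniversalArc_arcOfPoint {α : Spec (.of k) ⟶ arcSpace p}
    (hα : α ≫ arcSpaceStr p = 𝟙 _) [FormalPointAlgebra k (FormalNbhd p (α ≫ arcSpaceProj p))]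
    [FormalPointAlgebra k (FormalNbhd (arcSpaceStr p) α)] :
    ∃ u : FormalNbhd p (α ≫ arcSpaceProj p) →A[k] PowerSeries (FormalNbhd (arcSpaceStr p) α),
      IsUniversalArc u ∧ ∀ c n, aug k _ (PowerSeries.coeff n (u c)) = PowerSeries.coeff n
        (arcFormalHom p (arcOfPoint α) (α ≫ arcSpaceProj p) (arcOfPoint_closedPoint p α) c) := by
  obtain ⟨ρ, u, hρ, -, hu, h⟩ := exists_isUniversalArc hα (by rw [Category.assoc]; exact hα) rfl
    (affineNhd (pt (α ≫ arcSpaceProj p))) (Spec.preimage (pointToChart α)).hom <| by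
      rw [CommRingCat.ofHom_hom, Spec.map_preimage]
      exact IsOpenImmersion.lift_fac _ _ _
  refine ⟨u, hu, aug_coeff_eq_coeff_completionLift _ _ u fun o n ↦ ?_⟩
  have h1 : ((PowerSeries.map
      (aug k (FormalNbhd (arcSpaceStr p) α) : FormalNbhd (arcSpaceStr p) α →+* k)).comp
      (u : FormalNbhd p (α ≫ arcSpaceProj p) →+* _)).comp (algebraMap _ _) =
      arcStalkHom p (arcOfPoint α) (α ≫ arcSpaceProj p) (arcOfPoint_closedPoint p α) := by
    refine localHom_ext_chart hρ fun b ↦ PowerSeries.ext fun n ↦ ?_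
    refine (PowerSeries.coeff_map _ _ _).trans ((h b n).trans (Eq.symm ?_))
    have h2 := eq_of_spec_comp hρ (f := arcStalkHom p (arcOfPoint α) (α ≫ arcSpaceProj p)
      (arcOfPoint_closedPoint p α)) (spec_arcStalkHom _ _) b
    refine (congrArg _ h2).trans ?_
    rw [RingHom.comp_apply, PowerSeries.coeff_map, HasseSchmidt.coeff_univArc]
  rw [← h1]
  exact (PowerSeries.coeff_map _ _ _).symm

/-- On a chart, the constant arc is the point of the Hasse--Schmidt algebra that factors through
`toBase`, so all coefficients of positive index vanish there. Comparison with the constant series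
`psC` carries this to the completion. -/
theorem exists_isUniversalArc_constArcs {x : Spec (.of k) ⟶ X} (hx : x ≫ p = 𝟙 _)
    (hα : (x ≫ constArcs p) ≫ arcSpaceStr p = 𝟙 _) [FormalPointAlgebra k (FormalNbhd p x)]
    [FormalPointAlgebra k (FormalNbhd (arcSpaceStr p) (x ≫ constArcs p))] :
    ∃ u : FormalNbhd p x →A[k] PowerSeries (FormalNbhd (arcSpaceStr p) (x ≫ constArcs p)),
      IsUniversalArc u ∧
      ∀ c n, aug k _ (PowerSeries.coeff n (u c)) = if n = 0 then aug k _ c else 0 := by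
  let U := affineNhd (pt x)
  have hrange : Set.range x ⊆ Set.range U.2.fromSpec := by
    rintro _ ⟨z, rfl⟩
    have hz : z = closedPoint k := Subsingleton.elim (α := PrimeSpectrum k) _ _
    subst hz
    rw [U.2.range_fromSpec]
    exact mem_affineNhd (pt x)
  let ξ : Γ(X, U.toOpens) →+* k := (Spec.preimage (IsOpenImmersion.lift U.2.fromSpec x hrange)).hom
  have hξ : Spec.map (CommRingCat.ofHom ξ) ≫ U.2.fromSpec = x := by
    rw [CommRingCat.ofHom_hom, Spec.map_preimage, IsOpenImmersion.lift_fac]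
  obtain ⟨ρ, u, hρ, hc, hu, h⟩ := exists_isUniversalArc hα hx
    (by rw [Category.assoc, constArcs_proj, Category.comp_id]) U
    (ξ.comp (HasseSchmidt.toBase (sectionsHom p U.toOpens))) <| by
      rw [CommRingCat.ofHom_comp, Spec.map_comp, Category.assoc]
      refine (congrArg _ (fromSpec_constArcs p U).symm).trans ?_
      rw [← Category.assoc, hξ]
  refine ⟨u, hu, fun c n ↦ (hc.aug_coeff_eq u (psC k _) (fun b n ↦ (h b n).trans ?_) c n).trans ?_⟩
  · rw [RingHom.comp_apply, HasseSchmidt.toBase_d, psC_apply, PowerSeries.coeff_C]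
    split_ifs with hn
    · exact ((aug_formalNbhd hx (ρ b)).trans (residueHom_chart hρ hx hξ b)).symm
    · simp
  · rw [psC_apply, PowerSeries.coeff_C]
    split_ifs <;> simp

/-- The image of `α` is the constant arc, in terms of the associated homomorphisms. -/
lemma coeff_arcFormalHom_of_imageArc_eq {Y : Scheme.{u}} {q : Y ⟶ Spec (.of k)}
    {x : Spec (.of k) ⟶ X} {y : Spec (.of k) ⟶ Y} (hy : y ≫ q = 𝟙 _)
    (φ : FormalNbhd q y →+* FormalNbhd p x) (a : Spec (.of (PowerSeries k)) ⟶ X)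
    (h : a (closedPoint (PowerSeries k)) = pt x)
    (hβ : imageArc p q x y φ a h = arcOfPoint (y ≫ constArcs q)) (o : LocalRingAt q y) :
    arcFormalHom p a x h (φ (algebraMap _ _ o)) = PowerSeries.C (residueHom q y hy o) := by
  have h1 : ((arcFormalHom p a x h).comp φ).comp (algebraMap (LocalRingAt q y) _) =
      (PowerSeries.C).comp (residueHom q y hy : LocalRingAt q y →+* k) := by
    refine localHom_ext (hβ.trans ?_)
    rw [arcOfPoint_constArcs, CommRingCat.ofHom_comp, Spec.map_comp, Category.assoc,
      spec_residueHom]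
  exact congr($h1 o)

end UniversalArcOfScheme

end

end ArcSpaces

namespace ArcSpaces

noncomputable section

open scoped PowerSeries.WithPiTopology Topology

/-! ### Trivial tangent space and the lifting property -/

section TrivialTangentSpace

variable {k : Type u} [Field k] {A : Type u} [CommRing A] [Algebra k A] [TopologicalSpace A]
  [FormalPointAlgebra k A]

/-- A formal scheme with trivial tangent space is a reduced point. -/
theorem eq_zero_of_aug_eq_zero
    (h : ∀ (v : A →A[k] SqZeroAlg k k) (x : A), SqZeroAlg.snd (v x) = 0) (x : A)
    (hx : aug k A x = 0) : x = 0 := by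
  refine FormalPointAlgebra.separated (k := k) x fun 𝔞 h𝔞 ↦ ?_
  set 𝔪 := RingHom.ker (aug k A)
  -- Otherwise a linear form that vanishes on `𝔪 ^ 2 + 𝔞` but not at some `y` in `𝔪` gives, after
  -- removing constants, a derivation. It is continuous since it kills `𝔞 ⊓ 𝔪`, so it is a nonzero
  -- tangent vector.
  have key : 𝔪 ≤ 𝔪 ^ 2 ⊔ 𝔞 := by
    intro y hy
    by_contra hne
    obtain ⟨f, hf, hle⟩ :=
      Submodule.exists_le_ker_of_notMem (p := (𝔪 ^ 2 ⊔ 𝔞).restrictScalars k) (v := y) hne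
    have hle' (a : A) (ha : a ∈ 𝔪 ^ 2 ⊔ 𝔞) : f a = 0 := hle ha
    let δ : A →ₗ[k] k := f - f ∘ₗ Algebra.linearMap k A ∘ₗ (aug k A).toLinearMap
    have hδ (a : A) : δ a = f (a - algebraMap k A (aug k A a)) := (map_sub f _ _).symm
    have hleib (a b : A) : δ (a * b) = aug k A a • δ b + aug k A b • δ a := by
      simp only [hδ]
      rw [← map_smul, ← map_smul, ← map_add, ← sub_eq_zero, ← map_sub]
      refine hle' _ (Ideal.mem_sup_left ?_)
      have : a * b - algebraMap k A (aug k A (a * b)) -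
          (aug k A a • (b - algebraMap k A (aug k A b)) +
            aug k A b • (a - algebraMap k A (aug k A a))) =
          (a - algebraMap k A (aug k A a)) * (b - algebraMap k A (aug k A b)) := by
        rw [Algebra.smul_def, Algebra.smul_def, map_mul, map_mul]
        ring
      rw [this, pow_two]
      exact Ideal.mul_mem_mul (by simp [𝔪]) (by simp [𝔪])
    let v : A →A[k] SqZeroAlg k k :=
      continuousAlgHomOfDiscrete (SqZeroAlg.ofDerivation (aug k A) δ hleib) <| by
        refine isOpen_of_openIdeal_le (𝔞 := 𝔞 ⊓ 𝔪) (h𝔞.inter (isOpen_ker_aug k A)) fun a ha ↦ ?_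
        have ha2 : aug k A a = 0 := ha.2
        rw [RingHom.mem_ker]
        ext
        · simpa using ha2
        · change δ a = 0
          rw [hδ, ha2, map_zero, sub_zero]
          exact hle' a (Ideal.mem_sup_right ha.1)
    have hvy : δ y = 0 := h v y
    have hy' : aug k A y = 0 := hy
    rw [hδ, hy', map_zero, sub_zero] at hvy
    exact hf hvy
  -- Iterating the inclusion, up to a power of `𝔪` contained in the open ideal `𝔞`.
  have key2 (n : ℕ) : 𝔪 ≤ 𝔪 ^ (n + 1) ⊔ 𝔞 := by
    induction n with
    | zero => simp
    | succ n ih =>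
      refine ih.trans (sup_le ?_ le_sup_right)
      calc 𝔪 ^ (n + 1) = 𝔪 ^ n * 𝔪 := pow_succ _ _
        _ ≤ 𝔪 ^ n * (𝔪 ^ 2 ⊔ 𝔞) := Ideal.mul_mono_right key
        _ = 𝔪 ^ n * 𝔪 ^ 2 ⊔ 𝔪 ^ n * 𝔞 := Ideal.mul_sup _ _ _
        _ ≤ 𝔪 ^ (n + 1 + 1) ⊔ 𝔞 := sup_le_sup (by rw [← pow_add]) Ideal.mul_le_right
  obtain ⟨n, hn⟩ := exists_ker_aug_pow_le k 𝔞 h𝔞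
  exact (key2 n).trans (sup_le ((Ideal.pow_le_pow_right n.le_succ).trans hn) le_rfl) hx

/-- A formal power series ring over `k` has the lifting property for surjections. -/
theorem IsFreeExtension.exists_lift {C : Type u} [CommRing C] [Algebra k C] [TopologicalSpace C]
    [FormalPointAlgebra k C] {I : Type v} {a : A →A[k] C} {z : I → C}
    (hz : IsFreeExtension.{u, v, u} a z) (hA : ∀ x : A, aug k A x = 0 → x = 0)
    {P P' : Type u} [CommRing P] [Algebra k P] [TopologicalSpace P] [FormalPointAlgebra k P]
    [CommRing P'] [Algebra k P'] [TopologicalSpace P'] [FormalPointAlgebra k P']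
    (π : P →A[k] P') (hπ : Function.Surjective π) (f : C →A[k] P') :
    ∃ F : C →A[k] P, ∀ c, π (F c) = f c := by
  have hA' (x : A) : x = algebraMap k A (aug k A x) := by
    rw [← sub_eq_zero]
    exact hA _ (by simp)
  -- Since `A` is reduced to constants, only the variables have to be lifted, and any preimages
  -- work: `π` preserves augmentations, so they lie in the maximal ideal.
  choose b hb using fun i ↦ hπ (f (z i))
  have : IsTopologicalRing P := FormalPointAlgebra.isTopologicalRing k
  let ι : A →A[k] P :=
    { (Algebra.ofId k P).comp (aug k A) with
      cont := by
        refine continuous_of_isOpen_comap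
          (((Algebra.ofId k P).comp (aug k A) : A →ₐ[k] P) : A →+* P) fun 𝔞 _ ↦
            isOpen_of_openIdeal_le (isOpen_ker_aug k A) fun x hx ↦ ?_
        rw [hA x hx]
        exact zero_mem _ }
  obtain ⟨F, hF1, hF2⟩ := hz.exists_hom P ι b fun i ↦ by
    rw [← aug_apply π, hb, aug_apply, hz.aug_eq_zero]
  have : π.comp F = f := by
    refine hz.hom_ext _ _ _ (fun x ↦ ?_) fun i ↦ ?_
    · rw [hA' x, AlgHomClass.commutes a, AlgHomClass.commutes, AlgHomClass.commutes]
    · rw [ContinuousAlgHom.comp_apply, hF2, hb]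
  exact ⟨F, fun c ↦ congr($this c)⟩

end TrivialTangentSpace

/-! ### From infinitesimal lifting on the completion to formal smoothness -/

section FormallySmooth

variable {k : Type u} [Field k] {P : Type u} [CommRing P] [Algebra k P] [Algebra P k]
  [IsScalarTower k P k]

/-- A derivation whose values are killed by the kernel of `P → k` factors through `k ⊗ Ω`, so it
only sees the differential at the rational point. -/
lemma derivation_eq_zero_of_one_tmul_eq_zero {f : P}
    (hf : (1 : k) ⊗ₜ[P] KaehlerDifferential.D k P f = 0) {M : Type*} [AddCommGroup M]
    [Module k M] [Module P M] [IsScalarTower k P M] (D : Derivation k P M)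
    (hD : ∀ n ∈ RingHom.ker (algebraMap P k), ∀ a, n • D a = 0) : D f = 0 := by
  have h1 (n : P) (hn : n ∈ RingHom.ker (algebraMap P k)) (ω : Ω[P⁄k]) :
      n • D.liftKaehlerDifferential ω = 0 := by
    have hω : ω ∈ Submodule.span P (Set.range (KaehlerDifferential.D k P)) := by
      rw [KaehlerDifferential.span_range_derivation]
      trivial
    induction hω using Submodule.span_induction with
    | mem x hx =>
      obtain ⟨a, rfl⟩ := hx
      rw [Derivation.liftKaehlerDifferential_comp_D, hD n hn]
    | zero => rw [map_zero, smul_zero]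
    | add x y _ _ hx hy => rw [map_add, smul_add, hx, hy, add_zero]
    | smul a x _ hx => rw [map_smul, smul_comm, hx, smul_zero]
  have hk (c : k) : algebraMap P k (algebraMap k P c) = c :=
    (IsScalarTower.algebraMap_apply k P k c).symm
  let L : k ⊗[P] Ω[P⁄k] →ₗ[P] M := TensorProduct.lift <|
    LinearMap.mk₂ P (fun c ω ↦ algebraMap k P c • D.liftKaehlerDifferential ω)
      (fun c d ω ↦ by rw [map_add, add_smul])
      (fun a c ω ↦ by
        rw [← sub_eq_zero, smul_smul, ← sub_smul]
        refine h1 _ ?_ ω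
        rw [RingHom.mem_ker, map_sub, map_mul, hk, hk, Algebra.smul_def, sub_self])
      (fun c ω ω' ↦ by rw [map_add, smul_add])
      (fun a c ω ↦ by rw [map_smul, smul_comm])
  have h2 := congrArg L hf
  rw [map_zero] at h2
  change algebraMap k P 1 • D.liftKaehlerDifferential (KaehlerDifferential.D k P f) = 0 at h2
  rwa [map_one, one_smul, Derivation.liftKaehlerDifferential_comp_D] at h2

/-- Krull's intersection theorem for `P ⧸ J`. -/
lemma mem_of_forall_mem_sup_pow [IsLocalRing P] [IsNoetherianRing P] {J : Ideal P}
    {f : P} (h : ∀ n, f ∈ J ⊔ maximalIdeal P ^ (n + 1)) : f ∈ J := by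
  have h1 : ⨅ i : ℕ, (maximalIdeal P) ^ i • (⊤ : Submodule P (P ⧸ J)) = ⊥ :=
    Ideal.iInf_pow_smul_eq_bot_of_isLocalRing _ (maximalIdeal.isMaximal P).ne_top
  rw [← Ideal.Quotient.eq_zero_iff_mem, ← Submodule.mem_bot (R := P), ← h1, Submodule.mem_iInf]
  intro n
  obtain ⟨a, ha, b, hb, rfl⟩ := Submodule.mem_sup.1 (h n)
  rw [map_add, Ideal.Quotient.eq_zero_iff_mem.2 ha, zero_add]
  have : Ideal.Quotient.mk J b = b • (1 : P ⧸ J) := by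
    rw [Algebra.smul_def, mul_one]
    rfl
  rw [this]
  exact Submodule.smul_mem_smul (Ideal.pow_le_pow_right n.le_succ hb) trivial

lemma one_tmul_eq_zero_of_mem_mul {P : Type*} [CommRing P] [Algebra P k] {I : Ideal P} {f : P}
    (hf : f ∈ RingHom.ker (algebraMap P k) * I) (hfI : f ∈ I) :
    (1 : k) ⊗ₜ[P] (⟨f, hfI⟩ : I) = 0 := by
  have h : ∀ f ∈ RingHom.ker (algebraMap P k) * I, ∃ hfI : f ∈ I,
      (1 : k) ⊗ₜ[P] (⟨f, hfI⟩ : I) = 0 := by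
    intro f hf
    induction hf using Submodule.mul_induction_on' with
    | mem_mul_mem n hn i hi =>
      refine ⟨I.mul_mem_left n hi, ?_⟩
      have : (⟨n * i, I.mul_mem_left n hi⟩ : I) = n • ⟨i, hi⟩ := rfl
      rw [this, ← TensorProduct.smul_tmul, Algebra.smul_def, RingHom.mem_ker.1 hn, zero_mul,
        TensorProduct.zero_tmul]
    | add x _ y _ hx hy =>
      obtain ⟨hx, hx0⟩ := hx
      obtain ⟨hy, hy0⟩ := hy
      refine ⟨add_mem hx hy, ?_⟩
      have : (⟨x + y, add_mem hx hy⟩ : I) = ⟨x, hx⟩ + ⟨y, hy⟩ := rfl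
      rw [this, TensorProduct.tmul_add, hx0, hy0, add_zero]
  exact (h f hf).2

variable {O : Type u} [CommRing O] [Algebra k O] [IsLocalRing O] [Algebra P O]
  [IsScalarTower k P O] [Algebra O k] [IsScalarTower k O k] [IsScalarTower P O k]

lemma ker_algebraMap_eq_maximalIdeal {R : Type*} [CommRing R] [IsLocalRing R] [Algebra k R]
    [Algebra R k] [IsScalarTower k R k] : RingHom.ker (algebraMap R k) = maximalIdeal R := by
  have : (RingHom.ker (algebraMap R k)).IsMaximal :=
    RingHom.ker_isMaximal_of_surjective _ fun c ↦
      ⟨algebraMap k R c, (IsScalarTower.algebraMap_apply k R k c).symm⟩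
  exact IsLocalRing.eq_maximalIdeal this

lemma formalPointAlgebra_quotient {R : Type u} [CommRing R] [Algebra k R] [Algebra R k]
    [IsScalarTower k R k] (𝔞 : Ideal R) [TopologicalSpace (R ⧸ 𝔞)] [DiscreteTopology (R ⧸ 𝔞)]
    (h𝔞 : 𝔞 ≤ RingHom.ker (algebraMap R k)) (n : ℕ) (hn : RingHom.ker (algebraMap R k) ^ n ≤ 𝔞) :
    FormalPointAlgebra k (R ⧸ 𝔞) := by
  refine formalPointAlgebra_of_discrete
    (Ideal.Quotient.liftₐ 𝔞 (IsScalarTower.toAlgHom k R k) fun a ha ↦ h𝔞 ha) ⟨n, ?_⟩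
  have h1 : RingHom.ker (Ideal.Quotient.liftₐ 𝔞 (IsScalarTower.toAlgHom k R k) fun a ha ↦ h𝔞 ha) =
      (RingHom.ker (algebraMap R k)).map (Ideal.Quotient.mk 𝔞) := by
    refine le_antisymm (fun x hx ↦ ?_) (Ideal.map_le_iff_le_comap.2 fun a ha ↦ ha)
    obtain ⟨a, rfl⟩ := Ideal.Quotient.mk_surjective x
    exact Ideal.mem_map_of_mem _ hx
  rw [h1, ← Ideal.map_pow, Ideal.zero_eq_bot, Ideal.map_eq_bot_iff_le_ker, Ideal.mk_ker]
  exact hn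

/-- Infinitesimal lifting for the completion of `O = P / I` allows to detect the elements of `I`
with vanishing differential. -/
lemma mem_sup_of_exists_lift [IsLocalRing P] (hsurj : Function.Surjective (algebraMap P O))
    [FormalPointAlgebra k (AdicCompletion (maximalIdeal O) O)]
    (H : ∀ (Q Q' : Type u) [CommRing Q] [Algebra k Q] [TopologicalSpace Q]
      [FormalPointAlgebra k Q] [CommRing Q'] [Algebra k Q'] [TopologicalSpace Q']
      [FormalPointAlgebra k Q'] (π : Q →A[k] Q') (_ : Function.Surjective π)
      (f : AdicCompletion (maximalIdeal O) O →A[k] Q'),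
      ∃ F : AdicCompletion (maximalIdeal O) O →A[k] Q, ∀ c, π (F c) = f c)
    {f : P} (hfI : f ∈ RingHom.ker (algebraMap P O))
    (hf : (1 : k) ⊗ₜ[P] KaehlerDifferential.D k P f = 0) (n : ℕ) :
    f ∈ RingHom.ker (algebraMap P k) * RingHom.ker (algebraMap P O) ⊔
      maximalIdeal P ^ (n + 1) := by
  set I := RingHom.ker (algebraMap P O)
  have hn : maximalIdeal P = RingHom.ker (algebraMap P k) := ker_algebraMap_eq_maximalIdeal.symm
  have hm : maximalIdeal O = RingHom.ker (algebraMap O k) := ker_algebraMap_eq_maximalIdeal.symm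
  have hεχ (a : P) : algebraMap P k a = algebraMap O k (algebraMap P O a) :=
    IsScalarTower.algebraMap_apply P O k a
  set 𝔫 := RingHom.ker (algebraMap P k) with h𝔫
  rw [hn]
  have hI : I ≤ 𝔫 := fun a ha ↦ by
    rw [h𝔫, RingHom.mem_ker, hεχ, RingHom.mem_ker.1 ha, map_zero]
  have hmap : 𝔫.map (algebraMap P O) = maximalIdeal O := by
    refine le_antisymm (Ideal.map_le_iff_le_comap.2 fun a ha ↦ ?_) fun o ho ↦ ?_
    · rwa [Ideal.mem_comap, hm, RingHom.mem_ker, ← hεχ]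
    · obtain ⟨a, rfl⟩ := hsurj o
      refine Ideal.mem_map_of_mem _ ?_
      rwa [hm, RingHom.mem_ker, ← hεχ] at ho
  -- Chosen so that `P ⧸ 𝔞` maps onto `O ⧸ 𝔪 ^ (n + 1)` with kernel the image of `I`, and this
  -- kernel is annihilated by `𝔫`, hence has square zero.
  set 𝔞 := 𝔫 * I ⊔ 𝔫 ^ (n + 1) with h𝔞
  have h𝔞O (a : P) (ha : a ∈ 𝔞) : algebraMap P O a ∈ maximalIdeal O ^ (n + 1) := by
    rw [← hmap, ← Ideal.map_pow]
    obtain ⟨b, hb, c, hc, rfl⟩ := Submodule.mem_sup.1 ha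
    rw [map_add, RingHom.mem_ker.1 (Ideal.mul_le_right hb : b ∈ I), zero_add]
    exact Ideal.mem_map_of_mem _ hc
  let : TopologicalSpace (P ⧸ 𝔞) := ⊥
  have : DiscreteTopology (P ⧸ 𝔞) := ⟨rfl⟩
  let : TopologicalSpace (O ⧸ maximalIdeal O ^ (n + 1)) := ⊥
  have : DiscreteTopology (O ⧸ maximalIdeal O ^ (n + 1)) := ⟨rfl⟩
  have : FormalPointAlgebra k (P ⧸ 𝔞) := formalPointAlgebra_quotient 𝔞
    (sup_le Ideal.mul_le_left (Ideal.pow_le_self n.succ_ne_zero)) (n + 1) le_sup_right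
  have : FormalPointAlgebra k (O ⧸ maximalIdeal O ^ (n + 1)) := formalPointAlgebra_quotient _
    (hm ▸ Ideal.pow_le_self n.succ_ne_zero) (n + 1) (Ideal.pow_right_mono hm.ge _)
  let π : P ⧸ 𝔞 →A[k] O ⧸ maximalIdeal O ^ (n + 1) := continuousAlgHomOfDiscrete
    (Ideal.Quotient.liftₐ 𝔞 ((Ideal.Quotient.mkₐ k _).comp (IsScalarTower.toAlgHom k P O))
      fun a ha ↦ Ideal.Quotient.eq_zero_iff_mem.2 (h𝔞O a ha)) (isOpen_discrete _)
  have hπ (a : P) : π (Ideal.Quotient.mk 𝔞 a) = Ideal.Quotient.mk _ (algebraMap P O a) := rfl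
  have hπs : Function.Surjective π := fun x ↦ by
    obtain ⟨o, rfl⟩ := Ideal.Quotient.mk_surjective x
    obtain ⟨a, rfl⟩ := hsurj o
    exact ⟨Ideal.Quotient.mk 𝔞 a, rfl⟩
  obtain ⟨g, hg⟩ := exists_continuousAlgHom_completion (IsScalarTower.toAlgHom k O k) hm
    (Ideal.Quotient.mkₐ k (maximalIdeal O ^ (n + 1))) fun o ↦ by
      let φ : O ⧸ maximalIdeal O ^ (n + 1) →ₐ[k] k :=
        Ideal.Quotient.liftₐ _ (IsScalarTower.toAlgHom k O k)
          fun a ha ↦ (Ideal.pow_le_self n.succ_ne_zero).trans hm.le ha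
      rw [← eq_aug φ (isOpen_discrete _)]
      rfl
  obtain ⟨F, hF⟩ := H _ _ π hπs g
  -- The lift supplied by the hypothesis, precomposed with `P → O`, so it kills `I`. It agrees with
  -- the quotient map modulo the image of `I`; hence the difference `D` is a derivation killed by
  -- `𝔫`. On `f` it is the class of `f`, and it vanishes because the differential of `f` does.
  let G : P →ₐ[k] P ⧸ 𝔞 := ((F : _ →ₐ[k] P ⧸ 𝔞).comp (completionOf (maximalIdeal O) k)).comp
    (IsScalarTower.toAlgHom k P O)
  have hG (a : P) : ∃ i ∈ I, Ideal.Quotient.mk 𝔞 a - G a = Ideal.Quotient.mk 𝔞 i := by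
    obtain ⟨b, hb⟩ := Ideal.Quotient.mk_surjective (Ideal.Quotient.mk 𝔞 a - G a)
    have h1 : π (Ideal.Quotient.mk 𝔞 b) = 0 := by
      rw [hb, map_sub, hπ, sub_eq_zero]
      refine Eq.symm ?_
      refine (hF _).trans ?_
      exact hg _
    rw [hπ, Ideal.Quotient.eq_zero_iff_mem, ← hmap, ← Ideal.map_pow,
      Ideal.mem_map_iff_of_surjective _ hsurj] at h1
    obtain ⟨c, hc, hcb⟩ := h1
    refine ⟨b - c, ?_, ?_⟩
    · rw [RingHom.mem_ker, map_sub, hcb, sub_self]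
    · rw [← hb, Ideal.Quotient.eq, sub_sub_cancel]
      exact Ideal.mem_sup_right hc
  have hmul (m : P) (hm : m ∈ 𝔫) (a : P) :
      Ideal.Quotient.mk 𝔞 m * (Ideal.Quotient.mk 𝔞 a - G a) = 0 := by
    obtain ⟨i, hi, h⟩ := hG a
    rw [h, ← map_mul, Ideal.Quotient.eq_zero_iff_mem]
    exact Ideal.mem_sup_left (Ideal.mul_mem_mul hm hi)
  let D : Derivation k P (P ⧸ 𝔞) := Derivation.mk'
    ((Ideal.Quotient.mkₐ k 𝔞).toLinearMap - G.toLinearMap) fun a b ↦ by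
      change Ideal.Quotient.mk 𝔞 (a * b) - G (a * b) =
        Ideal.Quotient.mk 𝔞 a * (Ideal.Quotient.mk 𝔞 b - G b) +
        Ideal.Quotient.mk 𝔞 b * (Ideal.Quotient.mk 𝔞 a - G a)
      have h1 : (Ideal.Quotient.mk 𝔞 a - G a) * (Ideal.Quotient.mk 𝔞 b - G b) = 0 := by
        obtain ⟨i, hi, h⟩ := hG a
        rw [h]
        exact hmul i (hI hi) b
      rw [map_mul, map_mul]
      linear_combination -h1
  have hD := derivation_eq_zero_of_one_tmul_eq_zero hf D fun m hm a ↦ hmul m hm a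
  have hD' : Ideal.Quotient.mk 𝔞 f - G f = 0 := hD
  have hGf : G f = 0 := by
    change F (completionOf _ k (algebraMap P O f)) = 0
    rw [RingHom.mem_ker.1 hfI, map_zero, map_zero]
  rwa [hGf, sub_zero, Ideal.Quotient.eq_zero_iff_mem] at hD'

/-- With `I` the kernel of `P → O`, the Jacobian criterion asks that `k ⊗ I → k ⊗ Ω` be injective.
An `f` in its kernel lies in `𝔫 I + 𝔫 ^ (n + 1)` for all `n` by lifting, hence in `𝔫 I` by Krull,
where `1 ⊗ f` is zero. -/
theorem formallySmooth_of_exists_lift [IsLocalRing P] [IsNoetherianRing P]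
    [Algebra.FormallySmooth k P] [Module.Free P Ω[P⁄k]] [Module.Finite P Ω[P⁄k]]
    (hsurj : Function.Surjective (algebraMap P O))
    [FormalPointAlgebra k (AdicCompletion (maximalIdeal O) O)]
    (H : ∀ (Q Q' : Type u) [CommRing Q] [Algebra k Q] [TopologicalSpace Q]
      [FormalPointAlgebra k Q] [CommRing Q'] [Algebra k Q'] [TopologicalSpace Q']
      [FormalPointAlgebra k Q'] (π : Q →A[k] Q') (_ : Function.Surjective π)
      (f : AdicCompletion (maximalIdeal O) O →A[k] Q'),
      ∃ F : AdicCompletion (maximalIdeal O) O →A[k] Q, ∀ c, π (F c) = f c) :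
    Algebra.FormallySmooth k O := by
  rw [Algebra.FormallySmooth.iff_injective_cotangentComplexBaseChange (P := P) (K := k) hsurj
    (IsNoetherian.noetherian _) (ker_algebraMap_eq_maximalIdeal (R := O)).ge,
    injective_iff_map_eq_zero]
  intro x hx
  obtain ⟨⟨f, hf⟩, rfl⟩ := TensorProduct.mk_surjective P (RingHom.ker (algebraMap P O)) k
    (fun c ↦ ⟨algebraMap k P c, (IsScalarTower.algebraMap_apply k P k c).symm⟩) x
  refine one_tmul_eq_zero_of_mem_mul (mem_of_forall_mem_sup_pow
    (mem_sup_of_exists_lift hsurj H hf ?_)) hf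
  refine Eq.trans ?_ hx
  change _ = KaehlerDifferential.cotangentComplexBaseChange k O P k _
  erw [KaehlerDifferential.cotangentComplexBaseChange_tmul]
  simp

end FormallySmooth

end

end ArcSpaces

namespace ArcSpaces

noncomputable section

open scoped PowerSeries.WithPiTopology Topology

/-! ### Local rings of finite type algebras -/

section EssFiniteType

variable {k : Type u} [Field k]

/-- A presentation of `B` exhibits `O` as a quotient of a polynomial ring localized at the preimage
of `𝔭`. That localization is noetherian and formally smooth with finite free differentials, as the
criterion requires. -/
theorem formallySmooth_of_isLocalization_of_exists_lift {B O : Type u} [CommRing B] [CommRing O]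
    [Algebra k B] [Algebra.FiniteType k B] [Algebra k O] [Algebra B O] [IsScalarTower k B O]
    [IsLocalRing O] (𝔭 : Ideal B) [𝔭.IsPrime] [IsLocalization.AtPrime O 𝔭]
    (χ : O →ₐ[k] k) [FormalPointAlgebra k (AdicCompletion (maximalIdeal O) O)]
    (H : ∀ (Q Q' : Type u) [CommRing Q] [Algebra k Q] [TopologicalSpace Q]
      [FormalPointAlgebra k Q] [CommRing Q'] [Algebra k Q'] [TopologicalSpace Q']
      [FormalPointAlgebra k Q'] (π : Q →A[k] Q') (_ : Function.Surjective π)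
      (f : AdicCompletion (maximalIdeal O) O →A[k] Q'),
      ∃ F : AdicCompletion (maximalIdeal O) O →A[k] Q, ∀ c, π (F c) = f c) :
    Algebra.FormallySmooth k O := by
  obtain ⟨n, f₀, hf₀⟩ := Algebra.FiniteType.iff_quotient_mvPolynomial''.mp
    (inferInstance : Algebra.FiniteType k B)
  let 𝔮 : Ideal (MvPolynomial (Fin n) k) := 𝔭.comap (f₀ : MvPolynomial (Fin n) k →+* B)
  let P := Localization.AtPrime 𝔮
  let φ : P →ₐ[k] O := IsLocalization.liftAlgHom (M := 𝔮.primeCompl)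
    (f := (IsScalarTower.toAlgHom k B O).comp f₀) fun x ↦
      IsLocalization.map_units (M := 𝔭.primeCompl) O ⟨f₀ x.1, x.2⟩
  have hφ : Function.Surjective φ := by
    intro x
    obtain ⟨x, ⟨s, hs⟩, rfl⟩ := IsLocalization.exists_mk'_eq 𝔭.primeCompl x
    obtain ⟨x, rfl⟩ := hf₀ x
    obtain ⟨s, rfl⟩ := hf₀ s
    refine ⟨IsLocalization.mk' (M := 𝔮.primeCompl) P x ⟨s, hs⟩, ?_⟩
    have h (t : MvPolynomial (Fin n) k) : φ (algebraMap _ P t) = algebraMap B O (f₀ t) :=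
      IsLocalization.lift_eq _ t
    rw [IsLocalization.eq_mk'_iff_mul_eq, ← h, ← h, ← map_mul]
    exact congrArg φ (IsLocalization.mk'_spec P x (⟨s, hs⟩ : 𝔮.primeCompl))
  algebraize [φ.toRingHom, χ.toRingHom, (χ.comp φ).toRingHom]
  have : IsScalarTower k P O := .of_algebraMap_eq' φ.comp_algebraMap.symm
  have : IsScalarTower k O k := .of_algebraMap_eq' χ.comp_algebraMap.symm
  have : IsScalarTower k P k := .of_algebraMap_eq' (χ.comp φ).comp_algebraMap.symm
  have : IsScalarTower P O k := .of_algebraMap_eq' rfl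
  have : Algebra.FormallyEtale (MvPolynomial (Fin n) k) P := .of_isLocalization 𝔮.primeCompl
  have : Algebra.FormallySmooth k P := .comp _ (MvPolynomial (Fin n) k) _
  have : Module.Free P Ω[P⁄k] := .of_equiv
    (KaehlerDifferential.tensorKaehlerEquivOfFormallyEtale k (MvPolynomial (Fin n) k) P)
  have : IsNoetherianRing P := IsLocalization.isNoetherianRing 𝔮.primeCompl P inferInstance
  exact formallySmooth_of_exists_lift hφ H

end EssFiniteType

/-! ### Schemes of finite type: generators of the completion, and smoothness at a point -/

section Scheme

variable {k : Type u} [Field k] {X : Scheme.{u}} (p : X ⟶ Spec (.of k))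

lemma finiteType_sectionsHom [LocallyOfFiniteType p] (U : X.AffineZariskiSite) :
    (sectionsHom p U.toOpens).FiniteType := by
  have h := (HasRingHomProperty.Spec_iff (P := @LocallyOfFiniteType)).1
    (show LocallyOfFiniteType (Spec.map (CommRingCat.ofHom (sectionsHom p U.toOpens))) by
      rw [← fromSpec_comp]
      infer_instance)
  exact h

/-- Coordinates on an affine chart generate topologically: maps out of the completion are determined
on the chart, hence on its finitely many algebra generators. -/
lemma exists_generators_formalNbhd [LocallyOfFiniteType p] {x : Spec (.of k) ⟶ X}
    (hx : x ≫ p = 𝟙 _) [FormalPointAlgebra k (FormalNbhd p x)] :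
    ∃ (r : ℕ) (c : Fin r → FormalNbhd p x), ∀ (P : Type u) [CommRing P] [Algebra k P]
      [TopologicalSpace P] [FormalPointAlgebra k P] (F G : FormalNbhd p x →A[k] P),
      (∀ i, F (c i) = G (c i)) → F = G := by
  let U := affineNhd (pt x)
  obtain ⟨ρ, hρ⟩ := exists_chartHom (r := p) (z := x) U.2.fromSpec
    (by rw [U.2.range_fromSpec]; exact mem_affineNhd (pt x))
  have h := isFormalCompletion_formalNbhd hρ hx (fromSpec_comp p U)
  algebraize [sectionsHom p U.toOpens]
  have : Algebra.FiniteType k Γ(X, U.toOpens) := finiteType_sectionsHom p U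
  obtain ⟨r, f₀, hf₀⟩ := Algebra.FiniteType.iff_quotient_mvPolynomial''.mp this
  refine ⟨r, fun i ↦ algebraMap _ _ (ρ (f₀ (.X i))), fun P _ _ _ _ F G hFG ↦ h.hom_ext P F G ?_⟩
  intro b
  obtain ⟨t, rfl⟩ := hf₀ b
  have key : (F : FormalNbhd p x →+* P).comp (((algebraMap _ (FormalNbhd p x)).comp ρ).comp
      (f₀ : MvPolynomial (Fin r) k →+* _)) = (G : FormalNbhd p x →+* P).comp
        (((algebraMap _ (FormalNbhd p x)).comp ρ).comp (f₀ : MvPolynomial (Fin r) k →+* _)) := by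
    refine MvPolynomial.ringHom_ext (fun c ↦ ?_) hFG
    have h1 : f₀ (.C c) = sectionsHom p U.toOpens c := f₀.commutes c
    have h2 (F : FormalNbhd p x →A[k] P) :
        F (algebraMap _ _ (ρ (f₀ (.C c)))) = algebraMap k P c := by
      rw [h1]
      exact (congrArg F (h.map_algebraMap c)).trans (AlgHomClass.commutes F c)
    exact (h2 F).trans (h2 G).symm
  exact congr($key t)

/-- Lifting makes the stalk formally smooth. For a morphism locally of finite presentation this
means that the point lies in the smooth locus, which is open. -/
theorem exists_smooth_of_exists_lift [LocallyOfFiniteType p] {x : Spec (.of k) ⟶ X}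
    (hx : x ≫ p = 𝟙 _) [FormalPointAlgebra k (FormalNbhd p x)]
    (H : ∀ (Q Q' : Type u) [CommRing Q] [Algebra k Q] [TopologicalSpace Q]
      [FormalPointAlgebra k Q] [CommRing Q'] [Algebra k Q'] [TopologicalSpace Q']
      [FormalPointAlgebra k Q'] (π : Q →A[k] Q') (_ : Function.Surjective π)
      (f : FormalNbhd p x →A[k] Q'), ∃ F : FormalNbhd p x →A[k] Q, ∀ c, π (F c) = f c) :
    ∃ U : X.Opens, pt x ∈ U ∧ Smooth (U.ι ≫ p) := by
  have : LocallyOfFinitePresentation p :=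
    LocallyOfFinitePresentation.iff_locallyOfFiniteType.2 inferInstance
  let U := affineNhd (pt x)
  have hxU : pt x ∈ U.toOpens := mem_affineNhd (pt x)
  let : Algebra k Γ(X, U.toOpens) := (sectionsHom p U.toOpens).toAlgebra
  have : Algebra.FiniteType k Γ(X, U.toOpens) := finiteType_sectionsHom p U
  let : Algebra Γ(X, U.toOpens) (LocalRingAt p x) :=
    X.presheaf.algebra_section_stalk ⟨pt x, hxU⟩
  have : IsLocalization.AtPrime (LocalRingAt p x) (U.2.primeIdealOf ⟨pt x, hxU⟩).asIdeal :=
    U.2.isLocalization_stalk ⟨pt x, hxU⟩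
  have : IsScalarTower k Γ(X, U.toOpens) (LocalRingAt p x) := by
    refine .of_algebraMap_eq fun c ↦ ?_
    change X.presheaf.germ ⊤ (pt x) _ (sectionsHom p ⊤ c) =
      X.presheaf.germ U.toOpens (pt x) hxU (sectionsHom p U.toOpens c)
    rw [← map_comp_sectionsHom p (homOfLE le_top : U.toOpens ⟶ ⊤)]
    exact (X.presheaf.germ_res_apply (homOfLE le_top) _ hxU _).symm
  have hO : Algebra.FormallySmooth k (LocalRingAt p x) :=
    formallySmooth_of_isLocalization_of_exists_lift (U.2.primeIdealOf ⟨pt x, hxU⟩).asIdeal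
      (residueHom p x hx) H
  -- The smooth locus is defined by stalk maps, so the stalk of `Spec k` has to be identified with
  -- `k`.
  have hiso (y : Spec (.of k)) : IsIso ((Scheme.ΓSpecIso (.of k)).inv ≫
      (Spec (.of k)).presheaf.germ ⊤ y (TopologicalSpace.Opens.mem_top _)) := by
    obtain rfl : y = closedPoint k := Subsingleton.elim (α := PrimeSpectrum k) _ _
    have : (Scheme.ΓSpecIso (.of k)).inv ≫ (Spec (.of k)).presheaf.germ ⊤ (closedPoint k)
        (TopologicalSpace.Opens.mem_top _) = (stalkClosedPointIso (.of k)).inv := by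
      rw [Iso.inv_comp_eq]
      exact (ΓSpecIso_hom_stalkClosedPointIso_inv (.of k)).symm
    rw [this]
    infer_instance
  have hmem : pt x ∈ p.smoothLocus := by
    rw [Scheme.Hom.mem_smoothLocus]
    have := hiso (p (pt x))
    refine (RingHom.FormallySmooth.respectsIso.cancel_left_isIso ((Scheme.ΓSpecIso (.of k)).inv ≫
      (Spec (.of k)).presheaf.germ ⊤ (p (pt x)) (TopologicalSpace.Opens.mem_top _))
      (p.stalkMap (pt x))).1 ?_
    have h1 : (p.stalkMap (pt x)).hom.comp ((Scheme.ΓSpecIso (.of k)).inv ≫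
        (Spec (.of k)).presheaf.germ ⊤ (p (pt x)) (TopologicalSpace.Opens.mem_top _)).hom =
        algebraMap k (LocalRingAt p x) := by
      rw [← CommRingCat.hom_comp, Category.assoc, Scheme.Hom.germ_stalkMap]
      refine RingHom.ext fun c ↦ ?_
      change _ = X.presheaf.germ ⊤ (pt x) _ (X.presheaf.map (𝟙 _) _)
      rw [X.presheaf.map_id]
      rfl
    have h2 := (RingHom.formallySmooth_algebraMap (R := k) (S := LocalRingAt p x)).2 hO
    rw [← h1] at h2
    exact h2
  refine ⟨p.smoothLocus, hmem, ?_⟩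
  rw [← Scheme.Hom.smoothLocus_eq_top_iff, ← Scheme.Hom.preimage_smoothLocus_eq]
  ext y
  simp

/-- The variant with the local ring itself in place of a chart, needed because the assumption on the
image arc is stated on the local ring of `Y`. -/
lemma isFormalCompletion_algebraMap {x : Spec (.of k) ⟶ X} (hx : x ≫ p = 𝟙 _)
    [FormalPointAlgebra k (FormalNbhd p x)] : IsFormalCompletion (algebraMap k (LocalRingAt p x))
      (algebraMap (LocalRingAt p x) (FormalNbhd p x)) := by
  refine ⟨fun c ↦ rfl, fun P _ _ _ _ f hf hb ↦ ?_, fun P _ _ _ _ F G h ↦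
    continuousAlgHom_ext_completion h⟩
  exact exists_continuousAlgHom_completion (residueHom p x hx) (maximalIdeal_eq_ker hx)
    { f with commutes' := hf } fun o ↦ (hb o).trans (aug_formalNbhd hx o)

end Scheme

end

end ArcSpaces

theorem mainTheorem3 {k : Type u} [Field k] [CharZero k]
    {X Y : Scheme.{u}} (p : X ⟶ Spec (.of k)) [LocallyOfFiniteType p] [QuasiCompact p]
    (q : Y ⟶ Spec (.of k)) [LocallyOfFiniteType q] [QuasiCompact q]
    (x : Spec (.of k) ⟶ X) (hx : x ≫ p = 𝟙 _) (y : Spec (.of k) ⟶ Y) (hy : y ≫ q = 𝟙 _)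
    {I : Type v}
    (e : FormalNbhd p x ≃A[k] completedTensor k (FormalNbhd q y) (PowerSeriesRing k I))
    (hmin : ¬ HasSmoothFactor k (FormalNbhd q y))
    (α : Spec (.of k) ⟶ arcSpace p) (hα : α ≫ arcSpaceStr p = 𝟙 _)
    (hαx : α ≫ arcSpaceProj p = x)
    (hβ : imageArc p q x y (projHom p e) (arcOfPoint α)
        (hαx ▸ arcOfPoint_closedPoint p α) = arcOfPoint (y ≫ constArcs q)) :
    (∃ J : Type u, Nonempty (FormalNbhd (arcSpaceStr p) α ≃A[k]
      completedTensor k (FormalNbhd (arcSpaceStr q) (y ≫ constArcs q)) (PowerSeriesRing k J))) ∧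
    ¬ HasSmoothFactor k (FormalNbhd (arcSpaceStr q) (y ≫ constArcs q)) ∧
    ((¬ ∃ U : X.Opens, pt x ∈ U ∧ Smooth (U.ι ≫ p)) →
      ¬ HasFiniteFormalModel k (FormalNbhd (arcSpaceStr p) α)) := by
  subst hαx
  have hβk : (y ≫ constArcs q) ≫ arcSpaceStr q = 𝟙 _ := by
    rw [arcSpaceStr, Category.assoc, ← Category.assoc (constArcs q), constArcs_proj,
      Category.id_comp, hy]
  have := formalPointAlgebra_formalNbhd hx
  have := formalPointAlgebra_formalNbhd hy
  have := formalPointAlgebra_formalNbhd hα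
  have := formalPointAlgebra_formalNbhd hβk
  obtain ⟨u', hu', hred'⟩ := exists_isUniversalArc_arcOfPoint hα
  obtain ⟨u, hu, hred⟩ := exists_isUniversalArc_constArcs hy hβk
  have hfree := isFreeExtension_of_equiv.{u, v, u} e
  set a := (e.trans (ctensorEquiv k (FormalNbhd q y) _)).symm.toContinuousAlgHom.comp
    (tensorInl k (FormalNbhd q y) (PowerSeriesRing k I))
  have heq (c : FormalNbhd q y) (n : ℕ) :
      -- The universal deformation of `α`, restricted to `Y`, reduces to the constant arc. This
      -- holds on the local ring of `Y` by `hβ`, and passes to its completion.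
      aug k _ (PowerSeries.coeff n (u' (a c))) = aug k _ (PowerSeries.coeff n (u c)) := by
    open scoped PowerSeries.WithPiTopology in
    refine (isFormalCompletion_algebraMap q hy).aug_coeff_eq (u'.comp a) u (fun o n ↦ ?_) c n
    rw [hred, aug_formalNbhd hy]
    refine (hred' _ n).trans ?_
    refine (congrArg (PowerSeries.coeff n)
      (coeff_arcFormalHom_of_imageArc_eq hy (projHom p e) _ _ hβ o)).trans ?_
    rw [PowerSeries.coeff_C]
  obtain ⟨J, ⟨e'⟩⟩ := hu.exists_nonempty_equiv hu' hfree heq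
  refine ⟨⟨J, ⟨e'⟩⟩, not_hasSmoothFactor_of_isUniversalArc (residueHom q y hy)
    (maximalIdeal_eq_ker hy) hmin hu hred, fun hX ↦ ?_⟩
  -- The formal neighborhood of `α` is now a free extension both of that of the constant arc, by
  -- `e'`, and of a topologically finitely generated algebra, by `e''`. This is the situation of
  -- `snd_eq_zero_of_isFreeExtension`.
  rintro ⟨W, r, _, _, w, hw, L, ⟨e''⟩⟩
  have := formalPointAlgebra_formalNbhd hw
  obtain ⟨m, c, hc⟩ := exists_generators_formalNbhd r hw
  refine hX (exists_smooth_of_exists_lift p hx fun P P' _ _ _ _ _ _ _ _ π hπ f ↦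
    hfree.exists_lift (eq_zero_of_aug_eq_zero ?_) π hπ f)
  exact snd_eq_zero_of_isFreeExtension (residueHom q y hy) (maximalIdeal_eq_ker hy) hmin hu hred
    (isFreeExtension_of_equiv.{u, u, u} e') (isFreeExtension_of_equiv.{u, u, u} e'') c
    (hc (SqZeroAlg k k))
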